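/- Let $\mathcal S_1,\mathcal S_2,\mathcal X_1,\mathcal X_2,\mathcal Y$ be finite sets, $P_{S_1S_2}$ a probability mass function on $\mathcal S_1\times\mathcal S_2$ and $P_{Y|X_1X_2S_1S_2}$ a channel with inputs in $\mathcal X_1,\mathcal X_2$, states in $\mathcal S_1,\mathcal S_2$ and output in $\mathcal Y$. States and channel are memoryless: over $n$ uses, $P(\mathbf s_1,\mathbf s_2)=\prod_{i=1}^n P(s_{1i},s_{2i})$ and $P(\mathbf y|\mathbf x_1,\mathbf x_2,\mathbf s_1,\mathbf s_2)=\prod_{i=1}^n P(y_i|x_{1i},x_{2i},s_{1i},s_{2i})$. A code of length $n$ with rates $R_1,R_2\ge 0$ has message sets $\mathcal W_1,\mathcal W_2$ with $|\mathcal W_i|=\lceil 2^{nR_i}\rceil$, encoders $X_{1,j}=f_{1,j}(W_1,S_1^n,X_2^{j-1})$ and $X_{2,j}=f_{2,j}(W_2,S_2^n,X_1^{j-1})$ for $j=1,\dots,n$ (each encoder knows its own state sequence non-causally and the other encoder's inputs strictly causally), and a decoder $g:\mathcal Y^n\to\mathcal W_1\times\mathcal W_2$. Its error probability $P_e^n$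 is the probability that $g(Y^n)\ne(W_1,W_2)$ for independent, uniformly distributed messages. A pair $(R_1,R_2)$ is achievable if there is a sequence of such codes, one for each length $n$, with $P_e^n\to0$ as $n\to\infty$. The capacity region is the closure of the set of achievable pairs. Consider all triples of finite sets $\mathcal U,\mathcal V_1,\mathcal V_2$ and all joint probability mass functions of the form $$P_{S_1S_2}(s_1,s_2)\,P_U(u)\,P_{X_1V_1|US_1}(x_1,v_1|u,s_1)\,P_{X_2V_2|US_2}(x_2,v_2|u,s_2)\,P_{Y|X_1X_2S_1S_2}(y|x_1,x_2,s_1,s_2),$$ and let $\mathcal R$ be the union, over all of these, of the sets of pairs $(R_1,R_2)$ with $R_1,R_2\ge0$ and $$R_1\le I(X_1;V_1|U,S_2)-I(V_1;S_1|U,S_2),$$ $$R_2\le I(X_2;V_2|U,S_1)-I(V_2;S_2|U,S_1),$$ $$R_1+R_2\le I(Y;V_1,V_2,U)-I(V_1,V_2;S_1,S_2|U),$$ where mutual information is measured in bits. Then $\mathcal R$ is contained in the capacity region. Moreover, every pair $(R_1,R_2)$ with $R_1,R_2\ge0$ that satisfies the three inequalities strictly, for some joint probability mass function of this form, is itself achievable.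 -/

import Mathlib

open Filter Topology

namespace CribMAC

/-! ### Information measures of finite random variables

A probability mass function on a finite sample space `Ω` is a function `p : Ω → ℝ` in
`stdSimplex ℝ Ω`; a random variable is a function on `Ω`. Logarithms are to base 2. -/

section Information

variable {Ω α β γ : Type*} [Fintype Ω] [Fintype α] [Fintype β] [Fintype γ]

open Classical in
/-- The probability mass function of the random variable `A` under `p`, that is `P(A = a)`. -/
noncomputable def law (p : Ω → ℝ) (A : Ω → α) (a : α) : ℝ :=
  ∑ ω, if A ω = a then p ω else 0

/-- The mutual information `I(A; B)` in bits. -/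
noncomputable def mutualInfo (p : Ω → ℝ) (A : Ω → α) (B : Ω → β) : ℝ :=
  ∑ a, ∑ b, law p (fun ω => (A ω, B ω)) (a, b) *
    Real.logb 2 (law p (fun ω => (A ω, B ω)) (a, b) / (law p A a * law p B b))

/-- The conditional mutual information `I(A; B | C)` in bits. -/
noncomputable def condMutualInfo (p : Ω → ℝ) (A : Ω → α) (B : Ω → β) (C : Ω → γ) : ℝ :=
  ∑ a, ∑ b, ∑ c, law p (fun ω => (A ω, B ω, C ω)) (a, b, c) *
    Real.logb 2 (law p (fun ω => (A ω, B ω, C ω)) (a, b, c) * law p C c /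
      (law p (fun ω => (A ω, C ω)) (a, c) * law p (fun ω => (B ω, C ω)) (b, c)))

end Information

/-! ### Codes, error probability, achievable rates -/

/-- A code of length `n` with message sets of sizes `M₁`, `M₂`. In its `j`-th use, encoder `i` sees
its message, its whole state sequence and the inputs of the other encoder at the earlier times. -/
structure Code (S₁ S₂ X₁ X₂ Y : Type*) (n M₁ M₂ : ℕ) where
  enc₁ : (j : Fin n) → Fin M₁ → (Fin n → S₁) → (Fin j → X₂) → X₁
  enc₂ : (j : Fin n) → Fin M₂ → (Fin n → S₂) → (Fin j → X₁) → X₂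
  dec : (Fin n → Y) → Fin M₁ × Fin M₂

section Coding

variable {S₁ S₂ X₁ X₂ Y : Type*} {n M₁ M₂ : ℕ}

/-- The pair of channel inputs at time `j`, by recursion on `j`. -/
def Code.inputs (c : Code S₁ S₂ X₁ X₂ Y n M₁ M₂) (w₁ : Fin M₁) (w₂ : Fin M₂)
    (s₁ : Fin n → S₁) (s₂ : Fin n → S₂) (j : ℕ) (hj : j < n) : X₁ × X₂ :=
  (c.enc₁ ⟨j, hj⟩ w₁ s₁ (fun i => (Code.inputs c w₁ w₂ s₁ s₂ i (i.2.trans hj)).2),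
   c.enc₂ ⟨j, hj⟩ w₂ s₂ (fun i => (Code.inputs c w₁ w₂ s₁ s₂ i (i.2.trans hj)).1))
termination_by j
decreasing_by all_goals exact i.2

/-- The input sequence of encoder 1. -/
def Code.x₁ (c : Code S₁ S₂ X₁ X₂ Y n M₁ M₂) (w₁ : Fin M₁) (w₂ : Fin M₂)
    (s₁ : Fin n → S₁) (s₂ : Fin n → S₂) (j : Fin n) : X₁ :=
  (c.inputs w₁ w₂ s₁ s₂ j j.2).1

/-- The input sequence of encoder 2. -/
def Code.x₂ (c : Code S₁ S₂ X₁ X₂ Y n M₁ M₂) (w₁ : Fin M₁) (w₂ : Fin M₂)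
    (s₁ : Fin n → S₁) (s₂ : Fin n → S₂) (j : Fin n) : X₂ :=
  (c.inputs w₁ w₂ s₁ s₂ j j.2).2

theorem Code.x₁_eq (c : Code S₁ S₂ X₁ X₂ Y n M₁ M₂) (w₁ : Fin M₁) (w₂ : Fin M₂)
    (s₁ : Fin n → S₁) (s₂ : Fin n → S₂) (j : Fin n) :
    c.x₁ w₁ w₂ s₁ s₂ j =
      c.enc₁ j w₁ s₁ (fun i => c.x₂ w₁ w₂ s₁ s₂ ⟨i, i.2.trans j.2⟩) := by
  rw [Code.x₁, Code.inputs]; rfl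

theorem Code.x₂_eq (c : Code S₁ S₂ X₁ X₂ Y n M₁ M₂) (w₁ : Fin M₁) (w₂ : Fin M₂)
    (s₁ : Fin n → S₁) (s₂ : Fin n → S₂) (j : Fin n) :
    c.x₂ w₁ w₂ s₁ s₂ j =
      c.enc₂ j w₂ s₂ (fun i => c.x₁ w₁ w₂ s₁ s₂ ⟨i, i.2.trans j.2⟩) := by
  rw [Code.x₂, Code.inputs]; rfl

variable [Fintype S₁] [Fintype S₂] [Fintype Y]

/-- The average error probability of a code, for the memoryless state law `PS` and the memoryless
channel `W`, where `W x₁ x₂ s₁ s₂ y` is `P(y | x₁, x₂, s₁, s₂)`. -/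
noncomputable def Code.errorProb (PS : S₁ × S₂ → ℝ) (W : X₁ → X₂ → S₁ → S₂ → Y → ℝ)
    (c : Code S₁ S₂ X₁ X₂ Y n M₁ M₂) : ℝ :=
  (1 / ((M₁ : ℝ) * (M₂ : ℝ))) * ∑ w₁ : Fin M₁, ∑ w₂ : Fin M₂,
    ∑ s₁ : Fin n → S₁, ∑ s₂ : Fin n → S₂, ∑ y : Fin n → Y,
      if c.dec y ≠ (w₁, w₂) then
        (∏ i, PS (s₁ i, s₂ i)) *
          ∏ i, W (c.x₁ w₁ w₂ s₁ s₂ i) (c.x₂ w₁ w₂ s₁ s₂ i) (s₁ i) (s₂ i) (y i)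
      else 0

/-- The pairs of nonnegative rates for which there are codes of every length `n`, with
`2 ^ (n R₁)` and `2 ^ (n R₂)` messages (rounded up), whose average error probability tends to 0. -/
def achievableRates (PS : S₁ × S₂ → ℝ) (W : X₁ → X₂ → S₁ → S₂ → Y → ℝ) : Set (ℝ × ℝ) :=
  {R | 0 ≤ R.1 ∧ 0 ≤ R.2 ∧
    ∃ c : (n : ℕ) → Code S₁ S₂ X₁ X₂ Y n
        ⌈(2 : ℝ) ^ ((n : ℝ) * R.1)⌉₊ ⌈(2 : ℝ) ^ ((n : ℝ) * R.2)⌉₊,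
      Tendsto (fun n => (c n).errorProb PS W) atTop (𝓝 0)}

/-- The capacity region: the closure of the set of achievable rate pairs. -/
def capacityRegion (PS : S₁ × S₂ → ℝ) (W : X₁ → X₂ → S₁ → S₂ → Y → ℝ) : Set (ℝ × ℝ) :=
  closure (achievableRates PS W)

end Coding

/-! ### The single-letter region -/

/-- The sample space of `(S₁, S₂, U, V₁, V₂, X₁, X₂, Y)`. -/
abbrev Outcome (S₁ S₂ U V₁ V₂ X₁ X₂ Y : Type*) := S₁ × S₂ × U × V₁ × V₂ × X₁ × X₂ × Y

namespace Outcome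

variable {S₁ S₂ U V₁ V₂ X₁ X₂ Y : Type*}

abbrev s₁ (ω : Outcome S₁ S₂ U V₁ V₂ X₁ X₂ Y) : S₁ := ω.1
abbrev s₂ (ω : Outcome S₁ S₂ U V₁ V₂ X₁ X₂ Y) : S₂ := ω.2.1
abbrev u (ω : Outcome S₁ S₂ U V₁ V₂ X₁ X₂ Y) : U := ω.2.2.1
abbrev v₁ (ω : Outcome S₁ S₂ U V₁ V₂ X₁ X₂ Y) : V₁ := ω.2.2.2.1
abbrev v₂ (ω : Outcome S₁ S₂ U V₁ V₂ X₁ X₂ Y) : V₂ := ω.2.2.2.2.1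
abbrev x₁ (ω : Outcome S₁ S₂ U V₁ V₂ X₁ X₂ Y) : X₁ := ω.2.2.2.2.2.1
abbrev x₂ (ω : Outcome S₁ S₂ U V₁ V₂ X₁ X₂ Y) : X₂ := ω.2.2.2.2.2.2.1
abbrev y (ω : Outcome S₁ S₂ U V₁ V₂ X₁ X₂ Y) : Y := ω.2.2.2.2.2.2.2

end Outcome

section Region

variable {S₁ S₂ U V₁ V₂ X₁ X₂ Y : Type*} [Fintype S₁] [Fintype S₂] [Fintype U] [Fintype V₁]
  [Fintype V₂] [Fintype X₁] [Fintype X₂] [Fintype Y]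

/-- The joint probability mass functions of the form
`P(s₁,s₂) P(u) P(x₁,v₁|u,s₁) P(x₂,v₂|u,s₂) P(y|x₁,x₂,s₁,s₂)`, where the first and the last factor
are given by `PS` and `W`. -/
def jointLaws (PS : S₁ × S₂ → ℝ) (W : X₁ → X₂ → S₁ → S₂ → Y → ℝ) :
    Set (Outcome S₁ S₂ U V₁ V₂ X₁ X₂ Y → ℝ) :=
  {p | ∃ (PU : U → ℝ) (Q₁ : U → S₁ → X₁ × V₁ → ℝ) (Q₂ : U → S₂ → X₂ × V₂ → ℝ),
    PU ∈ stdSimplex ℝ U ∧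
    (∀ u s₁, Q₁ u s₁ ∈ stdSimplex ℝ (X₁ × V₁)) ∧
    (∀ u s₂, Q₂ u s₂ ∈ stdSimplex ℝ (X₂ × V₂)) ∧
    ∀ ω, p ω = PS (ω.s₁, ω.s₂) * PU ω.u * Q₁ ω.u ω.s₁ (ω.x₁, ω.v₁) *
      Q₂ ω.u ω.s₂ (ω.x₂, ω.v₂) * W ω.x₁ ω.x₂ ω.s₁ ω.s₂ ω.y}

/-- `I(X₁; V₁ | U, S₂) - I(V₁; S₁ | U, S₂)` -/
noncomputable def bound₁ (p : Outcome S₁ S₂ U V₁ V₂ X₁ X₂ Y → ℝ) : ℝ :=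
  condMutualInfo p (fun ω => ω.x₁) (fun ω => ω.v₁) (fun ω => (ω.u, ω.s₂)) -
    condMutualInfo p (fun ω => ω.v₁) (fun ω => ω.s₁) (fun ω => (ω.u, ω.s₂))

/-- `I(X₂; V₂ | U, S₁) - I(V₂; S₂ | U, S₁)` -/
noncomputable def bound₂ (p : Outcome S₁ S₂ U V₁ V₂ X₁ X₂ Y → ℝ) : ℝ :=
  condMutualInfo p (fun ω => ω.x₂) (fun ω => ω.v₂) (fun ω => (ω.u, ω.s₁)) -
    condMutualInfo p (fun ω => ω.v₂) (fun ω => ω.s₂) (fun ω => (ω.u, ω.s₁))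

/-- `I(Y; V₁, V₂, U) - I(V₁, V₂; S₁, S₂ | U)` -/
noncomputable def boundSum (p : Outcome S₁ S₂ U V₁ V₂ X₁ X₂ Y → ℝ) : ℝ :=
  mutualInfo p (fun ω => ω.y) (fun ω => (ω.v₁, ω.v₂, ω.u)) -
    condMutualInfo p (fun ω => (ω.v₁, ω.v₂)) (fun ω => (ω.s₁, ω.s₂)) (fun ω => ω.u)

end Region

section Union

variable {S₁ S₂ X₁ X₂ Y : Type*} [Fintype S₁] [Fintype S₂] [Fintype X₁] [Fintype X₂] [Fintype Y]

/-- The rate region: the union, over all finite alphabets of `U`, `V₁`, `V₂` and all joint laws of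
the required form, of the sets of nonnegative rate pairs that satisfy the three inequalities. -/
def rateRegion (PS : S₁ × S₂ → ℝ) (W : X₁ → X₂ → S₁ → S₂ → Y → ℝ) : Set (ℝ × ℝ) :=
  {R | ∃ (U V₁ V₂ : Type) (_ : Fintype U) (_ : Fintype V₁) (_ : Fintype V₂)
      (p : Outcome S₁ S₂ U V₁ V₂ X₁ X₂ Y → ℝ), p ∈ jointLaws PS W ∧
      0 ≤ R.1 ∧ 0 ≤ R.2 ∧ R.1 ≤ bound₁ p ∧ R.2 ≤ bound₂ p ∧ R.1 + R.2 ≤ boundSum p}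

/-- The same union with strict upper bounds on the rates. -/
def strictRateRegion (PS : S₁ × S₂ → ℝ) (W : X₁ → X₂ → S₁ → S₂ → Y → ℝ) : Set (ℝ × ℝ) :=
  {R | ∃ (U V₁ V₂ : Type) (_ : Fintype U) (_ : Fintype V₁) (_ : Fintype V₂)
      (p : Outcome S₁ S₂ U V₁ V₂ X₁ X₂ Y → ℝ), p ∈ jointLaws PS W ∧
      0 ≤ R.1 ∧ 0 ≤ R.2 ∧ R.1 < bound₁ p ∧ R.2 < bound₂ p ∧ R.1 + R.2 < boundSum p}

end Union

end CribMAC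

open CribMAC

/-!
The proof is a random coding argument with block-Markov superposition, cooperation through the
observed inputs, Gel'fand-Pinsker style precoding against the states, and backward decoding.

**Transmission.** Split the `n` channel uses into `B + 1` blocks of length `m` and a remainder. In a
block the encoders share the "old" pair of messages, the one introduced in the previous block, and
each introduces a "fresh" message. The old pair selects a cloud centre `u`, and encoder 1 selects a
codeword `v₁` among those indexed by the old pair, its fresh message and a free index `j`, which lets
it adapt to its state sequence; encoder 2 does the same. At the end of the block each encoder
recovers the other's fresh message from the inputs it has observed and from its own states, so that
the fresh pair is common knowledge when the next block starts. The last block introduces nothing, and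
the receiver works backwards: knowing the fresh pair of a block it looks for the old one. The structure
`BlockCode` collects the maps used within one block, `BlockCode.toCode` builds the code of length
`n`, and `BlockCode.toCode_errorProb_le` bounds its error probability, for any injective labelling of
its messages by sequences of block messages, by the block errors.

**One block.** A `Scheme` packages the data of a random block code in one-shot form: the codeword
laws, the likelihood ratios `r₁`, `r₂` that relate codewords to states, the input laws, and the test
statistics `t₁`, `t₂`, `t`, whose mean under an independently drawn codeword is at most one. The free
index is chosen by a likelihood encoder, at random with probability proportional to the likelihood
ratio. By independence of the codewords and Jensen's inequality for the convex inverse, with `L`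
indices the selected codeword has a law of at least `q r / (1 + r / L)` (`le_sum_likelihood`), which
is close to the ideal law `q r` where `r` is small against `L`. Hence the outcome of encoding follows
essentially the ideal joint law (`Scheme.typicalProb_mul_le`), without a covering lemma. Markov's
inequality bounds the expected number of wrong codewords that pass a test. Since the encoders' maps enter the probability of correct transmission linearly,
both the codebook and the randomized encoders can be replaced by deterministic ones
(`Scheme.exists_blockCode`).

**Asymptotics.** `Scheme.pow` is the memoryless extension of a scheme. By Chebyshev's inequality its
logarithmic ratios concentrate at `m` times their means (`Scheme.exists_le_typicalProb_pow`), and for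
fixed large `B` the sum of the error terms tends to zero (`Scheme.mem_achievableRates`).

**Single-letter bounds.** For the scheme of a joint law the difference of `log t₂` and `log r₁` is, on
the support, the difference of the information densities in `bound₁`; likewise for `bound₂` and
`boundSum` (`TestChannel.bound₁_joint` and its companions). An encoder of rate zero has a single
message, which the other encoder need not recover. Hence `R₁ < bound₁` is required only if `R₁ ≠ 0`,
and every pair `R ≠ 0` of the closed region is the limit of the achievable pairs `(1 - δ) R`, without
any change of the joint law.
-/

namespace CribMAC

/-! ### Sums against product weights -/

section ProductWeights

variable {ι α : Type*} [Fintype ι] [DecidableEq ι] [Fintype α]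

theorem sum_prod_eq_one {μ : ι → α → ℝ} (hμ : ∀ k, ∑ a, μ k a = 1) :
    ∑ c : ι → α, ∏ k, μ k (c k) = 1 := by
  rw [← Fintype.prod_sum]
  simp [hμ]

/-- Under a product law, the coordinate `c i` has law `μ i`. -/
theorem sum_prod_mul_apply {μ : ι → α → ℝ} (hμ : ∀ k, ∑ a, μ k a = 1) (i : ι) (f : α → ℝ) :
    ∑ c : ι → α, (∏ k, μ k (c k)) * f (c i) = ∑ a, μ i a * f a := by
  have h : ∀ c : ι → α, (∏ k, μ k (c k)) * f (c i) =
      ∏ k, μ k (c k) * (if k = i then f (c k) else 1) := by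
    intro c
    rw [Finset.prod_mul_distrib, Finset.prod_ite_eq' Finset.univ i (fun k => f (c k))]
    simp
  simp_rw [h]
  rw [← Fintype.prod_sum (fun k a => μ k a * (if k = i then f a else 1)),
    Finset.prod_eq_single i]
  · simp
  · intro k _ hk
    simp [hk, hμ]
  · simp

/-- Under a product law, distinct coordinates are independent. -/
theorem sum_prod_mul_apply_mul_apply {μ : ι → α → ℝ} (hμ : ∀ k, ∑ a, μ k a = 1) {i j : ι}
    (hij : i ≠ j) (f g : α → ℝ) :
    ∑ c : ι → α, (∏ k, μ k (c k)) * (f (c i) * g (c j)) =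
      (∑ a, μ i a * f a) * ∑ a, μ j a * g a := by
  have h : ∀ c : ι → α, (∏ k, μ k (c k)) * (f (c i) * g (c j)) =
      ∏ k, μ k (c k) * ((if k = i then f (c k) else 1) * (if k = j then g (c k) else 1)) := by
    intro c
    rw [Finset.prod_mul_distrib, Finset.prod_mul_distrib,
      Finset.prod_ite_eq' Finset.univ i (fun k => f (c k)),
      Finset.prod_ite_eq' Finset.univ j (fun k => g (c k))]
    simp
  simp_rw [h]
  rw [← Fintype.prod_sum
      (fun k a => μ k a * ((if k = i then f a else 1) * (if k = j then g a else 1))),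
    Finset.prod_eq_mul i j hij]
  · simp [hij, hij.symm]
  · intro k _ hk
    simp [hk.1, hk.2, hμ]
  · simp
  · simp

theorem exists_le_of_sum_mul_le {μ : α → ℝ} (h0 : ∀ a, 0 ≤ μ a) (h1 : ∑ a, μ a = 1)
    {f : α → ℝ} {b : ℝ} (h : b ≤ ∑ a, μ a * f a) : ∃ a, b ≤ f a := by
  by_contra! hc
  have : ∑ a, μ a * f a < ∑ a, μ a * b := by
    apply Finset.sum_lt_sum
    · exact fun a _ => mul_le_mul_of_nonneg_left (hc a).le (h0 a)
    · by_contra! hn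
      have : ∑ a, μ a ≤ 0 := Finset.sum_nonpos fun a _ => by
        by_contra! hp
        exact absurd (hn a (Finset.mem_univ a)) (not_le.mpr (mul_lt_mul_of_pos_left (hc a) hp))
      linarith
  rw [← Finset.sum_mul, h1, one_mul] at this
  linarith

end ProductWeights

/-! ### Likelihood encoding -/

/-- Draw `a j`, `j : J`, independently from `q` and choose the index `j` with probability
proportional to `r (a j)`. The chosen value then has a law that is at least
`q v * r v / (1 + r v / |J|)`. By convexity of the inverse the random normalization can be
replaced by its mean, given `a j`, which is at most `r (a j) + |J|`. -/
theorem le_sum_likelihood {J V : Type*} [Fintype J] [DecidableEq J] [Nonempty J] [Fintype V]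
    {q r φ : V → ℝ} (hq : q ∈ stdSimplex ℝ V) (hr : ∀ v, 0 ≤ r v) (hqr : ∑ v, q v * r v ≤ 1)
    (hφ : ∀ v, 0 ≤ φ v) :
    ∑ v, q v * r v * φ v / (1 + r v / Fintype.card J) ≤
      ∑ a : J → V, (∏ k, q (a k)) * ∑ j, r (a j) / (∑ k, r (a k)) * φ (a j) := by
  set L : ℝ := ((Fintype.card J : ℕ) : ℝ) with hL
  have hL0 : 0 < L := by simp [hL, Fintype.card_pos]
  have hpos : ∀ v, 0 < r v + L := fun v => by have := hr v; linarith
  -- the tangent line of the inverse at `r (a j) + L`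
  have tangent : ∀ (a : J → V) (j : J),
      r (a j) * φ (a j) * (2 / (r (a j) + L) - r (a j) / (r (a j) + L) ^ 2) -
        ∑ k ∈ Finset.univ.erase j, r (a j) * φ (a j) / (r (a j) + L) ^ 2 * r (a k) ≤
      r (a j) / (∑ k, r (a k)) * φ (a j) := by
    intro a j
    rw [← Finset.mul_sum]
    have hs : ∑ k, r (a k) = r (a j) + ∑ k ∈ Finset.univ.erase j, r (a k) :=
      (Finset.add_sum_erase _ _ (Finset.mem_univ j)).symm
    have hs0 : 0 ≤ ∑ k ∈ Finset.univ.erase j, r (a k) := Finset.sum_nonneg fun k _ => hr _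
    rw [hs]
    set σ := ∑ k ∈ Finset.univ.erase j, r (a k)
    rcases (hr (a j)).eq_or_lt with h0 | h0
    · simp [← h0]
    · have hA := hpos (a j)
      set A := r (a j) + L
      have key : 2 / A - (r (a j) + σ) / A ^ 2 ≤ 1 / (r (a j) + σ) := by
        have hx : 0 < r (a j) + σ := by linarith
        rw [div_sub_div _ _ hA.ne' (by positivity), div_le_div_iff₀ (by positivity) hx]
        nlinarith [sq_nonneg (A - (r (a j) + σ)), mul_nonneg hA.le (sq_nonneg (A - (r (a j) + σ)))]
      have := mul_le_mul_of_nonneg_left key (mul_nonneg h0.le (hφ (a j)))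
      calc _ = r (a j) * φ (a j) * (2 / A - (r (a j) + σ) / A ^ 2) := by ring
        _ ≤ _ := this
        _ = _ := by ring
  have step : ∀ j : J, ∑ v, q v * (r v * φ v / (r v + L)) ≤
      ∑ a : J → V, (∏ k, q (a k)) * (r (a j) / (∑ k, r (a k)) * φ (a j)) := by
    intro j
    calc ∑ v, q v * (r v * φ v / (r v + L))
        ≤ ∑ v, q v * (r v * φ v * (2 / (r v + L) - r v / (r v + L) ^ 2)) -
            ∑ k ∈ Finset.univ.erase j,
              (∑ v, q v * (r v * φ v / (r v + L) ^ 2)) * ∑ v, q v * r v := by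
          rw [Finset.sum_const, Finset.card_erase_of_mem (Finset.mem_univ j), Finset.card_univ,
            nsmul_eq_mul, Nat.cast_sub Fintype.card_pos, ← hL, Nat.cast_one]
          have h1 : (L - 1) * ((∑ v, q v * (r v * φ v / (r v + L) ^ 2)) * ∑ v, q v * r v) ≤
              L * ∑ v, q v * (r v * φ v / (r v + L) ^ 2) := by
            have hc : 0 ≤ ∑ v, q v * (r v * φ v / (r v + L) ^ 2) :=
              Finset.sum_nonneg fun v _ => mul_nonneg (hq.1 v)
                (div_nonneg (mul_nonneg (hr v) (hφ v)) (sq_nonneg _))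
            have hd : 0 ≤ ∑ v, q v * r v :=
              Finset.sum_nonneg fun v _ => mul_nonneg (hq.1 v) (hr v)
            have hL1 : 1 ≤ L := by
              rw [hL]; exact_mod_cast Fintype.card_pos (α := J)
            nlinarith [mul_le_mul_of_nonneg_left hqr hc, mul_nonneg hc hd]
          have h2 : ∑ v, q v * (r v * φ v / (r v + L)) =
              ∑ v, q v * (r v * φ v * (2 / (r v + L) - r v / (r v + L) ^ 2)) -
                L * ∑ v, q v * (r v * φ v / (r v + L) ^ 2) := by
            rw [Finset.mul_sum, ← Finset.sum_sub_distrib]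
            refine Finset.sum_congr rfl fun v _ => ?_
            have := (hpos v).ne'
            field_simp
            ring
          linarith
      _ = ∑ a : J → V, (∏ k, q (a k)) *
            (r (a j) * φ (a j) * (2 / (r (a j) + L) - r (a j) / (r (a j) + L) ^ 2) -
              ∑ k ∈ Finset.univ.erase j, r (a j) * φ (a j) / (r (a j) + L) ^ 2 * r (a k)) := by
          have hA := sum_prod_mul_apply (fun _ : J => hq.2) j
            (fun v => r v * φ v * (2 / (r v + L) - r v / (r v + L) ^ 2))
          have hB : ∀ k ∈ Finset.univ.erase j, _ := fun k hk =>
            sum_prod_mul_apply_mul_apply (fun _ : J => hq.2) (Finset.ne_of_mem_erase hk).symm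
              (fun v => r v * φ v / (r v + L) ^ 2) r
          rw [← hA, ← Finset.sum_congr rfl hB, Finset.sum_comm, ← Finset.sum_sub_distrib]
          refine Finset.sum_congr rfl fun a _ => ?_
          rw [← Finset.mul_sum, ← mul_sub]
      _ ≤ _ := Finset.sum_le_sum fun a _ => mul_le_mul_of_nonneg_left (tangent a j)
          (Finset.prod_nonneg fun k _ => hq.1 _)
  calc ∑ v, q v * r v * φ v / (1 + r v / L)
      = ∑ _j : J, ∑ v, q v * (r v * φ v / (r v + L)) := by
        rw [Finset.sum_const, Finset.card_univ, nsmul_eq_mul, ← hL, Finset.mul_sum]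
        refine Finset.sum_congr rfl fun v _ => ?_
        have := (hpos v).ne'
        have h2 : 1 + r v / L = (r v + L) / L := by field_simp; ring
        rw [h2]
        field_simp
    _ ≤ ∑ j, ∑ a : J → V, (∏ k, q (a k)) * (r (a j) / (∑ k, r (a k)) * φ (a j)) :=
        Finset.sum_le_sum fun j _ => step j
    _ = _ := by
        rw [Finset.sum_comm]
        exact Finset.sum_congr rfl fun a _ => by rw [Finset.mul_sum]

/-! ### Replacing stochastic maps by deterministic ones -/

/-- A weighted sum that is linear in a stochastic map `K` is not decreased when `K` is replaced by
a suitable deterministic map. -/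
theorem exists_map_sum_le {I A X : Type*} [Fintype I] [Fintype A] [Fintype X] [Nonempty X]
    (α : I → A) {K : A → X → ℝ} (h0 : ∀ a x, 0 ≤ K a x) (h1 : ∀ a, ∑ x, K a x ≤ 1)
    {h : I → X → ℝ} (hh : ∀ i x, 0 ≤ h i x) :
    ∃ f : A → X, ∑ i, ∑ x, K (α i) x * h i x ≤ ∑ i, h i (f (α i)) := by
  classical
  have : ∀ a, ∃ x₀, ∀ x, ∑ i with α i = a, h i x ≤ ∑ i with α i = a, h i x₀ :=
    fun a => Finite.exists_max _
  choose f hf using this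
  refine ⟨f, ?_⟩
  rw [← Finset.sum_fiberwise Finset.univ α (fun i => ∑ x, K (α i) x * h i x),
    ← Finset.sum_fiberwise Finset.univ α (fun i => h i (f (α i)))]
  refine Finset.sum_le_sum fun a _ => ?_
  calc ∑ i with α i = a, ∑ x, K (α i) x * h i x
      = ∑ x, K a x * ∑ i with α i = a, h i x := by
        rw [Finset.sum_comm]
        refine Finset.sum_congr rfl fun x _ => ?_
        rw [Finset.mul_sum]
        refine Finset.sum_congr rfl fun i hi => ?_
        rw [(Finset.mem_filter.mp hi).2]
    _ ≤ ∑ x, K a x * ∑ i with α i = a, h i (f a) :=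
        Finset.sum_le_sum fun x _ => mul_le_mul_of_nonneg_left (hf a x) (h0 a x)
    _ = (∑ x, K a x) * ∑ i with α i = a, h i (f a) := (Finset.sum_mul _ _ _).symm
    _ ≤ ∑ i with α i = a, h i (f a) :=
        mul_le_of_le_one_left (Finset.sum_nonneg fun i _ => hh _ _) (h1 a)
    _ = ∑ i with α i = a, h i (f (α i)) :=
        Finset.sum_congr rfl fun i hi => by rw [(Finset.mem_filter.mp hi).2]

theorem exists_maps_sum_le {I A₁ A₂ X₁ X₂ : Type*} [Fintype I] [Fintype A₁] [Fintype A₂]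
    [Fintype X₁] [Fintype X₂] [Nonempty X₁] [Nonempty X₂] (α₁ : I → A₁) (α₂ : I → A₂)
    {K₁ : A₁ → X₁ → ℝ} (h₁0 : ∀ a x, 0 ≤ K₁ a x) (h₁1 : ∀ a, ∑ x, K₁ a x ≤ 1)
    {K₂ : A₂ → X₂ → ℝ} (h₂0 : ∀ a x, 0 ≤ K₂ a x) (h₂1 : ∀ a, ∑ x, K₂ a x ≤ 1)
    {h : I → X₁ → X₂ → ℝ} (hh : ∀ i x₁ x₂, 0 ≤ h i x₁ x₂) :
    ∃ (f₁ : A₁ → X₁) (f₂ : A₂ → X₂),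
      ∑ i, ∑ x₁, ∑ x₂, K₁ (α₁ i) x₁ * K₂ (α₂ i) x₂ * h i x₁ x₂ ≤
        ∑ i, h i (f₁ (α₁ i)) (f₂ (α₂ i)) := by
  obtain ⟨f₁, hf₁⟩ := exists_map_sum_le α₁ h₁0 h₁1
    (h := fun i x₁ => ∑ x₂, K₂ (α₂ i) x₂ * h i x₁ x₂)
    (fun i x₁ => Finset.sum_nonneg fun x₂ _ => mul_nonneg (h₂0 _ _) (hh _ _ _))
  obtain ⟨f₂, hf₂⟩ := exists_map_sum_le α₂ h₂0 h₂1
    (h := fun i x₂ => h i (f₁ (α₁ i)) x₂) (fun i x₂ => hh _ _ _)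
  refine ⟨f₁, f₂, le_trans (le_of_eq ?_) (hf₁.trans hf₂)⟩
  simp_rw [Finset.mul_sum, mul_assoc]

/-! ### One block of transmission -/

/-- A code for one block of a block-Markov scheme, in which the whole block counts as a single
channel use. The first argument of the encoders is the pair of messages of the previous block, the
second one is the fresh message. After the block, encoder 1 uses `crib₁` to find the fresh message
of encoder 2 from the inputs of encoder 2, and vice versa. The receiver, which knows the pair of
fresh messages from decoding the next block, uses `dec` to find the pair of the previous block. -/
structure BlockCode (S₁ S₂ X₁ X₂ Y W₁ W₂ : Type*) where
  enc₁ : W₁ × W₂ → W₁ → S₁ → X₁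
  enc₂ : W₁ × W₂ → W₂ → S₂ → X₂
  crib₁ : W₁ × W₂ → S₁ → X₂ → W₂
  crib₂ : W₁ × W₂ → S₂ → X₁ → W₁
  dec : W₁ × W₂ → Y → W₁ × W₂

section BlockCode

variable {S₁ S₂ X₁ X₂ Y W₁ W₂ : Type*}

/-- Both encoders and the receiver find the messages that they look for, when `o` and `w` are the
message pairs of the previous block and of this one. -/
def BlockCode.Correct (c : BlockCode S₁ S₂ X₁ X₂ Y W₁ W₂) (o w : W₁ × W₂) (s₁ : S₁) (s₂ : S₂)
    (y : Y) : Prop :=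
  c.crib₁ o s₁ (c.enc₂ o w.2 s₂) = w.2 ∧ c.crib₂ o s₂ (c.enc₁ o w.1 s₁) = w.1 ∧ c.dec w y = o

open Classical in
/-- The probability of `BlockCode.Correct`. -/
noncomputable def BlockCode.correctProb [Fintype S₁] [Fintype S₂] [Fintype Y]
    (PS : S₁ × S₂ → ℝ) (W : X₁ → X₂ → S₁ → S₂ → Y → ℝ)
    (c : BlockCode S₁ S₂ X₁ X₂ Y W₁ W₂) (o w : W₁ × W₂) : ℝ :=
  ∑ s₁, ∑ s₂, ∑ y, if c.Correct o w s₁ s₂ y then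
    PS (s₁, s₂) * W (c.enc₁ o w.1 s₁) (c.enc₂ o w.2 s₂) s₁ s₂ y else 0

end BlockCode

/-- The data of the random coding argument for a single block.

Codewords of the two encoders are drawn from `q₁ u` and `q₂ u`, where the cloud center `u` is drawn
from `PU`. The functions `r₁` and `r₂` stand for the likelihood ratios `P(v₁|u,s₁) / P(v₁|u)` and
`P(v₂|u,s₂) / P(v₂|u)`, and `k₁` and `k₂` for the conditional laws of the inputs. The functions `t₁`
and `t₂` are the statistics with which the encoders recognize the codeword of each other, and `t` is
the statistic of the receiver. The last three conditions express that a statistic has mean at most 1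
when the codeword is independent of the observation; by Markov's inequality it then exceeds a
threshold `T` with probability at most `1 / T`. -/
structure Scheme (S₁ S₂ X₁ X₂ Y U V₁ V₂ : Type*) [Fintype X₁] [Fintype X₂] [Fintype U] [Fintype V₁]
    [Fintype V₂] where
  PU : U → ℝ
  q₁ : U → V₁ → ℝ
  q₂ : U → V₂ → ℝ
  r₁ : U → S₁ → V₁ → ℝ
  r₂ : U → S₂ → V₂ → ℝ
  k₁ : U → S₁ → V₁ → X₁ → ℝ
  k₂ : U → S₂ → V₂ → X₂ → ℝ
  t₁ : U → V₂ → X₂ → S₁ → ℝ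
  t₂ : U → V₁ → X₁ → S₂ → ℝ
  t : U → V₁ → V₂ → Y → ℝ
  PU_mem : PU ∈ stdSimplex ℝ U
  q₁_mem : ∀ u, q₁ u ∈ stdSimplex ℝ V₁
  q₂_mem : ∀ u, q₂ u ∈ stdSimplex ℝ V₂
  r₁_nonneg : ∀ u s v, 0 ≤ r₁ u s v
  r₂_nonneg : ∀ u s v, 0 ≤ r₂ u s v
  k₁_nonneg : ∀ u s v x, 0 ≤ k₁ u s v x
  k₂_nonneg : ∀ u s v x, 0 ≤ k₂ u s v x
  t₁_nonneg : ∀ u v x s, 0 ≤ t₁ u v x s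
  t₂_nonneg : ∀ u v x s, 0 ≤ t₂ u v x s
  t_nonneg : ∀ u v₁ v₂ y, 0 ≤ t u v₁ v₂ y
  sum_r₁_le : ∀ u s, ∑ v, q₁ u v * r₁ u s v ≤ 1
  sum_r₂_le : ∀ u s, ∑ v, q₂ u v * r₂ u s v ≤ 1
  sum_k₁_le : ∀ u s v, ∑ x, k₁ u s v x ≤ 1
  sum_k₂_le : ∀ u s v, ∑ x, k₂ u s v x ≤ 1
  sum_t₁_le : ∀ u x s, ∑ v, q₂ u v * t₁ u v x s ≤ 1
  sum_t₂_le : ∀ u x s, ∑ v, q₁ u v * t₂ u v x s ≤ 1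
  sum_t_le : ∀ y, ∑ u, ∑ v₁, ∑ v₂, PU u * q₁ u v₁ * q₂ u v₂ * t u v₁ v₂ y ≤ 1

namespace Scheme

variable {S₁ S₂ X₁ X₂ Y U V₁ V₂ : Type*} [Fintype X₁] [Fintype X₂] [Fintype U] [Fintype V₁]
  [Fintype V₂]

/-- The joint law of states, auxiliary variables, inputs and output that the scheme emulates. -/
def jointLaw (σ : Scheme S₁ S₂ X₁ X₂ Y U V₁ V₂) (PS : S₁ × S₂ → ℝ)
    (W : X₁ → X₂ → S₁ → S₂ → Y → ℝ) (ω : Outcome S₁ S₂ U V₁ V₂ X₁ X₂ Y) : ℝ :=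
  PS (ω.s₁, ω.s₂) * σ.PU ω.u * (σ.q₁ ω.u ω.v₁ * σ.r₁ ω.u ω.s₁ ω.v₁ * σ.k₁ ω.u ω.s₁ ω.v₁ ω.x₁) *
    (σ.q₂ ω.u ω.v₂ * σ.r₂ ω.u ω.s₂ ω.v₂ * σ.k₂ ω.u ω.s₂ ω.v₂ ω.x₂) * W ω.x₁ ω.x₂ ω.s₁ ω.s₂ ω.y

/-- The likelihood ratios are at most `D₁`, `D₂` and the test statistics exceed `T₁`, `T₂`, `T`. -/
def Typical (σ : Scheme S₁ S₂ X₁ X₂ Y U V₁ V₂) (D₁ D₂ T₁ T₂ T : ℝ)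
    (ω : Outcome S₁ S₂ U V₁ V₂ X₁ X₂ Y) : Prop :=
  (σ.r₁ ω.u ω.s₁ ω.v₁ ≤ D₁ ∧ σ.r₂ ω.u ω.s₂ ω.v₂ ≤ D₂) ∧
    T₂ < σ.t₂ ω.u ω.v₁ ω.x₁ ω.s₂ ∧ T₁ < σ.t₁ ω.u ω.v₂ ω.x₂ ω.s₁ ∧ T < σ.t ω.u ω.v₁ ω.v₂ ω.y

theorem jointLaw_nonneg (σ : Scheme S₁ S₂ X₁ X₂ Y U V₁ V₂) {PS : S₁ × S₂ → ℝ}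
    {W : X₁ → X₂ → S₁ → S₂ → Y → ℝ} (hPS : ∀ s, 0 ≤ PS s) (hW : ∀ x₁ x₂ s₁ s₂ y, 0 ≤ W x₁ x₂ s₁ s₂ y)
    (ω : Outcome S₁ S₂ U V₁ V₂ X₁ X₂ Y) : 0 ≤ σ.jointLaw PS W ω := by
  have h1 := hPS (ω.s₁, ω.s₂)
  have h2 := σ.PU_mem.1 ω.u
  have h3 := (σ.q₁_mem ω.u).1 ω.v₁
  have h4 := (σ.q₂_mem ω.u).1 ω.v₂
  have h5 := σ.r₁_nonneg ω.u ω.s₁ ω.v₁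
  have h6 := σ.r₂_nonneg ω.u ω.s₂ ω.v₂
  have h7 := σ.k₁_nonneg ω.u ω.s₁ ω.v₁ ω.x₁
  have h8 := σ.k₂_nonneg ω.u ω.s₂ ω.v₂ ω.x₂
  have h9 := hW ω.x₁ ω.x₂ ω.s₁ ω.s₂ ω.y
  unfold jointLaw
  positivity

variable [Fintype S₁] [Fintype S₂] [Fintype Y]

open Classical in
/-- The probability of `Scheme.Typical` under the joint law of the scheme. -/
noncomputable def typicalProb (σ : Scheme S₁ S₂ X₁ X₂ Y U V₁ V₂) (PS : S₁ × S₂ → ℝ)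
    (W : X₁ → X₂ → S₁ → S₂ → Y → ℝ) (D₁ D₂ T₁ T₂ T : ℝ) : ℝ :=
  ∑ ω, if σ.Typical D₁ D₂ T₁ T₂ T ω then σ.jointLaw PS W ω else 0

theorem typicalProb_nonneg (σ : Scheme S₁ S₂ X₁ X₂ Y U V₁ V₂) {PS : S₁ × S₂ → ℝ}
    {W : X₁ → X₂ → S₁ → S₂ → Y → ℝ} (hPS : ∀ s, 0 ≤ PS s) (hW : ∀ x₁ x₂ s₁ s₂ y, 0 ≤ W x₁ x₂ s₁ s₂ y)
    (D₁ D₂ T₁ T₂ T : ℝ) : 0 ≤ σ.typicalProb PS W D₁ D₂ T₁ T₂ T := by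
  refine Finset.sum_nonneg fun ω _ => ?_
  split_ifs
  · exact σ.jointLaw_nonneg hPS hW ω
  · exact le_rfl

end Scheme

/-! ### The random codebook of one block -/

/-- The part of a codebook that belongs to one message pair of the previous block: a cloud center,
and for each fresh message of each encoder a list of satellite codewords. -/
abbrev Cluster (U V₁ V₂ W₁ W₂ J₁ J₂ : Type*) := U × (W₁ → J₁ → V₁) × (W₂ → J₂ → V₂)

section Cluster

variable {S₁ S₂ X₁ X₂ Y U V₁ V₂ : Type*} [Fintype X₁] [Fintype X₂] [Fintype U] [Fintype V₁]
  [Fintype V₂] {W₁ W₂ J₁ J₂ : Type*} [Fintype W₁] [Fintype W₂] [Fintype J₁] [Fintype J₂]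

/-- The law of a cluster: all codewords are conditionally independent, given the cloud center. -/
def Scheme.clusterLaw (σ : Scheme S₁ S₂ X₁ X₂ Y U V₁ V₂) (cl : Cluster U V₁ V₂ W₁ W₂ J₁ J₂) : ℝ :=
  σ.PU cl.1 * ((∏ w, ∏ j, σ.q₁ cl.1 (cl.2.1 w j)) * ∏ w, ∏ j, σ.q₂ cl.1 (cl.2.2 w j))

variable [DecidableEq W₁] [DecidableEq W₂] [DecidableEq J₁] [DecidableEq J₂]

theorem prod_prod_mem_stdSimplex {V : Type*} [Fintype V] {q : V → ℝ} (hq : q ∈ stdSimplex ℝ V) :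
    (fun c : W₁ → J₁ → V => ∏ w, ∏ j, q (c w j)) ∈ stdSimplex ℝ (W₁ → J₁ → V) :=
  ⟨fun _ => Finset.prod_nonneg fun _ _ => Finset.prod_nonneg fun _ _ => hq.1 _,
    sum_prod_eq_one (μ := fun _ (a : J₁ → V) => ∏ j, q (a j))
      fun _ => sum_prod_eq_one fun _ => hq.2⟩

theorem sum_prod_prod_mul_apply {V : Type*} [Fintype V] {q : V → ℝ} (hq : ∑ v, q v = 1) (w : W₁)
    (f : (J₁ → V) → ℝ) :
    ∑ c : W₁ → J₁ → V, (∏ w, ∏ j, q (c w j)) * f (c w) = ∑ a : J₁ → V, (∏ j, q (a j)) * f a :=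
  sum_prod_mul_apply (μ := fun _ (a : J₁ → V) => ∏ j, q (a j))
    (fun _ => sum_prod_eq_one fun _ => hq) w f

theorem sum_prod_prod_mul_apply_mul {V : Type*} [Fintype V] {q : V → ℝ} (hq : ∑ v, q v = 1)
    {w w' : W₁} (hw : w ≠ w') (j : J₁) (f : (J₁ → V) → ℝ) (g : V → ℝ) :
    ∑ c : W₁ → J₁ → V, (∏ w, ∏ j, q (c w j)) * (f (c w) * g (c w' j)) =
      (∑ c : W₁ → J₁ → V, (∏ w, ∏ j, q (c w j)) * f (c w)) * ∑ v, q v * g v := by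
  rw [sum_prod_prod_mul_apply hq]
  have := sum_prod_mul_apply_mul_apply (μ := fun _ (a : J₁ → V) => ∏ j, q (a j))
    (fun _ => sum_prod_eq_one fun _ => hq) hw f (fun a => g (a j))
  rw [this, sum_prod_mul_apply (fun _ => hq) j g]

namespace Scheme

variable (σ : Scheme S₁ S₂ X₁ X₂ Y U V₁ V₂)

theorem sum_clusterLaw_mul (f : Cluster U V₁ V₂ W₁ W₂ J₁ J₂ → ℝ) :
    ∑ cl, σ.clusterLaw cl * f cl =
      ∑ u, σ.PU u * ∑ c₁ : W₁ → J₁ → V₁, (∏ w, ∏ j, σ.q₁ u (c₁ w j)) *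
        ∑ c₂ : W₂ → J₂ → V₂, (∏ w, ∏ j, σ.q₂ u (c₂ w j)) * f (u, c₁, c₂) := by
  simp only [Fintype.sum_prod_type, clusterLaw, Finset.mul_sum, mul_assoc]

theorem sum_clusterLaw_mul' (f : Cluster U V₁ V₂ W₁ W₂ J₁ J₂ → ℝ) :
    ∑ cl, σ.clusterLaw cl * f cl =
      ∑ u, σ.PU u * ∑ c₂ : W₂ → J₂ → V₂, (∏ w, ∏ j, σ.q₂ u (c₂ w j)) *
        ∑ c₁ : W₁ → J₁ → V₁, (∏ w, ∏ j, σ.q₁ u (c₁ w j)) * f (u, c₁, c₂) := by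
  rw [sum_clusterLaw_mul]
  refine Finset.sum_congr rfl fun u _ => ?_
  congr 1
  simp only [Finset.mul_sum]
  rw [Finset.sum_comm]
  refine Finset.sum_congr rfl fun c₂ _ => Finset.sum_congr rfl fun c₁ _ => ?_
  ring

theorem clusterLaw_nonneg (cl : Cluster U V₁ V₂ W₁ W₂ J₁ J₂) : 0 ≤ σ.clusterLaw cl :=
  mul_nonneg (σ.PU_mem.1 _) (mul_nonneg ((prod_prod_mem_stdSimplex (σ.q₁_mem _)).1 _)
    ((prod_prod_mem_stdSimplex (σ.q₂_mem _)).1 _))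

theorem sum_clusterLaw : ∑ cl : Cluster U V₁ V₂ W₁ W₂ J₁ J₂, σ.clusterLaw cl = 1 := by
  have := σ.sum_clusterLaw_mul (fun _ : Cluster U V₁ V₂ W₁ W₂ J₁ J₂ => 1)
  simp only [mul_one] at this
  rw [this]
  have h1 := fun u => (prod_prod_mem_stdSimplex (W₁ := W₁) (J₁ := J₁) (σ.q₁_mem u)).2
  have h2 := fun u => (prod_prod_mem_stdSimplex (W₁ := W₂) (J₁ := J₂) (σ.q₂_mem u)).2
  simp [h1, h2, σ.PU_mem.2]

open Classical in
/-- Markov's inequality. -/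
theorem sum_mul_indicator_le {V : Type*} [Fintype V] {q t : V → ℝ} (hq : ∀ v, 0 ≤ q v)
    (ht : ∀ v, 0 ≤ t v) (h : ∑ v, q v * t v ≤ 1) {T : ℝ} (hT : 0 < T) :
    ∑ v, q v * (if T < t v then 1 else 0) ≤ 1 / T := by
  rw [le_div_iff₀ hT, Finset.sum_mul]
  refine le_trans (Finset.sum_le_sum fun v _ => ?_) h
  rw [mul_assoc]
  refine mul_le_mul_of_nonneg_left ?_ (hq v)
  split_ifs with hv
  · linarith
  · simpa using ht v

open Classical in
/-- The codewords of encoder 1 for a wrong message are independent of the right ones, so that each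
of them passes the test of encoder 2 with probability at most `1 / T`. -/
theorem sum_clusterLaw_crib₂_le {w₁ w₁' : W₁} (hw : w₁ ≠ w₁') (w₂ : W₂) (j : J₁)
    {f : U → (J₁ → V₁) → (J₂ → V₂) → ℝ} (hf : ∀ u a b, 0 ≤ f u a b) (x : X₁) (s : S₂) {T : ℝ}
    (hT : 0 < T) :
    ∑ cl : Cluster U V₁ V₂ W₁ W₂ J₁ J₂, σ.clusterLaw cl *
        (f cl.1 (cl.2.1 w₁) (cl.2.2 w₂) * if T < σ.t₂ cl.1 (cl.2.1 w₁' j) x s then 1 else 0) ≤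
      (∑ cl : Cluster U V₁ V₂ W₁ W₂ J₁ J₂, σ.clusterLaw cl *
        f cl.1 (cl.2.1 w₁) (cl.2.2 w₂)) * (1 / T) := by
  rw [σ.sum_clusterLaw_mul', σ.sum_clusterLaw_mul', Finset.sum_mul]
  refine Finset.sum_le_sum fun u _ => ?_
  rw [mul_assoc, Finset.sum_mul]
  refine mul_le_mul_of_nonneg_left (Finset.sum_le_sum fun c₂ _ => ?_) (σ.PU_mem.1 u)
  rw [mul_assoc]
  refine mul_le_mul_of_nonneg_left ?_ ((prod_prod_mem_stdSimplex (σ.q₂_mem u)).1 c₂)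
  rw [sum_prod_prod_mul_apply_mul (σ.q₁_mem u).2 hw j (fun a => f u a (c₂ w₂))
    (fun v => if T < σ.t₂ u v x s then 1 else 0)]
  refine mul_le_mul_of_nonneg_left
    (sum_mul_indicator_le (σ.q₁_mem u).1 (fun v => σ.t₂_nonneg _ _ _ _) (σ.sum_t₂_le u x s) hT) ?_
  exact Finset.sum_nonneg fun c₁ _ =>
    mul_nonneg ((prod_prod_mem_stdSimplex (σ.q₁_mem u)).1 c₁) (hf _ _ _)

open Classical in
theorem sum_clusterLaw_crib₁_le {w₂ w₂' : W₂} (hw : w₂ ≠ w₂') (w₁ : W₁) (j : J₂)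
    {f : U → (J₁ → V₁) → (J₂ → V₂) → ℝ} (hf : ∀ u a b, 0 ≤ f u a b) (x : X₂) (s : S₁) {T : ℝ}
    (hT : 0 < T) :
    ∑ cl : Cluster U V₁ V₂ W₁ W₂ J₁ J₂, σ.clusterLaw cl *
        (f cl.1 (cl.2.1 w₁) (cl.2.2 w₂) * if T < σ.t₁ cl.1 (cl.2.2 w₂' j) x s then 1 else 0) ≤
      (∑ cl : Cluster U V₁ V₂ W₁ W₂ J₁ J₂, σ.clusterLaw cl *
        f cl.1 (cl.2.1 w₁) (cl.2.2 w₂)) * (1 / T) := by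
  rw [σ.sum_clusterLaw_mul, σ.sum_clusterLaw_mul, Finset.sum_mul]
  refine Finset.sum_le_sum fun u _ => ?_
  rw [mul_assoc, Finset.sum_mul]
  refine mul_le_mul_of_nonneg_left (Finset.sum_le_sum fun c₁ _ => ?_) (σ.PU_mem.1 u)
  rw [mul_assoc]
  refine mul_le_mul_of_nonneg_left ?_ ((prod_prod_mem_stdSimplex (σ.q₁_mem u)).1 c₁)
  rw [sum_prod_prod_mul_apply_mul (σ.q₂_mem u).2 hw j (fun b => f u (c₁ w₁) b)
    (fun v => if T < σ.t₁ u v x s then 1 else 0)]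
  refine mul_le_mul_of_nonneg_left
    (sum_mul_indicator_le (σ.q₂_mem u).1 (fun v => σ.t₁_nonneg _ _ _ _) (σ.sum_t₁_le u x s) hT) ?_
  exact Finset.sum_nonneg fun c₂ _ =>
    mul_nonneg ((prod_prod_mem_stdSimplex (σ.q₂_mem u)).1 c₂) (hf _ _ _)

open Classical in
/-- A cluster that is independent of the output passes the test of the receiver with a given pair of
codewords with probability at most `1 / T`. -/
theorem sum_clusterLaw_dec_le (w₁ : W₁) (w₂ : W₂) (j₁ : J₁) (j₂ : J₂) (y : Y) {T : ℝ}
    (hT : 0 < T) :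
    ∑ cl : Cluster U V₁ V₂ W₁ W₂ J₁ J₂, σ.clusterLaw cl *
        (if T < σ.t cl.1 (cl.2.1 w₁ j₁) (cl.2.2 w₂ j₂) y then 1 else 0) ≤ 1 / T := by
  rw [σ.sum_clusterLaw_mul]
  have h : ∀ u, ∑ c₁ : W₁ → J₁ → V₁, (∏ w, ∏ j, σ.q₁ u (c₁ w j)) *
        ∑ c₂ : W₂ → J₂ → V₂, (∏ w, ∏ j, σ.q₂ u (c₂ w j)) *
          (if T < σ.t u (c₁ w₁ j₁) (c₂ w₂ j₂) y then 1 else 0) =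
      ∑ v₁, σ.q₁ u v₁ * ∑ v₂, σ.q₂ u v₂ * (if T < σ.t u v₁ v₂ y then 1 else 0) := by
    intro u
    have h2 : ∀ v₁, ∑ c₂ : W₂ → J₂ → V₂, (∏ w, ∏ j, σ.q₂ u (c₂ w j)) *
          (if T < σ.t u v₁ (c₂ w₂ j₂) y then (1 : ℝ) else 0) =
        ∑ v₂, σ.q₂ u v₂ * (if T < σ.t u v₁ v₂ y then 1 else 0) := by
      intro v₁
      rw [sum_prod_prod_mul_apply (σ.q₂_mem u).2 w₂
        (fun b => if T < σ.t u v₁ (b j₂) y then (1 : ℝ) else 0),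
        sum_prod_mul_apply (fun _ => (σ.q₂_mem u).2) j₂
          (fun v => if T < σ.t u v₁ v y then (1 : ℝ) else 0)]
    simp_rw [h2]
    rw [sum_prod_prod_mul_apply (σ.q₁_mem u).2 w₁
        (fun a => ∑ v₂, σ.q₂ u v₂ * (if T < σ.t u (a j₁) v₂ y then (1 : ℝ) else 0)),
        sum_prod_mul_apply (fun _ => (σ.q₁_mem u).2) j₁
          (fun v => ∑ v₂, σ.q₂ u v₂ * (if T < σ.t u v v₂ y then (1 : ℝ) else 0))]
  simp_rw [h]
  have := sum_mul_indicator_le (V := U × V₁ × V₂)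
    (q := fun v => σ.PU v.1 * σ.q₁ v.1 v.2.1 * σ.q₂ v.1 v.2.2)
    (t := fun v => σ.t v.1 v.2.1 v.2.2 y)
    (fun v => mul_nonneg (mul_nonneg (σ.PU_mem.1 _) ((σ.q₁_mem _).1 _)) ((σ.q₂_mem _).1 _))
    (fun v => σ.t_nonneg _ _ _ _)
    (by simpa only [Fintype.sum_prod_type] using σ.sum_t_le y) hT
  simpa only [Fintype.sum_prod_type, Finset.mul_sum, mul_assoc] using this

end Scheme

end Cluster

/-! ### Random coding for one block -/

namespace Scheme

variable {S₁ S₂ X₁ X₂ Y U V₁ V₂ : Type*} [Fintype X₁] [Fintype X₂] [Fintype U] [Fintype V₁]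
  [Fintype V₂] {W₁ W₂ J₁ J₂ : Type*} [Fintype J₁] [Fintype J₂]

variable (σ : Scheme S₁ S₂ X₁ X₂ Y U V₁ V₂)

section Encoders

/-- The likelihood encoder: among the codewords `a j`, the index `j` is chosen with probability
proportional to the likelihood of the state `s`, and the input is drawn given that codeword.
If all likelihoods vanish, the weights are 0, so that this is only a subprobability law. -/
noncomputable def likelihoodEnc₁ (u : U) (a : J₁ → V₁) (s : S₁) (x : X₁) : ℝ :=
  ∑ j, σ.r₁ u s (a j) / (∑ k, σ.r₁ u s (a k)) * σ.k₁ u s (a j) x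

/-- The likelihood encoder of the second user. -/
noncomputable def likelihoodEnc₂ (u : U) (b : J₂ → V₂) (s : S₂) (x : X₂) : ℝ :=
  ∑ j, σ.r₂ u s (b j) / (∑ k, σ.r₂ u s (b k)) * σ.k₂ u s (b j) x

theorem sum_div_sum_le_one {J : Type*} [Fintype J] (r : J → ℝ) : ∑ j, r j / (∑ k, r k) ≤ 1 := by
  rw [← Finset.sum_div]
  exact div_self_le_one _

theorem likelihoodEnc₁_nonneg (u : U) (a : J₁ → V₁) (s : S₁) (x : X₁) :
    0 ≤ σ.likelihoodEnc₁ u a s x :=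
  Finset.sum_nonneg fun _ _ => mul_nonneg
    (div_nonneg (σ.r₁_nonneg _ _ _) (Finset.sum_nonneg fun _ _ => σ.r₁_nonneg _ _ _))
    (σ.k₁_nonneg _ _ _ _)

theorem likelihoodEnc₂_nonneg (u : U) (b : J₂ → V₂) (s : S₂) (x : X₂) :
    0 ≤ σ.likelihoodEnc₂ u b s x :=
  Finset.sum_nonneg fun _ _ => mul_nonneg
    (div_nonneg (σ.r₂_nonneg _ _ _) (Finset.sum_nonneg fun _ _ => σ.r₂_nonneg _ _ _))
    (σ.k₂_nonneg _ _ _ _)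

theorem sum_likelihoodEnc₁_le (u : U) (a : J₁ → V₁) (s : S₁) :
    ∑ x, σ.likelihoodEnc₁ u a s x ≤ 1 := by
  unfold likelihoodEnc₁
  rw [Finset.sum_comm]
  refine le_trans (Finset.sum_le_sum fun j _ => ?_) (sum_div_sum_le_one fun j => σ.r₁ u s (a j))
  rw [← Finset.mul_sum]
  exact mul_le_of_le_one_right
    (div_nonneg (σ.r₁_nonneg _ _ _) (Finset.sum_nonneg fun _ _ => σ.r₁_nonneg _ _ _))
    (σ.sum_k₁_le _ _ _)

theorem sum_likelihoodEnc₂_le (u : U) (b : J₂ → V₂) (s : S₂) :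
    ∑ x, σ.likelihoodEnc₂ u b s x ≤ 1 := by
  unfold likelihoodEnc₂
  rw [Finset.sum_comm]
  refine le_trans (Finset.sum_le_sum fun j _ => ?_) (sum_div_sum_le_one fun j => σ.r₂ u s (b j))
  rw [← Finset.mul_sum]
  exact mul_le_of_le_one_right
    (div_nonneg (σ.r₂_nonneg _ _ _) (Finset.sum_nonneg fun _ _ => σ.r₂_nonneg _ _ _))
    (σ.sum_k₂_le _ _ _)

end Encoders

section Selected

open Classical in
/-- The probability that the states are `s₁, s₂`, the likelihood encoders produce the inputs
`x₁, x₂`, the output is `y`, and that the chosen codewords pass all tests. -/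
noncomputable def selectedProb (PS : S₁ × S₂ → ℝ) (W : X₁ → X₂ → S₁ → S₂ → Y → ℝ) (T₁ T₂ T : ℝ)
    (z : S₁ × S₂ × Y × X₁ × X₂) (u : U) (a : J₁ → V₁) (b : J₂ → V₂) : ℝ :=
  ∑ j₁, σ.r₁ u z.1 (a j₁) / (∑ k, σ.r₁ u z.1 (a k)) *
    ∑ j₂, σ.r₂ u z.2.1 (b j₂) / (∑ k, σ.r₂ u z.2.1 (b k)) *
      (σ.k₁ u z.1 (a j₁) z.2.2.2.1 * σ.k₂ u z.2.1 (b j₂) z.2.2.2.2 *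
        (PS (z.1, z.2.1) * W z.2.2.2.1 z.2.2.2.2 z.1 z.2.1 z.2.2.1 *
          if T₂ < σ.t₂ u (a j₁) z.2.2.2.1 z.2.1 ∧ T₁ < σ.t₁ u (b j₂) z.2.2.2.2 z.1 ∧
            T < σ.t u (a j₁) (b j₂) z.2.2.1 then 1 else 0))

theorem selectedProb_nonneg {PS : S₁ × S₂ → ℝ} {W : X₁ → X₂ → S₁ → S₂ → Y → ℝ}
    (hPS : ∀ s, 0 ≤ PS s) (hW : ∀ x₁ x₂ s₁ s₂ y, 0 ≤ W x₁ x₂ s₁ s₂ y) (T₁ T₂ T : ℝ)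
    (z : S₁ × S₂ × Y × X₁ × X₂) (u : U) (a : J₁ → V₁) (b : J₂ → V₂) :
    0 ≤ σ.selectedProb PS W T₁ T₂ T z u a b := by
  refine Finset.sum_nonneg fun j₁ _ => mul_nonneg
    (div_nonneg (σ.r₁_nonneg _ _ _) (Finset.sum_nonneg fun _ _ => σ.r₁_nonneg _ _ _))
    (Finset.sum_nonneg fun j₂ _ => mul_nonneg
    (div_nonneg (σ.r₂_nonneg _ _ _) (Finset.sum_nonneg fun _ _ => σ.r₂_nonneg _ _ _)) ?_)
  refine mul_nonneg (mul_nonneg (σ.k₁_nonneg _ _ _ _) (σ.k₂_nonneg _ _ _ _))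
    (mul_nonneg (mul_nonneg (hPS _) (hW _ _ _ _ _)) ?_)
  split_ifs <;> norm_num

variable [DecidableEq J₁] [DecidableEq J₂] [Nonempty J₁] [Nonempty J₂]
  [Fintype S₁] [Fintype S₂] [Fintype Y]

/-- Averaged over the codebook, the likelihood encoders emulate the joint law of the scheme, up to
the effect of the finite number of codewords per message. -/
theorem typicalProb_mul_le {PS : S₁ × S₂ → ℝ} {W : X₁ → X₂ → S₁ → S₂ → Y → ℝ}
    (hPS : ∀ s, 0 ≤ PS s) (hW : ∀ x₁ x₂ s₁ s₂ y, 0 ≤ W x₁ x₂ s₁ s₂ y) {D₁ D₂ : ℝ} (T₁ T₂ T : ℝ) :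
    (1 - D₁ / Fintype.card J₁ - D₂ / Fintype.card J₂) * σ.typicalProb PS W D₁ D₂ T₁ T₂ T ≤
      ∑ u, σ.PU u * ∑ a : J₁ → V₁, (∏ j, σ.q₁ u (a j)) * ∑ b : J₂ → V₂, (∏ j, σ.q₂ u (b j)) *
        ∑ z : S₁ × S₂ × Y × X₁ × X₂, σ.selectedProb PS W T₁ T₂ T z u a b := by
  classical
  set L₁ : ℝ := ((Fintype.card J₁ : ℕ) : ℝ)
  set L₂ : ℝ := ((Fintype.card J₂ : ℕ) : ℝ)
  have hL₁ : 0 < L₁ := by simp [L₁, Fintype.card_pos]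
  have hL₂ : 0 < L₂ := by simp [L₂, Fintype.card_pos]
  -- the factors of `selectedProb` that depend on the chosen codewords only
  let φ : S₁ × S₂ × Y × X₁ × X₂ → U → V₁ → V₂ → ℝ := fun z u v₁ v₂ =>
    σ.k₁ u z.1 v₁ z.2.2.2.1 * σ.k₂ u z.2.1 v₂ z.2.2.2.2 *
        (PS (z.1, z.2.1) * W z.2.2.2.1 z.2.2.2.2 z.1 z.2.1 z.2.2.1 *
          if T₂ < σ.t₂ u v₁ z.2.2.2.1 z.2.1 ∧ T₁ < σ.t₁ u v₂ z.2.2.2.2 z.1 ∧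
            T < σ.t u v₁ v₂ z.2.2.1 then 1 else 0)
  have hφ : ∀ z u v₁ v₂, 0 ≤ φ z u v₁ v₂ := by
    intro z u v₁ v₂
    refine mul_nonneg (mul_nonneg (σ.k₁_nonneg _ _ _ _) (σ.k₂_nonneg _ _ _ _))
      (mul_nonneg (mul_nonneg (hPS _) (hW _ _ _ _ _)) ?_)
    split_ifs <;> norm_num
  have hsel : ∀ z u (a : J₁ → V₁) (b : J₂ → V₂), σ.selectedProb PS W T₁ T₂ T z u a b =
      ∑ j₁, σ.r₁ u z.1 (a j₁) / (∑ k, σ.r₁ u z.1 (a k)) *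
        ∑ j₂, σ.r₂ u z.2.1 (b j₂) / (∑ k, σ.r₂ u z.2.1 (b k)) * φ z u (a j₁) (b j₂) :=
    fun z u a b => rfl
  have hcover : ∀ z u, ∑ v₁, σ.q₁ u v₁ * σ.r₁ u z.1 v₁ *
        (∑ v₂, σ.q₂ u v₂ * σ.r₂ u z.2.1 v₂ * φ z u v₁ v₂ / (1 + σ.r₂ u z.2.1 v₂ / L₂)) /
          (1 + σ.r₁ u z.1 v₁ / L₁) ≤
      ∑ a : J₁ → V₁, (∏ j, σ.q₁ u (a j)) * ∑ b : J₂ → V₂, (∏ j, σ.q₂ u (b j)) *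
        σ.selectedProb PS W T₁ T₂ T z u a b := by
    intro z u
    let ψ : V₁ → ℝ := fun v₁ => ∑ b : J₂ → V₂, (∏ j, σ.q₂ u (b j)) *
      ∑ j₂, σ.r₂ u z.2.1 (b j₂) / (∑ k, σ.r₂ u z.2.1 (b k)) * φ z u v₁ (b j₂)
    have hψ : ∀ v₁, ∑ v₂, σ.q₂ u v₂ * σ.r₂ u z.2.1 v₂ * φ z u v₁ v₂ /
        (1 + σ.r₂ u z.2.1 v₂ / L₂) ≤ ψ v₁ := fun v₁ =>
      le_sum_likelihood (σ.q₂_mem u) (σ.r₂_nonneg u _) (σ.sum_r₂_le u _) (fun v₂ => hφ z u v₁ v₂)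
    have hψ0 : ∀ v₁, 0 ≤ ψ v₁ := fun v₁ => le_trans
      (Finset.sum_nonneg fun v₂ _ => div_nonneg (mul_nonneg
        (mul_nonneg ((σ.q₂_mem u).1 _) (σ.r₂_nonneg _ _ _)) (hφ _ _ _ _))
        (add_nonneg zero_le_one (div_nonneg (σ.r₂_nonneg _ _ _) hL₂.le))) (hψ v₁)
    calc _ ≤ ∑ v₁, σ.q₁ u v₁ * σ.r₁ u z.1 v₁ * ψ v₁ / (1 + σ.r₁ u z.1 v₁ / L₁) := by
          refine Finset.sum_le_sum fun v₁ _ => ?_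
          refine div_le_div_of_nonneg_right (mul_le_mul_of_nonneg_left (hψ v₁)
            (mul_nonneg ((σ.q₁_mem u).1 _) (σ.r₁_nonneg _ _ _)))
            (add_nonneg zero_le_one (div_nonneg (σ.r₁_nonneg _ _ _) hL₁.le))
      _ ≤ _ := le_sum_likelihood (J := J₁) (σ.q₁_mem u) (σ.r₁_nonneg u z.1) (σ.sum_r₁_le u _) hψ0
      _ = _ := by
          refine Finset.sum_congr rfl fun a _ => ?_
          congr 1
          simp only [hsel, ψ, Finset.mul_sum]
          rw [Finset.sum_comm]
          refine Finset.sum_congr rfl fun b _ => Finset.sum_congr rfl fun j₁ _ =>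
            Finset.sum_congr rfl fun j₂ _ => ?_
          ring
  have hpoint : ∀ (z : S₁ × S₂ × Y × X₁ × X₂) u v₁ v₂,
      (1 - D₁ / L₁ - D₂ / L₂) * (if σ.Typical D₁ D₂ T₁ T₂ T
        (z.1, z.2.1, u, v₁, v₂, z.2.2.2.1, z.2.2.2.2, z.2.2.1) then
          σ.jointLaw PS W (z.1, z.2.1, u, v₁, v₂, z.2.2.2.1, z.2.2.2.2, z.2.2.1) else 0) ≤
      σ.PU u * (σ.q₁ u v₁ * σ.r₁ u z.1 v₁ *
        (σ.q₂ u v₂ * σ.r₂ u z.2.1 v₂ * φ z u v₁ v₂ / (1 + σ.r₂ u z.2.1 v₂ / L₂)) /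
          (1 + σ.r₁ u z.1 v₁ / L₁)) := by
    rintro ⟨s₁, s₂, y, x₁, x₂⟩ u v₁ v₂
    have hP := σ.PU_mem.1 u
    have hq₁ := (σ.q₁_mem u).1 v₁
    have hq₂ := (σ.q₂_mem u).1 v₂
    have hr₁ := σ.r₁_nonneg u s₁ v₁
    have hr₂ := σ.r₂_nonneg u s₂ v₂
    split_ifs with h
    · have hφ' : φ (s₁, s₂, y, x₁, x₂) u v₁ v₂ =
          σ.k₁ u s₁ v₁ x₁ * σ.k₂ u s₂ v₂ x₂ * (PS (s₁, s₂) * W x₁ x₂ s₁ s₂ y) := by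
        simp only [φ]
        rw [if_pos h.2, mul_one]
      have h1 : σ.r₁ u s₁ v₁ / L₁ ≤ D₁ / L₁ := div_le_div_of_nonneg_right h.1.1 hL₁.le
      have h2 : σ.r₂ u s₂ v₂ / L₂ ≤ D₂ / L₂ := div_le_div_of_nonneg_right h.1.2 hL₂.le
      have hα : 0 ≤ σ.r₁ u s₁ v₁ / L₁ := div_nonneg hr₁ hL₁.le
      have hβ : 0 ≤ σ.r₂ u s₂ v₂ / L₂ := div_nonneg hr₂ hL₂.le
      have hJ := σ.jointLaw_nonneg hPS hW (s₁, s₂, u, v₁, v₂, x₁, x₂, y)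
      simp only [hφ']
      set α := σ.r₁ u s₁ v₁ / L₁
      set β := σ.r₂ u s₂ v₂ / L₂
      calc _ ≤ 1 / ((1 + α) * (1 + β)) * σ.jointLaw PS W (s₁, s₂, u, v₁, v₂, x₁, x₂, y) := by
            refine mul_le_mul_of_nonneg_right ?_ hJ
            refine le_trans (b := 1 - α - β) (by linarith) ?_
            rw [le_div_iff₀ (by positivity)]
            nlinarith [mul_nonneg hα hβ, mul_nonneg hα hα, mul_nonneg hβ hβ,
              mul_nonneg (mul_nonneg hα hβ) hα, mul_nonneg (mul_nonneg hα hβ) hβ]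
        _ = _ := by
            unfold jointLaw
            have : 1 + α ≠ 0 := by positivity
            have : 1 + β ≠ 0 := by positivity
            field_simp
    · rw [mul_zero]
      have := hφ (s₁, s₂, y, x₁, x₂) u v₁ v₂
      positivity
  let e : (U × (S₁ × S₂ × Y × X₁ × X₂) × V₁ × V₂) ≃ Outcome S₁ S₂ U V₁ V₂ X₁ X₂ Y :=
    { toFun := fun p => (p.2.1.1, p.2.1.2.1, p.1, p.2.2.1, p.2.2.2, p.2.1.2.2.2.1, p.2.1.2.2.2.2,
        p.2.1.2.2.1)
      invFun := fun ω => (ω.u, (ω.s₁, ω.s₂, ω.y, ω.x₁, ω.x₂), ω.v₁, ω.v₂)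
      left_inv := fun _ => rfl
      right_inv := fun _ => rfl }
  calc _ = ∑ u, ∑ z : S₁ × S₂ × Y × X₁ × X₂, ∑ v₁, ∑ v₂, (1 - D₁ / L₁ - D₂ / L₂) *
        (if σ.Typical D₁ D₂ T₁ T₂ T
          (z.1, z.2.1, u, v₁, v₂, z.2.2.2.1, z.2.2.2.2, z.2.2.1) then
            σ.jointLaw PS W (z.1, z.2.1, u, v₁, v₂, z.2.2.2.1, z.2.2.2.2, z.2.2.1) else 0) := by
        rw [typicalProb, ← Equiv.sum_comp e, Finset.mul_sum, Fintype.sum_prod_type]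
        refine Finset.sum_congr rfl fun u _ => ?_
        rw [Fintype.sum_prod_type]
        refine Finset.sum_congr rfl fun z _ => ?_
        rw [Fintype.sum_prod_type]
        rfl
    _ ≤ ∑ u, ∑ z : S₁ × S₂ × Y × X₁ × X₂, σ.PU u * ∑ v₁, σ.q₁ u v₁ * σ.r₁ u z.1 v₁ *
        (∑ v₂, σ.q₂ u v₂ * σ.r₂ u z.2.1 v₂ * φ z u v₁ v₂ / (1 + σ.r₂ u z.2.1 v₂ / L₂)) /
          (1 + σ.r₁ u z.1 v₁ / L₁) := by
        simp only [Finset.mul_sum, Finset.sum_div]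
        exact Finset.sum_le_sum fun u _ => Finset.sum_le_sum fun z _ =>
          Finset.sum_le_sum fun v₁ _ => Finset.sum_le_sum fun v₂ _ => hpoint z u v₁ v₂
    _ ≤ ∑ u, ∑ z : S₁ × S₂ × Y × X₁ × X₂, σ.PU u *
        ∑ a : J₁ → V₁, (∏ j, σ.q₁ u (a j)) * ∑ b : J₂ → V₂, (∏ j, σ.q₂ u (b j)) *
          σ.selectedProb PS W T₁ T₂ T z u a b :=
        Finset.sum_le_sum fun u _ => Finset.sum_le_sum fun z _ =>
          mul_le_mul_of_nonneg_left (hcover z u) (σ.PU_mem.1 u)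
    _ = _ := by
        refine Finset.sum_congr rfl fun u _ => ?_
        rw [← Finset.mul_sum, Finset.sum_comm]
        congr 1
        refine Finset.sum_congr rfl fun a _ => ?_
        rw [← Finset.mul_sum, Finset.sum_comm]
        congr 1
        refine Finset.sum_congr rfl fun b _ => ?_
        rw [← Finset.mul_sum]

end Selected

end Scheme

/-! ### Existence of a good block code -/

namespace Scheme

variable {S₁ S₂ X₁ X₂ Y U V₁ V₂ : Type*} [Fintype X₁] [Fintype X₂] [Fintype U] [Fintype V₁]
  [Fintype V₂] {W₁ W₂ J₁ J₂ : Type*}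

variable (σ : Scheme S₁ S₂ X₁ X₂ Y U V₁ V₂)

section Decoders

/-- Encoder 2 looks for a message one of whose codewords passes its test. -/
noncomputable def crib₂ [Nonempty W₁] (T₂ : ℝ) (cl : Cluster U V₁ V₂ W₁ W₂ J₁ J₂) (s : S₂)
    (x : X₁) : W₁ :=
  Classical.epsilon fun w => ∃ j, T₂ < σ.t₂ cl.1 (cl.2.1 w j) x s

/-- Encoder 1 looks for a message one of whose codewords passes its test. -/
noncomputable def crib₁ [Nonempty W₂] (T₁ : ℝ) (cl : Cluster U V₁ V₂ W₁ W₂ J₁ J₂) (s : S₁)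
    (x : X₂) : W₂ :=
  Classical.epsilon fun w => ∃ j, T₁ < σ.t₁ cl.1 (cl.2.2 w j) x s

/-- The receiver, which knows the fresh messages `w`, looks for a message pair of the previous block
with a pair of codewords that passes its test. -/
noncomputable def dec [Nonempty W₁] [Nonempty W₂] (T : ℝ)
    (cb : W₁ × W₂ → Cluster U V₁ V₂ W₁ W₂ J₁ J₂) (w : W₁ × W₂) (y : Y) : W₁ × W₂ :=
  Classical.epsilon fun o => ∃ j₁ j₂,
    T < σ.t (cb o).1 ((cb o).2.1 w.1 j₁) ((cb o).2.2 w.2 j₂) y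

theorem epsilon_eq_of_unique {α : Type*} [Nonempty α] {p : α → Prop} {a : α} (ha : p a)
    (h : ∀ b, b ≠ a → ¬ p b) : Classical.epsilon p = a := by
  by_contra hne
  exact h _ hne (Classical.epsilon_spec ⟨a, ha⟩)

variable [Fintype W₁] [Fintype W₂] [Fintype J₁] [Fintype J₂] [DecidableEq W₁] [DecidableEq W₂]

open Classical in
/-- The number of codewords for wrong messages that pass one of the tests. -/
noncomputable def wrongCount (T₁ T₂ T : ℝ) (cb : W₁ × W₂ → Cluster U V₁ V₂ W₁ W₂ J₁ J₂)
    (o w : W₁ × W₂) (z : S₁ × S₂ × Y × X₁ × X₂) : ℝ :=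
  (∑ w' ∈ Finset.univ.erase w.1, ∑ j,
      if T₂ < σ.t₂ (cb o).1 ((cb o).2.1 w' j) z.2.2.2.1 z.2.1 then 1 else 0) +
    (∑ w' ∈ Finset.univ.erase w.2, ∑ j,
      if T₁ < σ.t₁ (cb o).1 ((cb o).2.2 w' j) z.2.2.2.2 z.1 then 1 else 0) +
    ∑ o' ∈ Finset.univ.erase o, ∑ j₁, ∑ j₂,
      if T < σ.t (cb o').1 ((cb o').2.1 w.1 j₁) ((cb o').2.2 w.2 j₂) z.2.2.1 then 1 else 0

theorem one_le_wrongCount (T₁ T₂ T : ℝ) (cb : W₁ × W₂ → Cluster U V₁ V₂ W₁ W₂ J₁ J₂)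
    (o w : W₁ × W₂) (z : S₁ × S₂ × Y × X₁ × X₂)
    (h : (∃ w', w' ≠ w.1 ∧ ∃ j, T₂ < σ.t₂ (cb o).1 ((cb o).2.1 w' j) z.2.2.2.1 z.2.1) ∨
      (∃ w', w' ≠ w.2 ∧ ∃ j, T₁ < σ.t₁ (cb o).1 ((cb o).2.2 w' j) z.2.2.2.2 z.1) ∨
      ∃ o', o' ≠ o ∧ ∃ j₁ j₂,
        T < σ.t (cb o').1 ((cb o').2.1 w.1 j₁) ((cb o').2.2 w.2 j₂) z.2.2.1) :
    1 ≤ σ.wrongCount T₁ T₂ T cb o w z := by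
  classical
  have hite : ∀ p : Prop, (0 : ℝ) ≤ if p then 1 else 0 := fun p => by split_ifs <;> norm_num
  have h1 : (0 : ℝ) ≤ ∑ w' ∈ Finset.univ.erase w.1, ∑ j,
      if T₂ < σ.t₂ (cb o).1 ((cb o).2.1 w' j) z.2.2.2.1 z.2.1 then 1 else 0 :=
    Finset.sum_nonneg fun _ _ => Finset.sum_nonneg fun _ _ => hite _
  have h2 : (0 : ℝ) ≤ ∑ w' ∈ Finset.univ.erase w.2, ∑ j,
      if T₁ < σ.t₁ (cb o).1 ((cb o).2.2 w' j) z.2.2.2.2 z.1 then 1 else 0 :=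
    Finset.sum_nonneg fun _ _ => Finset.sum_nonneg fun _ _ => hite _
  have h3 : (0 : ℝ) ≤ ∑ o' ∈ Finset.univ.erase o, ∑ j₁, ∑ j₂,
      if T < σ.t (cb o').1 ((cb o').2.1 w.1 j₁) ((cb o').2.2 w.2 j₂) z.2.2.1 then 1 else 0 :=
    Finset.sum_nonneg fun _ _ => Finset.sum_nonneg fun _ _ => Finset.sum_nonneg fun _ _ => hite _
  unfold wrongCount
  rcases h with ⟨w', hw', j, hj⟩ | ⟨w', hw', j, hj⟩ | ⟨o', ho', j₁, j₂, hj⟩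
  · have h4 := Finset.single_le_sum (f := fun j =>
      if T₂ < σ.t₂ (cb o).1 ((cb o).2.1 w' j) z.2.2.2.1 z.2.1 then (1 : ℝ) else 0)
      (fun _ _ => hite _) (Finset.mem_univ j)
    have h5 := Finset.single_le_sum (f := fun w' => ∑ j,
      if T₂ < σ.t₂ (cb o).1 ((cb o).2.1 w' j) z.2.2.2.1 z.2.1 then (1 : ℝ) else 0)
      (fun _ _ => Finset.sum_nonneg fun _ _ => hite _)
      (Finset.mem_erase.mpr ⟨hw', Finset.mem_univ w'⟩)
    simp only [if_pos hj] at h4 h5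
    linarith
  · have h4 := Finset.single_le_sum (f := fun j =>
      if T₁ < σ.t₁ (cb o).1 ((cb o).2.2 w' j) z.2.2.2.2 z.1 then (1 : ℝ) else 0)
      (fun _ _ => hite _) (Finset.mem_univ j)
    have h5 := Finset.single_le_sum (f := fun w' => ∑ j,
      if T₁ < σ.t₁ (cb o).1 ((cb o).2.2 w' j) z.2.2.2.2 z.1 then (1 : ℝ) else 0)
      (fun _ _ => Finset.sum_nonneg fun _ _ => hite _)
      (Finset.mem_erase.mpr ⟨hw', Finset.mem_univ w'⟩)
    simp only [if_pos hj] at h4 h5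
    linarith
  · have h4 := Finset.single_le_sum (f := fun j₂ =>
      if T < σ.t (cb o').1 ((cb o').2.1 w.1 j₁) ((cb o').2.2 w.2 j₂) z.2.2.1 then (1 : ℝ) else 0)
      (fun _ _ => hite _) (Finset.mem_univ j₂)
    have h5 := Finset.single_le_sum (f := fun j₁ => ∑ j₂,
      if T < σ.t (cb o').1 ((cb o').2.1 w.1 j₁) ((cb o').2.2 w.2 j₂) z.2.2.1 then (1 : ℝ) else 0)
      (fun _ _ => Finset.sum_nonneg fun _ _ => hite _) (Finset.mem_univ j₁)
    have h6 := Finset.single_le_sum (f := fun o' => ∑ j₁, ∑ j₂,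
      if T < σ.t (cb o').1 ((cb o').2.1 w.1 j₁) ((cb o').2.2 w.2 j₂) z.2.2.1 then (1 : ℝ) else 0)
      (fun _ _ => Finset.sum_nonneg fun _ _ => Finset.sum_nonneg fun _ _ => hite _)
      (Finset.mem_erase.mpr ⟨ho', Finset.mem_univ o'⟩)
    simp only [if_pos hj] at h4 h5 h6
    linarith

open Classical in
/-- All messages are found if the chosen codewords pass the tests and no wrong codewords do. -/
theorem selectedProb_mul_le [Nonempty W₁] [Nonempty W₂] {PS : S₁ × S₂ → ℝ}
    {W : X₁ → X₂ → S₁ → S₂ → Y → ℝ} (hPS : ∀ s, 0 ≤ PS s)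
    (hW : ∀ x₁ x₂ s₁ s₂ y, 0 ≤ W x₁ x₂ s₁ s₂ y) (T₁ T₂ T : ℝ)
    (cb : W₁ × W₂ → Cluster U V₁ V₂ W₁ W₂ J₁ J₂) (o w : W₁ × W₂) (z : S₁ × S₂ × Y × X₁ × X₂) :
    σ.selectedProb PS W T₁ T₂ T z (cb o).1 ((cb o).2.1 w.1) ((cb o).2.2 w.2) *
        (1 - σ.wrongCount T₁ T₂ T cb o w z) ≤
      σ.likelihoodEnc₁ (cb o).1 ((cb o).2.1 w.1) z.1 z.2.2.2.1 *
        σ.likelihoodEnc₂ (cb o).1 ((cb o).2.2 w.2) z.2.1 z.2.2.2.2 *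
        (if σ.crib₁ T₁ (cb o) z.1 z.2.2.2.2 = w.2 ∧ σ.crib₂ T₂ (cb o) z.2.1 z.2.2.2.1 = w.1 ∧
            σ.dec T cb w z.2.2.1 = o then
          PS (z.1, z.2.1) * W z.2.2.2.1 z.2.2.2.2 z.1 z.2.1 z.2.2.1 else 0) := by
  have hs := σ.selectedProb_nonneg hPS hW T₁ T₂ T z (cb o).1 ((cb o).2.1 w.1) ((cb o).2.2 w.2)
  have hPW : 0 ≤ PS (z.1, z.2.1) * W z.2.2.2.1 z.2.2.2.2 z.1 z.2.1 z.2.2.1 :=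
    mul_nonneg (hPS _) (hW _ _ _ _ _)
  have hr : 0 ≤ σ.likelihoodEnc₁ (cb o).1 ((cb o).2.1 w.1) z.1 z.2.2.2.1 *
        σ.likelihoodEnc₂ (cb o).1 ((cb o).2.2 w.2) z.2.1 z.2.2.2.2 *
        (if σ.crib₁ T₁ (cb o) z.1 z.2.2.2.2 = w.2 ∧ σ.crib₂ T₂ (cb o) z.2.1 z.2.2.2.1 = w.1 ∧
            σ.dec T cb w z.2.2.1 = o then
          PS (z.1, z.2.1) * W z.2.2.2.1 z.2.2.2.2 z.1 z.2.1 z.2.2.1 else 0) := by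
    refine mul_nonneg (mul_nonneg (σ.likelihoodEnc₁_nonneg _ _ _ _)
      (σ.likelihoodEnc₂_nonneg _ _ _ _)) ?_
    split_ifs
    exacts [hPW, le_rfl]
  by_cases hc : (∃ w', w' ≠ w.1 ∧ ∃ j, T₂ < σ.t₂ (cb o).1 ((cb o).2.1 w' j) z.2.2.2.1 z.2.1) ∨
      (∃ w', w' ≠ w.2 ∧ ∃ j, T₁ < σ.t₁ (cb o).1 ((cb o).2.2 w' j) z.2.2.2.2 z.1) ∨
      ∃ o', o' ≠ o ∧ ∃ j₁ j₂,
        T < σ.t (cb o').1 ((cb o').2.1 w.1 j₁) ((cb o').2.2 w.2 j₂) z.2.2.1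
  · have := σ.one_le_wrongCount T₁ T₂ T cb o w z hc
    exact (mul_nonpos_of_nonneg_of_nonpos hs (by linarith)).trans hr
  push Not at hc
  obtain ⟨hc₂, hc₁, hc⟩ := hc
  have hw0 : 0 ≤ σ.wrongCount T₁ T₂ T cb o w z := by
    unfold wrongCount
    positivity
  refine (mul_le_of_le_one_right hs (by linarith)).trans ?_
  unfold selectedProb likelihoodEnc₁ likelihoodEnc₂
  rw [Finset.sum_mul_sum, Finset.sum_mul]
  refine Finset.sum_le_sum fun j₁ _ => ?_
  rw [Finset.sum_mul, Finset.mul_sum]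
  refine Finset.sum_le_sum fun j₂ _ => ?_
  set ℓ₁ := σ.r₁ (cb o).1 z.1 ((cb o).2.1 w.1 j₁) /
    ∑ k, σ.r₁ (cb o).1 z.1 ((cb o).2.1 w.1 k)
  set ℓ₂ := σ.r₂ (cb o).1 z.2.1 ((cb o).2.2 w.2 j₂) /
    ∑ k, σ.r₂ (cb o).1 z.2.1 ((cb o).2.2 w.2 k)
  have hℓ₁ : 0 ≤ ℓ₁ :=
    div_nonneg (σ.r₁_nonneg _ _ _) (Finset.sum_nonneg fun _ _ => σ.r₁_nonneg _ _ _)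
  have hℓ₂ : 0 ≤ ℓ₂ :=
    div_nonneg (σ.r₂_nonneg _ _ _) (Finset.sum_nonneg fun _ _ => σ.r₂_nonneg _ _ _)
  have hk₁ := σ.k₁_nonneg (cb o).1 z.1 ((cb o).2.1 w.1 j₁) z.2.2.2.1
  have hk₂ := σ.k₂_nonneg (cb o).1 z.2.1 ((cb o).2.2 w.2 j₂) z.2.2.2.2
  rw [← mul_assoc, ← mul_assoc, mul_mul_mul_comm ℓ₁]
  refine mul_le_mul_of_nonneg_left ?_ (mul_nonneg (mul_nonneg hℓ₁ hk₁) (mul_nonneg hℓ₂ hk₂))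
  split_ifs with ht hcorr
  · simp
  · refine absurd ⟨?_, ?_, ?_⟩ hcorr
    · exact epsilon_eq_of_unique ⟨j₂, ht.2.1⟩ fun w' hw' ⟨j, hj⟩ => (hc₁ w' hw' j).not_gt hj
    · exact epsilon_eq_of_unique ⟨j₁, ht.1⟩ fun w' hw' ⟨j, hj⟩ => (hc₂ w' hw' j).not_gt hj
    · exact epsilon_eq_of_unique ⟨j₁, j₂, ht.2.2⟩
        fun o' ho' ⟨j, j', hj⟩ => (hc o' ho' j j').not_gt hj
  · simpa using hPW
  · simp

end Decoders

section Average

variable [Fintype W₁] [Fintype W₂] [Fintype J₁] [Fintype J₂] [DecidableEq W₁] [DecidableEq W₂]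
  [DecidableEq J₁] [DecidableEq J₂]

/-- The expected number of wrong codewords that pass a test, when the thresholds are `T₁`, `T₂` and
`T` and there are `M₁`, `M₂` messages with `L₁`, `L₂` codewords each, is at most this number. -/
noncomputable def wrongBound (M₁ M₂ L₁ L₂ T₁ T₂ T : ℝ) : ℝ :=
  (M₁ - 1) * L₁ / T₂ + (M₂ - 1) * L₂ / T₁ + M₁ * M₂ * L₁ * L₂ / T

theorem le_sum_wrongCount {T₁ T₂ T : ℝ} (hT₁ : 0 < T₁) (hT₂ : 0 < T₂) (hT : 0 < T)
    (o w : W₁ × W₂) (z : S₁ × S₂ × Y × X₁ × X₂) {f : U → (J₁ → V₁) → (J₂ → V₂) → ℝ}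
    (hf : ∀ u a b, 0 ≤ f u a b) :
    (∑ cl : Cluster U V₁ V₂ W₁ W₂ J₁ J₂, σ.clusterLaw cl * f cl.1 (cl.2.1 w.1) (cl.2.2 w.2)) *
        (1 - wrongBound (Fintype.card W₁) (Fintype.card W₂) (Fintype.card J₁) (Fintype.card J₂)
          T₁ T₂ T) ≤
      ∑ cb : W₁ × W₂ → Cluster U V₁ V₂ W₁ W₂ J₁ J₂, (∏ o, σ.clusterLaw (cb o)) *
        (f (cb o).1 ((cb o).2.1 w.1) ((cb o).2.2 w.2) *
          (1 - σ.wrongCount T₁ T₂ T cb o w z)) := by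
  classical
  set E := ∑ cl : Cluster U V₁ V₂ W₁ W₂ J₁ J₂,
    σ.clusterLaw cl * f cl.1 (cl.2.1 w.1) (cl.2.2 w.2) with hE
  have hE0 : 0 ≤ E := Finset.sum_nonneg fun cl _ => mul_nonneg (σ.clusterLaw_nonneg cl) (hf _ _ _)
  have hsum := fun _ : W₁ × W₂ => σ.sum_clusterLaw (W₁ := W₁) (W₂ := W₂) (J₁ := J₁) (J₂ := J₂)
  have h0 : ∑ cb : W₁ × W₂ → Cluster U V₁ V₂ W₁ W₂ J₁ J₂, (∏ o, σ.clusterLaw (cb o)) *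
      f (cb o).1 ((cb o).2.1 w.1) ((cb o).2.2 w.2) = E :=
    sum_prod_mul_apply hsum o fun cl => f cl.1 (cl.2.1 w.1) (cl.2.2 w.2)
  have h1 : ∀ w' ∈ Finset.univ.erase w.1, ∀ j,
      ∑ cb : W₁ × W₂ → Cluster U V₁ V₂ W₁ W₂ J₁ J₂, (∏ o, σ.clusterLaw (cb o)) *
        (f (cb o).1 ((cb o).2.1 w.1) ((cb o).2.2 w.2) *
          if T₂ < σ.t₂ (cb o).1 ((cb o).2.1 w' j) z.2.2.2.1 z.2.1 then 1 else 0) ≤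
        E * (1 / T₂) := by
    intro w' hw' j
    rw [sum_prod_mul_apply hsum o fun cl => f cl.1 (cl.2.1 w.1) (cl.2.2 w.2) *
      if T₂ < σ.t₂ cl.1 (cl.2.1 w' j) z.2.2.2.1 z.2.1 then 1 else 0]
    exact σ.sum_clusterLaw_crib₂_le (Finset.ne_of_mem_erase hw').symm w.2 j hf _ _ hT₂
  have h2 : ∀ w' ∈ Finset.univ.erase w.2, ∀ j,
      ∑ cb : W₁ × W₂ → Cluster U V₁ V₂ W₁ W₂ J₁ J₂, (∏ o, σ.clusterLaw (cb o)) *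
        (f (cb o).1 ((cb o).2.1 w.1) ((cb o).2.2 w.2) *
          if T₁ < σ.t₁ (cb o).1 ((cb o).2.2 w' j) z.2.2.2.2 z.1 then 1 else 0) ≤
        E * (1 / T₁) := by
    intro w' hw' j
    rw [sum_prod_mul_apply hsum o fun cl => f cl.1 (cl.2.1 w.1) (cl.2.2 w.2) *
      if T₁ < σ.t₁ cl.1 (cl.2.2 w' j) z.2.2.2.2 z.1 then 1 else 0]
    exact σ.sum_clusterLaw_crib₁_le (Finset.ne_of_mem_erase hw').symm w.1 j hf _ _ hT₁
  have h3 : ∀ o' ∈ Finset.univ.erase o, ∀ j₁ j₂,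
      ∑ cb : W₁ × W₂ → Cluster U V₁ V₂ W₁ W₂ J₁ J₂, (∏ o, σ.clusterLaw (cb o)) *
        (f (cb o).1 ((cb o).2.1 w.1) ((cb o).2.2 w.2) *
          if T < σ.t (cb o').1 ((cb o').2.1 w.1 j₁) ((cb o').2.2 w.2 j₂) z.2.2.1 then 1 else 0) ≤
        E * (1 / T) := by
    intro o' ho' j₁ j₂
    rw [sum_prod_mul_apply_mul_apply hsum (Finset.ne_of_mem_erase ho').symm
      (fun cl => f cl.1 (cl.2.1 w.1) (cl.2.2 w.2))
      (fun cl => if T < σ.t cl.1 (cl.2.1 w.1 j₁) (cl.2.2 w.2 j₂) z.2.2.1 then 1 else 0)]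
    exact mul_le_mul_of_nonneg_left (σ.sum_clusterLaw_dec_le w.1 w.2 j₁ j₂ _ hT) hE0
  have hexp : ∑ cb : W₁ × W₂ → Cluster U V₁ V₂ W₁ W₂ J₁ J₂, (∏ o, σ.clusterLaw (cb o)) *
        (f (cb o).1 ((cb o).2.1 w.1) ((cb o).2.2 w.2) * (1 - σ.wrongCount T₁ T₂ T cb o w z)) =
      E - (∑ w' ∈ Finset.univ.erase w.1, ∑ j,
          ∑ cb : W₁ × W₂ → Cluster U V₁ V₂ W₁ W₂ J₁ J₂, (∏ o, σ.clusterLaw (cb o)) *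
            (f (cb o).1 ((cb o).2.1 w.1) ((cb o).2.2 w.2) *
              if T₂ < σ.t₂ (cb o).1 ((cb o).2.1 w' j) z.2.2.2.1 z.2.1 then 1 else 0)) -
        (∑ w' ∈ Finset.univ.erase w.2, ∑ j,
          ∑ cb : W₁ × W₂ → Cluster U V₁ V₂ W₁ W₂ J₁ J₂, (∏ o, σ.clusterLaw (cb o)) *
            (f (cb o).1 ((cb o).2.1 w.1) ((cb o).2.2 w.2) *
              if T₁ < σ.t₁ (cb o).1 ((cb o).2.2 w' j) z.2.2.2.2 z.1 then 1 else 0)) -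
        ∑ o' ∈ Finset.univ.erase o, ∑ j₁, ∑ j₂,
          ∑ cb : W₁ × W₂ → Cluster U V₁ V₂ W₁ W₂ J₁ J₂, (∏ o, σ.clusterLaw (cb o)) *
            (f (cb o).1 ((cb o).2.1 w.1) ((cb o).2.2 w.2) *
              if T < σ.t (cb o').1 ((cb o').2.1 w.1 j₁) ((cb o').2.2 w.2 j₂) z.2.2.1
                then 1 else 0) := by
    rw [← h0]
    have hcb : ∀ cb : W₁ × W₂ → Cluster U V₁ V₂ W₁ W₂ J₁ J₂, (∏ o, σ.clusterLaw (cb o)) *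
        (f (cb o).1 ((cb o).2.1 w.1) ((cb o).2.2 w.2) * (1 - σ.wrongCount T₁ T₂ T cb o w z)) =
      (∏ o, σ.clusterLaw (cb o)) * f (cb o).1 ((cb o).2.1 w.1) ((cb o).2.2 w.2) -
        (∑ w' ∈ Finset.univ.erase w.1, ∑ j, (∏ o, σ.clusterLaw (cb o)) *
            (f (cb o).1 ((cb o).2.1 w.1) ((cb o).2.2 w.2) *
              if T₂ < σ.t₂ (cb o).1 ((cb o).2.1 w' j) z.2.2.2.1 z.2.1 then 1 else 0)) -
        (∑ w' ∈ Finset.univ.erase w.2, ∑ j, (∏ o, σ.clusterLaw (cb o)) *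
            (f (cb o).1 ((cb o).2.1 w.1) ((cb o).2.2 w.2) *
              if T₁ < σ.t₁ (cb o).1 ((cb o).2.2 w' j) z.2.2.2.2 z.1 then 1 else 0)) -
        ∑ o' ∈ Finset.univ.erase o, ∑ j₁, ∑ j₂, (∏ o, σ.clusterLaw (cb o)) *
            (f (cb o).1 ((cb o).2.1 w.1) ((cb o).2.2 w.2) *
              if T < σ.t (cb o').1 ((cb o').2.1 w.1 j₁) ((cb o').2.2 w.2 j₂) z.2.2.1
                then 1 else 0) := by
      intro cb
      unfold wrongCount
      simp_rw [← Finset.mul_sum]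
      ring
    simp_rw [hcb]
    rw [Finset.sum_sub_distrib, Finset.sum_sub_distrib, Finset.sum_sub_distrib]
    congr 1
    · congr 1
      · congr 1
        rw [Finset.sum_comm]
        exact Finset.sum_congr rfl fun w' _ => Finset.sum_comm
      · rw [Finset.sum_comm]
        exact Finset.sum_congr rfl fun w' _ => Finset.sum_comm
    · rw [Finset.sum_comm]
      refine Finset.sum_congr rfl fun o' _ => ?_
      rw [Finset.sum_comm]
      exact Finset.sum_congr rfl fun j₁ _ => Finset.sum_comm
  have hcard1 : ((Finset.univ.erase w.1).card : ℝ) = Fintype.card W₁ - 1 := by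
    rw [Finset.card_erase_of_mem (Finset.mem_univ _), Finset.card_univ,
      Nat.cast_sub (Fintype.card_pos_iff.mpr ⟨w.1⟩), Nat.cast_one]
  have hcard2 : ((Finset.univ.erase w.2).card : ℝ) = Fintype.card W₂ - 1 := by
    rw [Finset.card_erase_of_mem (Finset.mem_univ _), Finset.card_univ,
      Nat.cast_sub (Fintype.card_pos_iff.mpr ⟨w.2⟩), Nat.cast_one]
  have hcard3 : ((Finset.univ.erase o).card : ℝ) ≤ Fintype.card W₁ * Fintype.card W₂ := by
    rw [← Nat.cast_mul, ← Fintype.card_prod]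
    exact_mod_cast Finset.card_le_univ _
  have s1 := Finset.sum_le_sum fun w' hw' =>
    Finset.sum_le_sum fun j (_ : j ∈ Finset.univ) => h1 w' hw' j
  have s2 := Finset.sum_le_sum fun w' hw' =>
    Finset.sum_le_sum fun j (_ : j ∈ Finset.univ) => h2 w' hw' j
  have s3 := Finset.sum_le_sum fun o' ho' =>
    Finset.sum_le_sum fun j₁ (_ : j₁ ∈ Finset.univ) =>
      Finset.sum_le_sum fun j₂ (_ : j₂ ∈ Finset.univ) => h3 o' ho' j₁ j₂
  simp only [Finset.sum_const, Finset.card_univ, nsmul_eq_mul, hcard1, hcard2] at s1 s2 s3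
  have s3' : ((Finset.univ.erase o).card : ℝ) * (Fintype.card J₁ * (Fintype.card J₂ *
      (E * (1 / T)))) ≤ Fintype.card W₁ * Fintype.card W₂ * (Fintype.card J₁ * (Fintype.card J₂ *
      (E * (1 / T)))) :=
    mul_le_mul_of_nonneg_right hcard3 (by positivity)
  rw [hexp]
  have : E * (1 - wrongBound (Fintype.card W₁) (Fintype.card W₂) (Fintype.card J₁)
      (Fintype.card J₂) T₁ T₂ T) =
      E - (Fintype.card W₁ - 1) * (Fintype.card J₁ * (E * (1 / T₂))) -
        (Fintype.card W₂ - 1) * (Fintype.card J₂ * (E * (1 / T₁))) -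
        Fintype.card W₁ * Fintype.card W₂ * (Fintype.card J₁ * (Fintype.card J₂ *
      (E * (1 / T)))) := by
    unfold wrongBound; ring
  rw [this]
  linarith

variable [Nonempty J₁] [Nonempty J₂] [Nonempty W₁] [Nonempty W₂] [Fintype S₁] [Fintype S₂]
  [Fintype Y]

open Classical in
/-- The success probability for a random codebook and likelihood encoders. -/
theorem le_sum_correct {PS : S₁ × S₂ → ℝ}
    {W : X₁ → X₂ → S₁ → S₂ → Y → ℝ} (hPS : ∀ s, 0 ≤ PS s)
    (hW : ∀ x₁ x₂ s₁ s₂ y, 0 ≤ W x₁ x₂ s₁ s₂ y) {D₁ D₂ T₁ T₂ T : ℝ} (hD₁ : 0 ≤ D₁) (hD₂ : 0 ≤ D₂)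
    (hT₁ : 0 < T₁) (hT₂ : 0 < T₂) (hT : 0 < T) (hG : σ.typicalProb PS W D₁ D₂ T₁ T₂ T ≤ 1)
    (hη : wrongBound (Fintype.card W₁) (Fintype.card W₂) (Fintype.card J₁) (Fintype.card J₂)
      T₁ T₂ T ≤ 1) (o w : W₁ × W₂) :
    σ.typicalProb PS W D₁ D₂ T₁ T₂ T - D₁ / Fintype.card J₁ - D₂ / Fintype.card J₂ -
        wrongBound (Fintype.card W₁) (Fintype.card W₂) (Fintype.card J₁) (Fintype.card J₂)
          T₁ T₂ T ≤
      ∑ cb : W₁ × W₂ → Cluster U V₁ V₂ W₁ W₂ J₁ J₂, (∏ o, σ.clusterLaw (cb o)) *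
        ∑ z : S₁ × S₂ × Y × X₁ × X₂,
          σ.likelihoodEnc₁ (cb o).1 ((cb o).2.1 w.1) z.1 z.2.2.2.1 *
            σ.likelihoodEnc₂ (cb o).1 ((cb o).2.2 w.2) z.2.1 z.2.2.2.2 *
            (if σ.crib₁ T₁ (cb o) z.1 z.2.2.2.2 = w.2 ∧ σ.crib₂ T₂ (cb o) z.2.1 z.2.2.2.1 = w.1 ∧
                σ.dec T cb w z.2.2.1 = o then
              PS (z.1, z.2.1) * W z.2.2.2.1 z.2.2.2.2 z.1 z.2.1 z.2.2.1 else 0) := by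
  set η := wrongBound (Fintype.card W₁) (Fintype.card W₂) (Fintype.card J₁) (Fintype.card J₂)
      T₁ T₂ T with hηdef
  set G := σ.typicalProb PS W D₁ D₂ T₁ T₂ T
  have hG0 : 0 ≤ G := σ.typicalProb_nonneg hPS hW _ _ _ _ _
  have hη0 : 0 ≤ η := by
    have h1 : (1 : ℝ) ≤ Fintype.card W₁ := by exact_mod_cast Fintype.card_pos (α := W₁)
    have h2 : (1 : ℝ) ≤ Fintype.card W₂ := by exact_mod_cast Fintype.card_pos (α := W₂)
    have h3 : (0 : ℝ) ≤ Fintype.card W₁ - 1 := by linarith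
    have h4 : (0 : ℝ) ≤ Fintype.card W₂ - 1 := by linarith
    rw [hηdef, wrongBound]
    positivity
  have hd₁ : 0 ≤ D₁ / Fintype.card J₁ := by positivity
  have hd₂ : 0 ≤ D₂ / Fintype.card J₂ := by positivity
  have hE := σ.typicalProb_mul_le (J₁ := J₁) (J₂ := J₂) (D₁ := D₁) (D₂ := D₂) hPS hW T₁ T₂ T
  set d₁ := D₁ / (Fintype.card J₁ : ℝ)
  set d₂ := D₂ / (Fintype.card J₂ : ℝ)
  set E := ∑ u, σ.PU u * ∑ a : J₁ → V₁, (∏ j, σ.q₁ u (a j)) * ∑ b : J₂ → V₂, (∏ j, σ.q₂ u (b j)) *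
        ∑ z : S₁ × S₂ × Y × X₁ × X₂, σ.selectedProb PS W T₁ T₂ T z u a b with hEdef
  have hEz : E = ∑ z : S₁ × S₂ × Y × X₁ × X₂, ∑ cl : Cluster U V₁ V₂ W₁ W₂ J₁ J₂,
      σ.clusterLaw cl * σ.selectedProb PS W T₁ T₂ T z cl.1 (cl.2.1 w.1) (cl.2.2 w.2) := by
    rw [Finset.sum_comm]
    simp_rw [← Finset.mul_sum]
    rw [σ.sum_clusterLaw_mul, hEdef]
    refine Finset.sum_congr rfl fun u _ => ?_
    congr 1
    rw [← sum_prod_prod_mul_apply (W₁ := W₁) (σ.q₁_mem u).2 w.1]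
    refine Finset.sum_congr rfl fun c₁ _ => ?_
    congr 1
    rw [← sum_prod_prod_mul_apply (W₁ := W₂) (σ.q₂_mem u).2 w.2]
  calc G - d₁ - d₂ - η ≤ (1 - d₁ - d₂) * G * (1 - η) := by
        have ha : (1 - η) * ((d₁ + d₂) * G) ≤ d₁ + d₂ :=
          (mul_le_of_le_one_left (by positivity) (by linarith)).trans
            (mul_le_of_le_one_right (by positivity) hG)
        have hb : η * G ≤ η := mul_le_of_le_one_right hη0 hG
        linarith
    _ ≤ E * (1 - η) := mul_le_mul_of_nonneg_right hE (by linarith)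
    _ ≤ ∑ z : S₁ × S₂ × Y × X₁ × X₂,
        ∑ cb : W₁ × W₂ → Cluster U V₁ V₂ W₁ W₂ J₁ J₂, (∏ o, σ.clusterLaw (cb o)) *
        (σ.selectedProb PS W T₁ T₂ T z (cb o).1 ((cb o).2.1 w.1) ((cb o).2.2 w.2) *
          (1 - σ.wrongCount T₁ T₂ T cb o w z)) := by
        rw [hEz, Finset.sum_mul]
        exact Finset.sum_le_sum fun z _ => σ.le_sum_wrongCount hT₁ hT₂ hT o w z
          (σ.selectedProb_nonneg hPS hW T₁ T₂ T z)
    _ = ∑ cb : W₁ × W₂ → Cluster U V₁ V₂ W₁ W₂ J₁ J₂, (∏ o, σ.clusterLaw (cb o)) *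
        ∑ z : S₁ × S₂ × Y × X₁ × X₂,
        (σ.selectedProb PS W T₁ T₂ T z (cb o).1 ((cb o).2.1 w.1) ((cb o).2.2 w.2) *
          (1 - σ.wrongCount T₁ T₂ T cb o w z)) := by
        rw [Finset.sum_comm]
        simp_rw [← Finset.mul_sum]
    _ ≤ _ := Finset.sum_le_sum fun cb _ => mul_le_mul_of_nonneg_left
        (Finset.sum_le_sum fun z _ => σ.selectedProb_mul_le hPS hW T₁ T₂ T cb o w z)
        (Finset.prod_nonneg fun o _ => σ.clusterLaw_nonneg _)

/-- The one-shot coding theorem: for every weight `π` on the pairs of old and fresh messages there is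
a deterministic block code whose success probability, averaged with weight `π`, is at least the
average for the random code. -/
theorem exists_blockCode [Nonempty X₁] [Nonempty X₂] {PS : S₁ × S₂ → ℝ}
    {W : X₁ → X₂ → S₁ → S₂ → Y → ℝ} (hPS : ∀ s, 0 ≤ PS s)
    (hW : ∀ x₁ x₂ s₁ s₂ y, 0 ≤ W x₁ x₂ s₁ s₂ y) {D₁ D₂ T₁ T₂ T : ℝ} (hD₁ : 0 ≤ D₁) (hD₂ : 0 ≤ D₂)
    (hT₁ : 0 < T₁) (hT₂ : 0 < T₂) (hT : 0 < T) (hG : σ.typicalProb PS W D₁ D₂ T₁ T₂ T ≤ 1)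
    (hη : wrongBound (Fintype.card W₁) (Fintype.card W₂) (Fintype.card J₁) (Fintype.card J₂)
      T₁ T₂ T ≤ 1)
    {π : (W₁ × W₂) × (W₁ × W₂) → ℝ} (hπ : ∀ i, 0 ≤ π i) :
    ∃ c : BlockCode S₁ S₂ X₁ X₂ Y W₁ W₂, ∑ i, π i *
      (σ.typicalProb PS W D₁ D₂ T₁ T₂ T - D₁ / Fintype.card J₁ - D₂ / Fintype.card J₂ -
        wrongBound (Fintype.card W₁) (Fintype.card W₂) (Fintype.card J₁) (Fintype.card J₂)
          T₁ T₂ T) ≤ ∑ i, π i * c.correctProb PS W i.1 i.2 := by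
  classical
  have havg := Finset.sum_le_sum fun i (_ : i ∈ Finset.univ) => mul_le_mul_of_nonneg_left
    (σ.le_sum_correct (J₁ := J₁) (J₂ := J₂) hPS hW hD₁ hD₂ hT₁ hT₂ hT hG hη i.1 i.2) (hπ i)
  simp_rw [Finset.mul_sum (s := (Finset.univ : Finset (W₁ × W₂ → Cluster U V₁ V₂ W₁ W₂ J₁ J₂)))]
    at havg
  rw [Finset.sum_comm] at havg
  simp_rw [mul_left_comm (π _), ← Finset.mul_sum] at havg
  obtain ⟨cb, hcb⟩ := exists_le_of_sum_mul_le
    (fun cb => Finset.prod_nonneg fun o _ => σ.clusterLaw_nonneg (cb o))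
    (sum_prod_eq_one fun _ => σ.sum_clusterLaw) havg
  obtain ⟨f₁, f₂, hf⟩ := exists_maps_sum_le
    (I := ((W₁ × W₂) × (W₁ × W₂)) × S₁ × S₂ × Y)
    (α₁ := fun i => (i.1.1, i.1.2.1, i.2.1)) (α₂ := fun i => (i.1.1, i.1.2.2, i.2.2.1))
    (K₁ := fun a x => σ.likelihoodEnc₁ (cb a.1).1 ((cb a.1).2.1 a.2.1) a.2.2 x)
    (fun _ _ => σ.likelihoodEnc₁_nonneg _ _ _ _) (fun _ => σ.sum_likelihoodEnc₁_le _ _ _)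
    (K₂ := fun a x => σ.likelihoodEnc₂ (cb a.1).1 ((cb a.1).2.2 a.2.1) a.2.2 x)
    (fun _ _ => σ.likelihoodEnc₂_nonneg _ _ _ _) (fun _ => σ.sum_likelihoodEnc₂_le _ _ _)
    (h := fun i x₁ x₂ => π i.1 *
      if σ.crib₁ T₁ (cb i.1.1) i.2.1 x₂ = i.1.2.2 ∧ σ.crib₂ T₂ (cb i.1.1) i.2.2.1 x₁ = i.1.2.1 ∧
            σ.dec T cb i.1.2 i.2.2.2 = i.1.1 then
          PS (i.2.1, i.2.2.1) * W x₁ x₂ i.2.1 i.2.2.1 i.2.2.2 else 0)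
    (fun i x₁ x₂ => mul_nonneg (hπ _) (by
      split_ifs
      exacts [mul_nonneg (hPS _) (hW _ _ _ _ _), le_rfl]))
  refine ⟨⟨fun o w s => f₁ (o, w, s), fun o w s => f₂ (o, w, s), fun o s x => σ.crib₁ T₁ (cb o) s x,
    fun o s x => σ.crib₂ T₂ (cb o) s x, fun w y => σ.dec T cb w y⟩, hcb.trans (le_trans (le_of_eq ?_)
      (hf.trans (le_of_eq ?_)))⟩
  · refine Eq.trans ?_ (Fintype.sum_prod_type _).symm
    refine Finset.sum_congr rfl fun i _ => ?_
    simp only [Fintype.sum_prod_type, Finset.mul_sum]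
    refine Finset.sum_congr rfl fun s₁ _ => Finset.sum_congr rfl fun s₂ _ =>
      Finset.sum_congr rfl fun y _ => Finset.sum_congr rfl fun x₁ _ =>
      Finset.sum_congr rfl fun x₂ _ => ?_
    ring
  · refine (Fintype.sum_prod_type _).trans ?_
    refine Finset.sum_congr rfl fun i _ => ?_
    simp only [Fintype.sum_prod_type, BlockCode.correctProb, BlockCode.Correct, Finset.mul_sum]
    refine Finset.sum_congr rfl fun s₁ _ => Finset.sum_congr rfl fun s₂ _ =>
      Finset.sum_congr rfl fun y _ => ?_
    congr 1
    split
    · rename_i h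
      exact (if_pos h).symm
    · rename_i h
      exact (if_neg h).symm

end Average

end Scheme

/-! ### Splitting a sequence into blocks -/

section Blocks

variable {α : Type*}

/-- A finite sequence, continued by an arbitrary constant. -/
noncomputable def extend [Nonempty α] {k : ℕ} (f : Fin k → α) (t : ℕ) : α :=
  if h : t < k then f ⟨t, h⟩ else Classical.arbitrary α

/-- The `b`-th block of length `m` of a sequence. -/
def block (m : ℕ) (f : ℕ → α) (b : ℕ) (i : Fin m) : α := f (b * m + i)

/-- The times in `K` blocks of length `m`, followed by a remainder of length `r`. -/
def timeEquiv (K m r : ℕ) : (Fin K × Fin m) ⊕ Fin r ≃ Fin (K * m + r) :=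
  (Equiv.sumCongr finProdFinEquiv (Equiv.refl _)).trans finSumFinEquiv

theorem timeEquiv_inl_val {K m r : ℕ} (b : Fin K) (i : Fin m) :
    (timeEquiv K m r (.inl (b, i)) : ℕ) = b * m + i := by
  simp [timeEquiv, finProdFinEquiv]
  ring

theorem timeEquiv_inr_val {K m r : ℕ} (k : Fin r) :
    (timeEquiv K m r (.inr k) : ℕ) = K * m + k := by
  simp [timeEquiv]

theorem block_extend [Nonempty α] {K m r : ℕ} (f : Fin (K * m + r) → α) (b : Fin K) :
    block m (extend f) b = fun i => f (timeEquiv K m r (.inl (b, i))) := by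
  funext i
  have h := (timeEquiv K m r (.inl (b, i))).2
  have e := timeEquiv_inl_val (r := r) b i
  rw [block, extend, dif_pos (by rw [← e]; exact h)]
  congr 1
  exact Fin.ext e.symm

/-- Triples of sequences correspond to sequences of blocks of triples and a remainder. -/
def splitEquiv (K m r : ℕ) (α β γ : Type*) :
    (Fin (K * m + r) → α) × (Fin (K * m + r) → β) × (Fin (K * m + r) → γ) ≃
      (Fin K → (Fin m → α) × (Fin m → β) × (Fin m → γ)) × (Fin r → α × β × γ) where
  toFun z :=
    (fun b => (fun i => z.1 (timeEquiv K m r (.inl (b, i))),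
        fun i => z.2.1 (timeEquiv K m r (.inl (b, i))),
        fun i => z.2.2 (timeEquiv K m r (.inl (b, i)))),
      fun k => (z.1 (timeEquiv K m r (.inr k)), z.2.1 (timeEquiv K m r (.inr k)),
        z.2.2 (timeEquiv K m r (.inr k))))
  invFun p :=
    (fun t => Sum.elim (fun bi => (p.1 bi.1).1 bi.2) (fun k => (p.2 k).1)
        ((timeEquiv K m r).symm t),
      fun t => Sum.elim (fun bi => (p.1 bi.1).2.1 bi.2) (fun k => (p.2 k).2.1)
        ((timeEquiv K m r).symm t),
      fun t => Sum.elim (fun bi => (p.1 bi.1).2.2 bi.2) (fun k => (p.2 k).2.2)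
        ((timeEquiv K m r).symm t))
  left_inv z := by
    have h : ∀ {δ : Type _} (f : Fin (K * m + r) → δ) t,
        Sum.elim (fun bi : Fin K × Fin m => f (timeEquiv K m r (.inl (bi.1, bi.2))))
          (fun k => f (timeEquiv K m r (.inr k))) ((timeEquiv K m r).symm t) = f t := by
      intro δ f t
      obtain ⟨x, rfl⟩ := (timeEquiv K m r).surjective t
      rw [Equiv.symm_apply_apply]
      rcases x with ⟨b, i⟩ | k <;> rfl
    refine Prod.ext (funext fun t => ?_) (Prod.ext (funext fun t => ?_) (funext fun t => ?_))
    · exact h z.1 t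
    · obtain ⟨x, rfl⟩ := (timeEquiv K m r).surjective t
      simp only [Equiv.symm_apply_apply]
      rcases x with ⟨b, i⟩ | k <;> rfl
    · obtain ⟨x, rfl⟩ := (timeEquiv K m r).surjective t
      simp only [Equiv.symm_apply_apply]
      rcases x with ⟨b, i⟩ | k <;> rfl
  right_inv p := by
    simp only [Equiv.symm_apply_apply, Sum.elim_inl, Sum.elim_inr]

theorem prod_timeEquiv {M : Type*} [CommMonoid M] {K m r : ℕ} (f : Fin (K * m + r) → M) :
    ∏ t, f t = (∏ b, ∏ i, f (timeEquiv K m r (.inl (b, i)))) *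
      ∏ k, f (timeEquiv K m r (.inr k)) := by
  rw [← (timeEquiv K m r).prod_comp, Fintype.prod_sum_type, Fintype.prod_prod_type]

end Blocks

/-! ### The block-Markov code -/

/-- The memoryless extension of the state law. -/
def statePow {S₁ S₂ : Type*} (PS : S₁ × S₂ → ℝ) (m : ℕ) (s : (Fin m → S₁) × (Fin m → S₂)) : ℝ :=
  ∏ i, PS (s.1 i, s.2 i)

/-- The memoryless extension of the channel. -/
def channelPow {S₁ S₂ X₁ X₂ Y : Type*} (W : X₁ → X₂ → S₁ → S₂ → Y → ℝ) (m : ℕ) (x₁ : Fin m → X₁)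
    (x₂ : Fin m → X₂) (s₁ : Fin m → S₁) (s₂ : Fin m → S₂) (y : Fin m → Y) : ℝ :=
  ∏ i, W (x₁ i) (x₂ i) (s₁ i) (s₂ i) (y i)

section BlockMarkov

variable {S₁ S₂ X₁ X₂ Y W₁ W₂ : Type*} {m : ℕ}

/-- The sequence of messages of one encoder that starts with `d`, goes through `a`, and continues
with `d`: in block `b` the old message is `messageSeq d a b`, the fresh one is
`messageSeq d a (b + 1)`. -/
def messageSeq {A : Type*} {B : ℕ} (d : A) (a : Fin B → A) : ℕ → A
  | 0 => d
  | k + 1 => if h : k < B then a ⟨k, h⟩ else d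

namespace BlockCode

variable (c : BlockCode (Fin m → S₁) (Fin m → S₂) (Fin m → X₁) (Fin m → X₂) (Fin m → Y) W₁ W₂)

/-- The estimates that encoder 1 forms of the messages of encoder 2. -/
def est₁ (d₂ : W₂) (μ₁ : ℕ → W₁) (s₁ : ℕ → Fin m → S₁) (x₂ : ℕ → Fin m → X₂) : ℕ → W₂
  | 0 => d₂
  | b + 1 => c.crib₁ (μ₁ b, est₁ d₂ μ₁ s₁ x₂ b) (s₁ b) (x₂ b)

/-- The estimates that encoder 2 forms of the messages of encoder 1. -/
def est₂ (d₁ : W₁) (μ₂ : ℕ → W₂) (s₂ : ℕ → Fin m → S₂) (x₁ : ℕ → Fin m → X₁) : ℕ → W₁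
  | 0 => d₁
  | b + 1 => c.crib₂ (est₂ d₁ μ₂ s₂ x₁ b, μ₂ b) (s₂ b) (x₁ b)

/-- The message pairs found by backward decoding of the blocks `B`, `B - 1`, …. -/
def decodeBack (d : W₁ × W₂) (B : ℕ) (y : ℕ → Fin m → Y) : ℕ → W₁ × W₂
  | 0 => d
  | k + 1 => c.dec (decodeBack d B y k) (y (B - k))

/-- The input that encoder 1 produces at time `t` if its estimates of the messages of encoder 2 are
correct. After the last block, the input is constant. -/
noncomputable def genie₁ [Nonempty X₁] (hm : 0 < m) (B : ℕ) (μ : ℕ → W₁ × W₂) (s₁ : ℕ → S₁)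
    (t : ℕ) : X₁ :=
  if t / m ≤ B then
    c.enc₁ (μ (t / m)) (μ (t / m + 1)).1 (block m s₁ (t / m)) ⟨t % m, Nat.mod_lt t hm⟩
  else Classical.arbitrary X₁

/-- The input that encoder 2 produces at time `t` if its estimates of the messages of encoder 1 are
correct. -/
noncomputable def genie₂ [Nonempty X₂] (hm : 0 < m) (B : ℕ) (μ : ℕ → W₁ × W₂) (s₂ : ℕ → S₂)
    (t : ℕ) : X₂ :=
  if t / m ≤ B then
    c.enc₂ (μ (t / m)) (μ (t / m + 1)).2 (block m s₂ (t / m)) ⟨t % m, Nat.mod_lt t hm⟩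
  else Classical.arbitrary X₂

theorem div_mul_add_lt {b j : ℕ} (i : Fin m) (hb : b < j / m) : b * m + i < j := by
  have h1 : (b + 1) * m ≤ j / m * m := Nat.mul_le_mul_right _ hb
  have h2 := Nat.div_mul_le_self j m
  have h3 := i.2
  linarith [add_mul b 1 m]

theorem block_genie₁ [Nonempty X₁] (hm : 0 < m) {B : ℕ} (μ : ℕ → W₁ × W₂) (s : ℕ → S₁) {b : ℕ} (hb : b ≤ B) :
    block m (c.genie₁ hm B μ s) b = c.enc₁ (μ b) (μ (b + 1)).1 (block m s b) := by
  funext i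
  have e1 : (b * m + i) / m = b := by
    rw [mul_comm, Nat.mul_add_div hm, Nat.div_eq_of_lt i.2, add_zero]
  have e2 : (b * m + i) % m = i := by
    rw [mul_comm, Nat.mul_add_mod, Nat.mod_eq_of_lt i.2]
  simp only [block, genie₁, e1, e2, if_pos hb]

theorem block_genie₂ [Nonempty X₂] (hm : 0 < m) {B : ℕ} (μ : ℕ → W₁ × W₂) (s : ℕ → S₂) {b : ℕ} (hb : b ≤ B) :
    block m (c.genie₂ hm B μ s) b = c.enc₂ (μ b) (μ (b + 1)).2 (block m s b) := by
  funext i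
  have e1 : (b * m + i) / m = b := by
    rw [mul_comm, Nat.mul_add_div hm, Nat.div_eq_of_lt i.2, add_zero]
  have e2 : (b * m + i) % m = i := by
    rw [mul_comm, Nat.mul_add_mod, Nat.mod_eq_of_lt i.2]
  simp only [block, genie₂, e1, e2, if_pos hb]

variable [Nonempty S₁] [Nonempty S₂] [Nonempty X₁] [Nonempty X₂] [Nonempty Y]

/-- The block-Markov code: `B + 1` blocks of length `m` transmit `B` messages of the block code for
each encoder, into which the messages are embedded by `φ₁` and `φ₂`. -/
noncomputable def toCode {n N₁ N₂ : ℕ} [NeZero N₁] [NeZero N₂] (hm : 0 < m) (B : ℕ)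
    (d : W₁ × W₂) (φ₁ : Fin N₁ → Fin B → W₁) (φ₂ : Fin N₂ → Fin B → W₂) :
    Code S₁ S₂ X₁ X₂ Y n N₁ N₂ where
  enc₁ j w s x :=
    let μ₁ := messageSeq d.1 (φ₁ w)
    let σ := block m (extend s)
    if (j : ℕ) / m ≤ B then
      c.enc₁ (μ₁ (j / m), c.est₁ d.2 μ₁ σ (block m (extend x)) (j / m)) (μ₁ (j / m + 1))
        (σ (j / m)) ⟨j % m, Nat.mod_lt j hm⟩
    else Classical.arbitrary X₁
  enc₂ j w s x :=
    let μ₂ := messageSeq d.2 (φ₂ w)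
    let σ := block m (extend s)
    if (j : ℕ) / m ≤ B then
      c.enc₂ (c.est₂ d.1 μ₂ σ (block m (extend x)) (j / m), μ₂ (j / m)) (μ₂ (j / m + 1))
        (σ (j / m)) ⟨j % m, Nat.mod_lt j hm⟩
    else Classical.arbitrary X₂
  dec y :=
    let ŵ := c.decodeBack d B (block m (extend y))
    (Function.invFun φ₁ fun k => (ŵ (B - k)).1, Function.invFun φ₂ fun k => (ŵ (B - k)).2)

/-- The pair of message sequences of the block-Markov code. -/
def messages {N₁ N₂ B : ℕ} (d : W₁ × W₂) (φ₁ : Fin N₁ → Fin B → W₁) (φ₂ : Fin N₂ → Fin B → W₂)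
    (w₁ : Fin N₁) (w₂ : Fin N₂) (k : ℕ) : W₁ × W₂ :=
  (messageSeq d.1 (φ₁ w₁) k, messageSeq d.2 (φ₂ w₂) k)

variable {n N₁ N₂ : ℕ} [NeZero N₁] [NeZero N₂] (hm : 0 < m) {B : ℕ}
    (d : W₁ × W₂) (φ₁ : Fin N₁ → Fin B → W₁) (φ₂ : Fin N₂ → Fin B → W₂)

theorem toCode_dec (hφ₁ : Function.Injective φ₁) (hφ₂ : Function.Injective φ₂) (w₁ : Fin N₁)
    (w₂ : Fin N₂) (y : Fin n → Y)
    (h : ∀ b ≤ B, c.dec (messages d φ₁ φ₂ w₁ w₂ (b + 1)) (block m (extend y) b) =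
      messages d φ₁ φ₂ w₁ w₂ b) :
    (c.toCode (n := n) hm B d φ₁ φ₂).dec y = (w₁, w₂) := by
  have hback : ∀ k ≤ B + 1, c.decodeBack d B (block m (extend y)) k =
      messages d φ₁ φ₂ w₁ w₂ (B + 1 - k) := by
    intro k
    induction k with
    | zero => intro _; simp [decodeBack, messages, messageSeq]
    | succ k ih =>
      intro hk
      rw [decodeBack, ih (by omega)]
      have e1 : B + 1 - k = B - k + 1 := by omega
      have e2 : B + 1 - (k + 1) = B - k := by omega
      rw [e1, e2]
      exact h _ (by omega)
  have hk : ∀ k : Fin B, c.decodeBack d B (block m (extend y)) (B - k) =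
      (φ₁ w₁ k, φ₂ w₂ k) := by
    intro k
    rw [hback _ (by omega)]
    have e1 : B + 1 - (B - (k : ℕ)) = k + 1 := by omega
    rw [e1]
    simp [messages, messageSeq]
  have h1 : (fun k : Fin B => (c.decodeBack d B (block m (extend y)) (B - k)).1) = φ₁ w₁ := by
    funext k; rw [hk]
  have h2 : (fun k : Fin B => (c.decodeBack d B (block m (extend y)) (B - k)).2) = φ₂ w₂ := by
    funext k; rw [hk]
  show (Function.invFun φ₁ _, Function.invFun φ₂ _) = _
  rw [h1, h2, Function.leftInverse_invFun hφ₁, Function.leftInverse_invFun hφ₂]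

/-- As long as all estimates of the encoders would be correct with correct earlier estimates, the
inputs are those that correct estimates produce. -/
theorem toCode_inputs (w₁ : Fin N₁) (w₂ : Fin N₂) (s₁ : Fin n → S₁) (s₂ : Fin n → S₂)
    (h₁ : ∀ b ≤ B, c.crib₁ (messages d φ₁ φ₂ w₁ w₂ b) (block m (extend s₁) b)
      (c.enc₂ (messages d φ₁ φ₂ w₁ w₂ b) (messages d φ₁ φ₂ w₁ w₂ (b + 1)).2
        (block m (extend s₂) b)) = (messages d φ₁ φ₂ w₁ w₂ (b + 1)).2)
    (h₂ : ∀ b ≤ B, c.crib₂ (messages d φ₁ φ₂ w₁ w₂ b) (block m (extend s₂) b)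
      (c.enc₁ (messages d φ₁ φ₂ w₁ w₂ b) (messages d φ₁ φ₂ w₁ w₂ (b + 1)).1
        (block m (extend s₁) b)) = (messages d φ₁ φ₂ w₁ w₂ (b + 1)).1) :
    ∀ (j : ℕ) (hj : j < n),
      (c.toCode hm B d φ₁ φ₂).x₁ w₁ w₂ s₁ s₂ ⟨j, hj⟩ =
        c.genie₁ hm B (messages d φ₁ φ₂ w₁ w₂) (extend s₁) j ∧
      (c.toCode hm B d φ₁ φ₂).x₂ w₁ w₂ s₁ s₂ ⟨j, hj⟩ =
        c.genie₂ hm B (messages d φ₁ φ₂ w₁ w₂) (extend s₂) j := by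
  intro j
  induction j using Nat.strong_induction_on with
  | _ j ih =>
  intro hj
  set μ := messages d φ₁ φ₂ w₁ w₂ with hμ
  rw [Code.x₁_eq, Code.x₂_eq]
  have hx₁ : (fun i : Fin j => (c.toCode hm B d φ₁ φ₂).x₁ w₁ w₂ s₁ s₂ ⟨i, i.2.trans hj⟩) =
      fun i : Fin j => c.genie₁ hm B μ (extend s₁) i := by
    funext i; exact (ih i i.2 _).1
  have hx₂ : (fun i : Fin j => (c.toCode hm B d φ₁ φ₂).x₂ w₁ w₂ s₁ s₂ ⟨i, i.2.trans hj⟩) =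
      fun i : Fin j => c.genie₂ hm B μ (extend s₂) i := by
    funext i; exact (ih i i.2 _).2
  simp only [hx₁, hx₂]
  -- only complete blocks of past inputs enter the estimates
  have hb₁ : ∀ b, b < j / m → b ≤ B →
      block m (extend fun i : Fin j => c.genie₁ hm B μ (extend s₁) i) b =
        c.enc₁ (μ b) (μ (b + 1)).1 (block m (extend s₁) b) := by
    intro b hb hB
    rw [← c.block_genie₁ hm μ (extend s₁) hB]
    funext i
    rw [block, extend, dif_pos (div_mul_add_lt i hb)]
    rfl
  have hb₂ : ∀ b, b < j / m → b ≤ B →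
      block m (extend fun i : Fin j => c.genie₂ hm B μ (extend s₂) i) b =
        c.enc₂ (μ b) (μ (b + 1)).2 (block m (extend s₂) b) := by
    intro b hb hB
    rw [← c.block_genie₂ hm μ (extend s₂) hB]
    funext i
    rw [block, extend, dif_pos (div_mul_add_lt i hb)]
    rfl
  have hest₁ : ∀ b, b ≤ j / m → b ≤ B → c.est₁ d.2 (messageSeq d.1 (φ₁ w₁))
      (block m (extend s₁)) (block m (extend fun i : Fin j => c.genie₂ hm B μ (extend s₂) i)) b =
        (μ b).2 := by
    intro b
    induction b with
    | zero => intro _ _; rfl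
    | succ b ihb =>
      intro hb hB
      rw [est₁, ihb (by omega) (by omega), hb₂ b (by omega) (by omega)]
      exact h₁ b (by omega)
  have hest₂ : ∀ b, b ≤ j / m → b ≤ B → c.est₂ d.1 (messageSeq d.2 (φ₂ w₂))
      (block m (extend s₂)) (block m (extend fun i : Fin j => c.genie₁ hm B μ (extend s₁) i)) b =
        (μ b).1 := by
    intro b
    induction b with
    | zero => intro _ _; rfl
    | succ b ihb =>
      intro hb hB
      rw [est₂, ihb (by omega) (by omega), hb₁ b (by omega) (by omega)]
      exact h₂ b (by omega)
  constructor
  · simp only [toCode, genie₁]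
    split_ifs with hB
    · rw [hest₁ _ le_rfl hB]
      rfl
    · rfl
  · simp only [toCode, genie₂]
    split_ifs with hB
    · rw [hest₂ _ le_rfl hB]
      rfl
    · rfl

end BlockCode

end BlockMarkov

/-! ### The error probability of the block-Markov code -/

section ErrorProbability

variable {S₁ S₂ X₁ X₂ Y : Type*} [Fintype Y]

theorem statePow_nonneg [Fintype S₁] [Fintype S₂] {PS : S₁ × S₂ → ℝ}
    (hPS : PS ∈ stdSimplex ℝ (S₁ × S₂)) (n : ℕ) (s : (Fin n → S₁) × (Fin n → S₂)) :
    0 ≤ statePow PS n s :=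
  Finset.prod_nonneg fun _ _ => hPS.1 _

theorem channelPow_mem {W : X₁ → X₂ → S₁ → S₂ → Y → ℝ}
    (hW : ∀ x₁ x₂ s₁ s₂, W x₁ x₂ s₁ s₂ ∈ stdSimplex ℝ Y) (n : ℕ) (x₁ : Fin n → X₁)
    (x₂ : Fin n → X₂) (s₁ : Fin n → S₁) (s₂ : Fin n → S₂) :
    channelPow W n x₁ x₂ s₁ s₂ ∈ stdSimplex ℝ (Fin n → Y) :=
  ⟨fun _ => Finset.prod_nonneg fun _ _ => (hW _ _ _ _).1 _,
    sum_prod_eq_one (μ := fun i => W (x₁ i) (x₂ i) (s₁ i) (s₂ i)) fun _ => (hW _ _ _ _).2⟩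

variable [Fintype S₁] [Fintype S₂]

theorem sum_statePow {PS : S₁ × S₂ → ℝ} (hPS : PS ∈ stdSimplex ℝ (S₁ × S₂)) (n : ℕ) :
    ∑ s, statePow PS n s = 1 := by
  rw [← (Equiv.arrowProdEquivProdArrow (Fin n) (fun _ => S₁) (fun _ => S₂)).sum_comp]
  exact sum_prod_eq_one fun _ => hPS.2

/-- Whatever the inputs are as functions of the states, states and output form a probability law. -/
theorem sum_statePow_mul_channelPow {PS : S₁ × S₂ → ℝ} (hPS : PS ∈ stdSimplex ℝ (S₁ × S₂))
    {W : X₁ → X₂ → S₁ → S₂ → Y → ℝ} (hW : ∀ x₁ x₂ s₁ s₂, W x₁ x₂ s₁ s₂ ∈ stdSimplex ℝ Y) (n : ℕ)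
    (x₁ : (Fin n → S₁) → (Fin n → S₂) → Fin n → X₁)
    (x₂ : (Fin n → S₁) → (Fin n → S₂) → Fin n → X₂) :
    ∑ z : (Fin n → S₁) × (Fin n → S₂) × (Fin n → Y), statePow PS n (z.1, z.2.1) *
      channelPow W n (x₁ z.1 z.2.1) (x₂ z.1 z.2.1) z.1 z.2.1 z.2.2 = 1 := by
  simp only [Fintype.sum_prod_type, ← Finset.mul_sum, (channelPow_mem hW n _ _ _ _).2, mul_one]
  rw [← Fintype.sum_prod_type (f := fun s => statePow PS n s), sum_statePow hPS]

variable {W₁ W₂ : Type*} {m r : ℕ} [Nonempty S₁] [Nonempty S₂] [Nonempty X₁] [Nonempty X₂]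
  [Nonempty Y]

/-- With correct estimates, the blocks are independent of each other, and each of them follows the
law of a single block. -/
theorem BlockCode.sum_genie_mul
    (c : BlockCode (Fin m → S₁) (Fin m → S₂) (Fin m → X₁) (Fin m → X₂) (Fin m → Y) W₁ W₂)
    {PS : S₁ × S₂ → ℝ} (hPS : PS ∈ stdSimplex ℝ (S₁ × S₂)) {W : X₁ → X₂ → S₁ → S₂ → Y → ℝ}
    (hW : ∀ x₁ x₂ s₁ s₂, W x₁ x₂ s₁ s₂ ∈ stdSimplex ℝ Y) (hm : 0 < m) {B : ℕ} (μ : ℕ → W₁ × W₂)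
    (b : Fin (B + 1)) (f : (Fin m → S₁) → (Fin m → S₂) → (Fin m → Y) → ℝ) :
    ∑ z : (Fin ((B + 1) * m + r) → S₁) × (Fin ((B + 1) * m + r) → S₂) ×
        (Fin ((B + 1) * m + r) → Y),
      statePow PS _ (z.1, z.2.1) * channelPow W _ (fun t => c.genie₁ hm B μ (extend z.1) t)
        (fun t => c.genie₂ hm B μ (extend z.2.1) t) z.1 z.2.1 z.2.2 *
          f (block m (extend z.1) b) (block m (extend z.2.1) b) (block m (extend z.2.2) b) =
      ∑ s₁, ∑ s₂, ∑ y, statePow PS m (s₁, s₂) *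
        channelPow W m (c.enc₁ (μ b) (μ (b + 1)).1 s₁) (c.enc₂ (μ b) (μ (b + 1)).2 s₂) s₁ s₂ y *
          f s₁ s₂ y := by
  let ρ : Fin (B + 1) → (Fin m → S₁) × (Fin m → S₂) × (Fin m → Y) → ℝ := fun b z =>
    statePow PS m (z.1, z.2.1) * channelPow W m (c.enc₁ (μ b) (μ (b + 1)).1 z.1)
      (c.enc₂ (μ b) (μ (b + 1)).2 z.2.1) z.1 z.2.1 z.2.2
  let τ : S₁ × S₂ × Y → ℝ := fun z => PS (z.1, z.2.1) *
    W (Classical.arbitrary X₁) (Classical.arbitrary X₂) z.1 z.2.1 z.2.2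
  have hρ : ∀ b, ∑ z, ρ b z = 1 := fun b =>
    sum_statePow_mul_channelPow hPS hW m (fun s₁ _ => c.enc₁ (μ b) (μ (b + 1)).1 s₁)
      (fun _ s₂ => c.enc₂ (μ b) (μ (b + 1)).2 s₂)
  have hτ : ∑ z, τ z = 1 := by
    simp only [τ, Fintype.sum_prod_type, ← Finset.mul_sum, (hW _ _ _ _).2, mul_one]
    rw [← Fintype.sum_prod_type (f := PS), hPS.2]
  have hg₁ : ∀ (s : ℕ → S₁) (b : Fin (B + 1)) (i : Fin m),
      c.genie₁ hm B μ s (timeEquiv (B + 1) m r (.inl (b, i))) =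
        c.enc₁ (μ b) (μ (b + 1)).1 (block m s b) i := by
    intro s b i
    rw [timeEquiv_inl_val, ← c.block_genie₁ hm μ s (Nat.le_of_lt_succ b.2)]
    rfl
  have hg₂ : ∀ (s : ℕ → S₂) (b : Fin (B + 1)) (i : Fin m),
      c.genie₂ hm B μ s (timeEquiv (B + 1) m r (.inl (b, i))) =
        c.enc₂ (μ b) (μ (b + 1)).2 (block m s b) i := by
    intro s b i
    rw [timeEquiv_inl_val, ← c.block_genie₂ hm μ s (Nat.le_of_lt_succ b.2)]
    rfl
  have hlate : ∀ k : Fin r, ¬ (timeEquiv (B + 1) m r (.inr k) : ℕ) / m ≤ B := by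
    intro k
    rw [timeEquiv_inr_val, not_le]
    exact Nat.lt_of_succ_le ((Nat.le_div_iff_mul_le hm).mpr (Nat.le_add_right _ _))
  have hsplit : ∀ z : (Fin ((B + 1) * m + r) → S₁) × (Fin ((B + 1) * m + r) → S₂) ×
        (Fin ((B + 1) * m + r) → Y),
      statePow PS _ (z.1, z.2.1) * channelPow W _ (fun t => c.genie₁ hm B μ (extend z.1) t)
        (fun t => c.genie₂ hm B μ (extend z.2.1) t) z.1 z.2.1 z.2.2 =
      (∏ b, ρ b ((splitEquiv (B + 1) m r S₁ S₂ Y z).1 b)) *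
        ∏ k, τ ((splitEquiv (B + 1) m r S₁ S₂ Y z).2 k) := by
    intro z
    simp only [ρ, τ, Finset.prod_mul_distrib]
    rw [statePow, channelPow, prod_timeEquiv, prod_timeEquiv, mul_mul_mul_comm]
    congr 1
    · congr 1
      refine Finset.prod_congr rfl fun b _ => Finset.prod_congr rfl fun i _ => ?_
      rw [hg₁, hg₂, block_extend, block_extend]
      rfl
    · congr 1
      refine Finset.prod_congr rfl fun k _ => ?_
      rw [BlockCode.genie₁, BlockCode.genie₂, if_neg (hlate k), if_neg (hlate k)]
      rfl
  let F : (Fin (B + 1) → (Fin m → S₁) × (Fin m → S₂) × (Fin m → Y)) × (Fin r → S₁ × S₂ × Y) → ℝ :=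
    fun p => ((∏ b, ρ b (p.1 b)) * f (p.1 b).1 (p.1 b).2.1 (p.1 b).2.2) * ∏ k, τ (p.2 k)
  have hz : ∀ z : (Fin ((B + 1) * m + r) → S₁) × (Fin ((B + 1) * m + r) → S₂) ×
        (Fin ((B + 1) * m + r) → Y),
      statePow PS _ (z.1, z.2.1) * channelPow W _ (fun t => c.genie₁ hm B μ (extend z.1) t)
        (fun t => c.genie₂ hm B μ (extend z.2.1) t) z.1 z.2.1 z.2.2 *
          f (block m (extend z.1) b) (block m (extend z.2.1) b) (block m (extend z.2.2) b) =
      F (splitEquiv (B + 1) m r S₁ S₂ Y z) := by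
    intro z
    rw [hsplit, block_extend, block_extend, block_extend, mul_right_comm]
    rfl
  refine (Fintype.sum_equiv (splitEquiv (B + 1) m r S₁ S₂ Y) _ F hz).trans ?_
  simp only [F]
  rw [Fintype.sum_prod_type]
  simp_rw [← Finset.mul_sum, sum_prod_eq_one (fun _ : Fin r => hτ), mul_one]
  rw [sum_prod_mul_apply hρ b (fun z => f z.1 z.2.1 z.2.2)]
  simp only [ρ, Fintype.sum_prod_type]

/-- Union bound over the blocks: an error of the block-Markov code means that in some block,
with correct estimates from the other blocks, not all messages are found. -/
theorem BlockCode.toCode_errorProb_le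
    (c : BlockCode (Fin m → S₁) (Fin m → S₂) (Fin m → X₁) (Fin m → X₂) (Fin m → Y) W₁ W₂)
    {PS : S₁ × S₂ → ℝ} (hPS : PS ∈ stdSimplex ℝ (S₁ × S₂)) {W : X₁ → X₂ → S₁ → S₂ → Y → ℝ}
    (hW : ∀ x₁ x₂ s₁ s₂, W x₁ x₂ s₁ s₂ ∈ stdSimplex ℝ Y) (hm : 0 < m) {N₁ N₂ B : ℕ}
    [NeZero N₁] [NeZero N₂] (d : W₁ × W₂) {φ₁ : Fin N₁ → Fin B → W₁} {φ₂ : Fin N₂ → Fin B → W₂}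
    (hφ₁ : Function.Injective φ₁) (hφ₂ : Function.Injective φ₂) :
    (c.toCode (n := (B + 1) * m + r) hm B d φ₁ φ₂).errorProb PS W ≤
      (1 / ((N₁ : ℝ) * N₂)) * ∑ w₁, ∑ w₂, ∑ b : Fin (B + 1),
        (1 - c.correctProb (statePow PS m) (channelPow W m) (messages d φ₁ φ₂ w₁ w₂ b)
          (messages d φ₁ φ₂ w₁ w₂ (b + 1))) := by
  classical
  unfold Code.errorProb
  refine mul_le_mul_of_nonneg_left (Finset.sum_le_sum fun w₁ _ => Finset.sum_le_sum fun w₂ _ => ?_)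
    (by positivity)
  set μ := messages d φ₁ φ₂ w₁ w₂ with hμ
  set C := c.toCode (n := (B + 1) * m + r) hm B d φ₁ φ₂ with hC
  let Z := (Fin ((B + 1) * m + r) → S₁) × (Fin ((B + 1) * m + r) → S₂) ×
    (Fin ((B + 1) * m + r) → Y)
  let P : Z → ℝ := fun z => statePow PS _ (z.1, z.2.1) *
    channelPow W _ (C.x₁ w₁ w₂ z.1 z.2.1) (C.x₂ w₁ w₂ z.1 z.2.1) z.1 z.2.1 z.2.2
  let Q : Z → ℝ := fun z => statePow PS _ (z.1, z.2.1) *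
    channelPow W _ (fun t => c.genie₁ hm B μ (extend z.1) t)
      (fun t => c.genie₂ hm B μ (extend z.2.1) t) z.1 z.2.1 z.2.2
  let G : Fin (B + 1) → Z → Prop := fun b z => c.Correct (μ b) (μ (b + 1))
    (block m (extend z.1) b) (block m (extend z.2.1) b) (block m (extend z.2.2) b)
  have hP1 : ∑ z, P z = 1 := sum_statePow_mul_channelPow hPS hW _
    (fun s₁ s₂ => C.x₁ w₁ w₂ s₁ s₂) (fun s₁ s₂ => C.x₂ w₁ w₂ s₁ s₂)
  have hQ1 : ∑ z, Q z = 1 := sum_statePow_mul_channelPow hPS hW _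
    (fun s₁ _ t => c.genie₁ hm B μ (extend s₁) t) (fun _ s₂ t => c.genie₂ hm B μ (extend s₂) t)
  have hP0 : ∀ z, 0 ≤ P z := fun z =>
    mul_nonneg (statePow_nonneg hPS _ _) ((channelPow_mem hW _ _ _ _ _).1 _)
  have hQ0 : ∀ z, 0 ≤ Q z := fun z =>
    mul_nonneg (statePow_nonneg hPS _ _) ((channelPow_mem hW _ _ _ _ _).1 _)
  have hPQ : ∀ z, (∀ b, G b z) → P z = Q z := by
    intro z hz
    have := c.toCode_inputs hm d φ₁ φ₂ w₁ w₂ z.1 z.2.1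
      (fun b hb => (hz ⟨b, Nat.lt_succ_of_le hb⟩).1) (fun b hb => (hz ⟨b, Nat.lt_succ_of_le hb⟩).2.1)
    simp only [P, Q]
    congr 2
    · funext t; exact (this t t.2).1
    · funext t; exact (this t t.2).2
  have hdec : ∀ z, (∀ b, G b z) → C.dec z.2.2 = (w₁, w₂) := fun z hz =>
    c.toCode_dec hm d φ₁ φ₂ hφ₁ hφ₂ w₁ w₂ z.2.2
      (fun b hb => (hz ⟨b, Nat.lt_succ_of_le hb⟩).2.2)
  calc _ = ∑ z, if C.dec z.2.2 ≠ (w₁, w₂) then P z else 0 := by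
        simp only [Z, Fintype.sum_prod_type]
        rfl
    _ ≤ ∑ z, (P z - if ∀ b, G b z then Q z else 0) := by
        refine Finset.sum_le_sum fun z _ => ?_
        by_cases hz : ∀ b, G b z
        · rw [if_pos hz, if_neg (not_not.mpr (hdec z hz)), hPQ z hz, sub_self]
        · rw [if_neg hz, sub_zero]
          split_ifs
          exacts [le_rfl, hP0 z]
    _ = ∑ z, (Q z - if ∀ b, G b z then Q z else 0) := by
        rw [Finset.sum_sub_distrib, Finset.sum_sub_distrib, hP1, hQ1]
    _ ≤ ∑ z, ∑ b, (Q z - Q z * if G b z then 1 else 0) := by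
        refine Finset.sum_le_sum fun z _ => ?_
        have hterm : ∀ b, 0 ≤ Q z - Q z * if G b z then 1 else 0 := fun b => by
          split_ifs
          · simp
          · simpa using hQ0 z
        by_cases hz : ∀ b, G b z
        · rw [if_pos hz, sub_self]
          exact Finset.sum_nonneg fun b _ => hterm b
        · rw [if_neg hz, sub_zero]
          push Not at hz
          obtain ⟨b, hb⟩ := hz
          refine le_trans (le_of_eq ?_)
            (Finset.single_le_sum (fun b _ => hterm b) (Finset.mem_univ b))
          simp [hb]
    _ = ∑ b : Fin (B + 1), (1 - c.correctProb (statePow PS m) (channelPow W m) (μ b)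
          (μ (b + 1))) := by
        rw [Finset.sum_comm]
        refine Finset.sum_congr rfl fun b _ => ?_
        rw [Finset.sum_sub_distrib, hQ1]
        congr 1
        refine (c.sum_genie_mul hPS hW hm μ b (fun s₁ s₂ y =>
          if c.Correct (μ b) (μ (b + 1)) s₁ s₂ y then 1 else 0)).trans ?_
        unfold correctProb
        refine Finset.sum_congr rfl fun s₁ _ => Finset.sum_congr rfl fun s₂ _ =>
          Finset.sum_congr rfl fun y _ => ?_
        rw [mul_ite, mul_one, mul_zero]

/-- If for every weight on the message pairs there is a block code with average error probability at
most `δ`, then there are block-Markov codes with error probability at most `(B + 1) δ`. -/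
theorem exists_code_errorProb_le [Fintype W₁] [Fintype W₂] [Nonempty W₁] [Nonempty W₂]
    {PS : S₁ × S₂ → ℝ} (hPS : PS ∈ stdSimplex ℝ (S₁ × S₂)) {W : X₁ → X₂ → S₁ → S₂ → Y → ℝ}
    (hW : ∀ x₁ x₂ s₁ s₂, W x₁ x₂ s₁ s₂ ∈ stdSimplex ℝ Y) (hm : 0 < m) {N₁ N₂ B : ℕ}
    [NeZero N₁] [NeZero N₂] (hN₁ : N₁ ≤ Fintype.card W₁ ^ B) (hN₂ : N₂ ≤ Fintype.card W₂ ^ B)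
    {δ : ℝ}
    (h : ∀ π : (W₁ × W₂) × (W₁ × W₂) → ℝ, (∀ i, 0 ≤ π i) →
      ∃ c : BlockCode (Fin m → S₁) (Fin m → S₂) (Fin m → X₁) (Fin m → X₂) (Fin m → Y) W₁ W₂,
        ∑ i, π i * (1 - δ) ≤ ∑ i, π i * c.correctProb (statePow PS m) (channelPow W m) i.1 i.2) :
    ∃ c : Code S₁ S₂ X₁ X₂ Y ((B + 1) * m + r) N₁ N₂, c.errorProb PS W ≤ (B + 1) * δ := by
  classical
  obtain ⟨φ₁⟩ : Nonempty (Fin N₁ ↪ (Fin B → W₁)) := by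
    rw [Function.Embedding.nonempty_iff_card_le]; simpa using hN₁
  obtain ⟨φ₂⟩ : Nonempty (Fin N₂ ↪ (Fin B → W₂)) := by
    rw [Function.Embedding.nonempty_iff_card_le]; simpa using hN₂
  let d : W₁ × W₂ := Classical.arbitrary _
  let I := Fin N₁ × Fin N₂ × Fin (B + 1)
  let ν : I → (W₁ × W₂) × (W₁ × W₂) := fun k =>
    (BlockCode.messages d φ₁ φ₂ k.1 k.2.1 k.2.2, BlockCode.messages d φ₁ φ₂ k.1 k.2.1 (k.2.2 + 1))
  -- the number of times that the code uses each pair of old and fresh messages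
  let π : (W₁ × W₂) × (W₁ × W₂) → ℝ := fun i => ∑ k, if ν k = i then 1 else 0
  have hπ : ∀ f : (W₁ × W₂) × (W₁ × W₂) → ℝ, ∑ i, π i * f i = ∑ k, f (ν k) := by
    intro f
    simp only [π, Finset.sum_mul]
    rw [Finset.sum_comm]
    simp
  obtain ⟨c, hc⟩ := h π fun i => Finset.sum_nonneg fun k _ => by split_ifs <;> norm_num
  refine ⟨c.toCode hm B d φ₁ φ₂, (c.toCode_errorProb_le hPS hW hm d φ₁.injective φ₂.injective).trans ?_⟩
  rw [hπ, hπ (fun i => c.correctProb (statePow PS m) (channelPow W m) i.1 i.2)] at hc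
  have hN₁0 : (0 : ℝ) < N₁ := by exact_mod_cast Nat.pos_of_ne_zero (NeZero.ne N₁)
  have hN₂0 : (0 : ℝ) < N₂ := by exact_mod_cast Nat.pos_of_ne_zero (NeZero.ne N₂)
  rw [div_mul_eq_mul_div, one_mul, div_le_iff₀ (by positivity)]
  have hcard : (Fintype.card I : ℝ) = N₁ * (N₂ * (B + 1)) := by simp [I]
  rw [Finset.sum_const, Finset.card_univ, nsmul_eq_mul, hcard] at hc
  have hsum : ∑ w₁, ∑ w₂, ∑ b : Fin (B + 1),
        (1 - c.correctProb (statePow PS m) (channelPow W m) (BlockCode.messages d φ₁ φ₂ w₁ w₂ b)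
          (BlockCode.messages d φ₁ φ₂ w₁ w₂ (b + 1))) =
      ∑ k : I, (1 - c.correctProb (statePow PS m) (channelPow W m) (ν k).1 (ν k).2) := by
    simp only [I, Fintype.sum_prod_type]
    rfl
  rw [hsum, Finset.sum_sub_distrib, Finset.sum_const, Finset.card_univ, nsmul_eq_mul, hcard]
  linarith

end ErrorProbability

/-! ### Memoryless extension of a scheme -/

theorem sum_prod_le_one {ι α : Type*} [Fintype ι] [DecidableEq ι] [Fintype α] {f : ι → α → ℝ}
    (h0 : ∀ i a, 0 ≤ f i a) (h1 : ∀ i, ∑ a, f i a ≤ 1) : ∑ c : ι → α, ∏ i, f i (c i) ≤ 1 := by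
  rw [← Fintype.prod_sum]
  exact Finset.prod_le_one (fun i _ => Finset.sum_nonneg fun a _ => h0 i a) fun i _ => h1 i

theorem prod_mem_stdSimplex {ι α : Type*} [Fintype ι] [DecidableEq ι] [Fintype α] {q : ι → α → ℝ}
    (hq : ∀ i, q i ∈ stdSimplex ℝ α) :
    (fun c : ι → α => ∏ i, q i (c i)) ∈ stdSimplex ℝ (ι → α) :=
  ⟨fun _ => Finset.prod_nonneg fun i _ => (hq i).1 _, sum_prod_eq_one fun i => (hq i).2⟩

namespace Scheme

variable {S₁ S₂ X₁ X₂ Y U V₁ V₂ : Type*} [Fintype X₁] [Fintype X₂] [Fintype U] [Fintype V₁]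
  [Fintype V₂]

/-- The `m`-fold memoryless extension of a scheme. -/
def pow (σ : Scheme S₁ S₂ X₁ X₂ Y U V₁ V₂) (m : ℕ) :
    Scheme (Fin m → S₁) (Fin m → S₂) (Fin m → X₁) (Fin m → X₂) (Fin m → Y) (Fin m → U)
      (Fin m → V₁) (Fin m → V₂) where
  PU u := ∏ i, σ.PU (u i)
  q₁ u v := ∏ i, σ.q₁ (u i) (v i)
  q₂ u v := ∏ i, σ.q₂ (u i) (v i)
  r₁ u s v := ∏ i, σ.r₁ (u i) (s i) (v i)
  r₂ u s v := ∏ i, σ.r₂ (u i) (s i) (v i)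
  k₁ u s v x := ∏ i, σ.k₁ (u i) (s i) (v i) (x i)
  k₂ u s v x := ∏ i, σ.k₂ (u i) (s i) (v i) (x i)
  t₁ u v x s := ∏ i, σ.t₁ (u i) (v i) (x i) (s i)
  t₂ u v x s := ∏ i, σ.t₂ (u i) (v i) (x i) (s i)
  t u v₁ v₂ y := ∏ i, σ.t (u i) (v₁ i) (v₂ i) (y i)
  PU_mem := prod_mem_stdSimplex fun _ => σ.PU_mem
  q₁_mem u := prod_mem_stdSimplex fun i => σ.q₁_mem (u i)
  q₂_mem u := prod_mem_stdSimplex fun i => σ.q₂_mem (u i)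
  r₁_nonneg _ _ _ := Finset.prod_nonneg fun _ _ => σ.r₁_nonneg _ _ _
  r₂_nonneg _ _ _ := Finset.prod_nonneg fun _ _ => σ.r₂_nonneg _ _ _
  k₁_nonneg _ _ _ _ := Finset.prod_nonneg fun _ _ => σ.k₁_nonneg _ _ _ _
  k₂_nonneg _ _ _ _ := Finset.prod_nonneg fun _ _ => σ.k₂_nonneg _ _ _ _
  t₁_nonneg _ _ _ _ := Finset.prod_nonneg fun _ _ => σ.t₁_nonneg _ _ _ _
  t₂_nonneg _ _ _ _ := Finset.prod_nonneg fun _ _ => σ.t₂_nonneg _ _ _ _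
  t_nonneg _ _ _ _ := Finset.prod_nonneg fun _ _ => σ.t_nonneg _ _ _ _
  sum_r₁_le u s := by
    simp_rw [← Finset.prod_mul_distrib]
    exact sum_prod_le_one (f := fun i v => σ.q₁ (u i) v * σ.r₁ (u i) (s i) v)
      (fun i v => mul_nonneg ((σ.q₁_mem _).1 _) (σ.r₁_nonneg _ _ _)) fun i => σ.sum_r₁_le _ _
  sum_r₂_le u s := by
    simp_rw [← Finset.prod_mul_distrib]
    exact sum_prod_le_one (f := fun i v => σ.q₂ (u i) v * σ.r₂ (u i) (s i) v)
      (fun i v => mul_nonneg ((σ.q₂_mem _).1 _) (σ.r₂_nonneg _ _ _)) fun i => σ.sum_r₂_le _ _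
  sum_k₁_le u s v := sum_prod_le_one (f := fun i x => σ.k₁ (u i) (s i) (v i) x)
    (fun _ _ => σ.k₁_nonneg _ _ _ _) fun _ => σ.sum_k₁_le _ _ _
  sum_k₂_le u s v := sum_prod_le_one (f := fun i x => σ.k₂ (u i) (s i) (v i) x)
    (fun _ _ => σ.k₂_nonneg _ _ _ _) fun _ => σ.sum_k₂_le _ _ _
  sum_t₁_le u x s := by
    simp_rw [← Finset.prod_mul_distrib]
    exact sum_prod_le_one (f := fun i v => σ.q₂ (u i) v * σ.t₁ (u i) v (x i) (s i))
      (fun i v => mul_nonneg ((σ.q₂_mem _).1 _) (σ.t₁_nonneg _ _ _ _)) fun i => σ.sum_t₁_le _ _ _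
  sum_t₂_le u x s := by
    simp_rw [← Finset.prod_mul_distrib]
    exact sum_prod_le_one (f := fun i v => σ.q₁ (u i) v * σ.t₂ (u i) v (x i) (s i))
      (fun i v => mul_nonneg ((σ.q₁_mem _).1 _) (σ.t₂_nonneg _ _ _ _)) fun i => σ.sum_t₂_le _ _ _
  sum_t_le y := by
    have h2 : ∀ (u : Fin m → U) (v₁ : Fin m → V₁), ∑ v₂ : Fin m → V₂, (∏ i, σ.PU (u i)) *
        (∏ i, σ.q₁ (u i) (v₁ i)) * (∏ i, σ.q₂ (u i) (v₂ i)) * (∏ i, σ.t (u i) (v₁ i) (v₂ i) (y i)) =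
        ∏ i, ∑ v₂, σ.PU (u i) * σ.q₁ (u i) (v₁ i) * σ.q₂ (u i) v₂ * σ.t (u i) (v₁ i) v₂ (y i) := by
      intro u v₁
      simp_rw [← Finset.prod_mul_distrib]
      rw [Fintype.prod_sum]
    have h1 : ∀ u : Fin m → U, ∑ v₁ : Fin m → V₁, ∏ i, ∑ v₂, σ.PU (u i) * σ.q₁ (u i) (v₁ i) *
          σ.q₂ (u i) v₂ * σ.t (u i) (v₁ i) v₂ (y i) =
        ∏ i, ∑ v₁, ∑ v₂, σ.PU (u i) * σ.q₁ (u i) v₁ * σ.q₂ (u i) v₂ * σ.t (u i) v₁ v₂ (y i) := by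
      intro u
      rw [Fintype.prod_sum]
    simp_rw [h2, h1]
    refine sum_prod_le_one (f := fun i u => ∑ v₁, ∑ v₂, σ.PU u * σ.q₁ u v₁ * σ.q₂ u v₂ *
      σ.t u v₁ v₂ (y i)) (fun i u => Finset.sum_nonneg fun v₁ _ => Finset.sum_nonneg fun v₂ _ => ?_)
      fun i => σ.sum_t_le (y i)
    exact mul_nonneg (mul_nonneg (mul_nonneg (σ.PU_mem.1 _) ((σ.q₁_mem _).1 _)) ((σ.q₂_mem _).1 _))
      (σ.t_nonneg _ _ _ _)

end Scheme

/-- A sequence of outcomes as an outcome with sequences as components. -/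
def outcomeSeqEquiv (m : ℕ) (S₁ S₂ U V₁ V₂ X₁ X₂ Y : Type*) :
    (Fin m → Outcome S₁ S₂ U V₁ V₂ X₁ X₂ Y) ≃ Outcome (Fin m → S₁) (Fin m → S₂) (Fin m → U)
      (Fin m → V₁) (Fin m → V₂) (Fin m → X₁) (Fin m → X₂) (Fin m → Y) where
  toFun ω := (fun i => (ω i).s₁, fun i => (ω i).s₂, fun i => (ω i).u, fun i => (ω i).v₁,
    fun i => (ω i).v₂, fun i => (ω i).x₁, fun i => (ω i).x₂, fun i => (ω i).y)
  invFun ω i := (ω.s₁ i, ω.s₂ i, ω.u i, ω.v₁ i, ω.v₂ i, ω.x₁ i, ω.x₂ i, ω.y i)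
  left_inv _ := rfl
  right_inv _ := rfl

section LawOfLargeNumbers

/-! ### The weak law of large numbers -/

variable {Ω : Type*} [Fintype Ω]

/-- The expectation of a random variable on a finite sample space. -/
def mean (p : Ω → ℝ) (f : Ω → ℝ) : ℝ := ∑ ω, p ω * f ω

/-- The variance of a random variable on a finite sample space. -/
def variance (p : Ω → ℝ) (f : Ω → ℝ) : ℝ := ∑ ω, p ω * (f ω - mean p f) ^ 2

theorem sum_prod_mul_sq {p : Ω → ℝ} (hp : p ∈ stdSimplex ℝ Ω) (f : Ω → ℝ) (m : ℕ) :
    ∑ ω : Fin m → Ω, (∏ i, p (ω i)) * (∑ i, f (ω i) - m * mean p f) ^ 2 = m * variance p f := by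
  set g : Ω → ℝ := fun ω => f ω - mean p f with hg
  have hg0 : ∑ ω, p ω * g ω = 0 := by
    simp only [hg, mul_sub, Finset.sum_sub_distrib, ← Finset.sum_mul, hp.2, one_mul]
    exact sub_self _
  have h1 : ∀ ω : Fin m → Ω, (∏ i, p (ω i)) * (∑ i, f (ω i) - m * mean p f) ^ 2 =
      ∑ i, ∑ j, (∏ k, p (ω k)) * (g (ω i) * g (ω j)) := by
    intro ω
    have : ∑ i, f (ω i) - m * mean p f = ∑ i, g (ω i) := by
      simp [hg, Finset.sum_sub_distrib]
    rw [this, sq, Finset.sum_mul_sum]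
    simp only [Finset.mul_sum]
  simp_rw [h1]
  rw [Finset.sum_comm]
  have h2 : ∀ i : Fin m, ∑ ω : Fin m → Ω, ∑ j, (∏ k, p (ω k)) * (g (ω i) * g (ω j)) =
      variance p f := by
    intro i
    rw [Finset.sum_comm, Finset.sum_eq_single i]
    · rw [sum_prod_mul_apply (fun _ => hp.2) i (fun a => g a * g a)]
      simp only [variance, hg, sq]
    · intro j _ hj
      rw [sum_prod_mul_apply_mul_apply (fun _ => hp.2) hj.symm g g, hg0, mul_zero]
    · simp
  simp [h2]

open Classical in
/-- Chebyshev's inequality for the sum of independent copies of `f`. -/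
theorem sum_prod_deviation_le {p : Ω → ℝ} (hp : p ∈ stdSimplex ℝ Ω) (f : Ω → ℝ) {m : ℕ}
    (hm : 0 < m) {ε : ℝ} (hε : 0 < ε) :
    ∑ ω : Fin m → Ω, (∏ i, p (ω i)) *
        (if m * ε ≤ |∑ i, f (ω i) - m * mean p f| then 1 else 0) ≤
      variance p f / ε ^ 2 / m := by
  have hm' : (0 : ℝ) < m := by exact_mod_cast hm
  rw [div_div, le_div_iff₀ (by positivity), Finset.sum_mul]
  have : variance p f * m = m * variance p f := mul_comm _ _
  refine le_of_mul_le_mul_right ?_ hm'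
  rw [this, ← sum_prod_mul_sq hp, Finset.sum_mul]
  refine Finset.sum_le_sum fun ω _ => ?_
  have h0 : 0 ≤ ∏ i, p (ω i) := Finset.prod_nonneg fun i _ => hp.1 _
  rw [mul_assoc, mul_assoc]
  refine mul_le_mul_of_nonneg_left ?_ h0
  split_ifs with h
  · rw [one_mul, ← sq_abs (∑ i, f (ω i) - m * mean p f)]
    calc ε ^ 2 * m * m = (m * ε) ^ 2 := by ring
      _ ≤ _ := pow_le_pow_left₀ (by positivity) h 2
  · rw [zero_mul]; positivity

end LawOfLargeNumbers

section TypicalProb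

variable {S₁ S₂ X₁ X₂ Y U V₁ V₂ : Type*} [Fintype X₁] [Fintype X₂] [Fintype U] [Fintype V₁]
  [Fintype V₂]

namespace Scheme

variable (σ : Scheme S₁ S₂ X₁ X₂ Y U V₁ V₂) {PS : S₁ × S₂ → ℝ} {W : X₁ → X₂ → S₁ → S₂ → Y → ℝ}

theorem jointLaw_pow (m : ℕ) (ω : Fin m → Outcome S₁ S₂ U V₁ V₂ X₁ X₂ Y) :
    (σ.pow m).jointLaw (statePow PS m) (channelPow W m) (outcomeSeqEquiv m _ _ _ _ _ _ _ _ ω) =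
      ∏ i, σ.jointLaw PS W (ω i) := by
  simp only [jointLaw, Finset.prod_mul_distrib]
  rfl

theorem prod_lt_of_sum_logb_lt {m : ℕ} {a : Fin m → ℝ} (ha : ∀ i, 0 < a i) {x : ℝ}
    (h : ∑ i, Real.logb 2 (a i) < x) : ∏ i, a i < (2 : ℝ) ^ x := by
  rw [← Real.logb_lt_iff_lt_rpow (by norm_num) (Finset.prod_pos fun i _ => ha i),
    Real.logb_prod _ _ (fun i _ => (ha i).ne')]
  exact h

theorem lt_prod_of_lt_sum_logb {m : ℕ} {a : Fin m → ℝ} (ha : ∀ i, 0 < a i) {x : ℝ}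
    (h : x < ∑ i, Real.logb 2 (a i)) : (2 : ℝ) ^ x < ∏ i, a i := by
  rw [← Real.lt_logb_iff_rpow_lt (by norm_num) (Finset.prod_pos fun i _ => ha i),
    Real.logb_prod _ _ (fun i _ => (ha i).ne')]
  exact h

theorem r₁_pos {ω : Outcome S₁ S₂ U V₁ V₂ X₁ X₂ Y} (h : 0 < σ.jointLaw PS W ω) :
    0 < σ.r₁ ω.u ω.s₁ ω.v₁ :=
  (σ.r₁_nonneg _ _ _).lt_of_ne fun h0 => h.ne' (by rw [jointLaw, ← h0]; ring)

theorem r₂_pos {ω : Outcome S₁ S₂ U V₁ V₂ X₁ X₂ Y} (h : 0 < σ.jointLaw PS W ω) :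
    0 < σ.r₂ ω.u ω.s₂ ω.v₂ :=
  (σ.r₂_nonneg _ _ _).lt_of_ne fun h0 => h.ne' (by rw [jointLaw, ← h0]; ring)

/-- The logarithms of the likelihood ratios and of the test statistics. -/
noncomputable def logRatio (σ : Scheme S₁ S₂ X₁ X₂ Y U V₁ V₂) (k : Fin 5)
    (ω : Outcome S₁ S₂ U V₁ V₂ X₁ X₂ Y) : ℝ :=
  ![Real.logb 2 (σ.r₁ ω.u ω.s₁ ω.v₁), Real.logb 2 (σ.r₂ ω.u ω.s₂ ω.v₂),
    Real.logb 2 (σ.t₁ ω.u ω.v₂ ω.x₂ ω.s₁), Real.logb 2 (σ.t₂ ω.u ω.v₁ ω.x₁ ω.s₂),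
    Real.logb 2 (σ.t ω.u ω.v₁ ω.v₂ ω.y)] k

variable [Fintype S₁] [Fintype S₂] [Fintype Y]

theorem typicalProb_pow_le_one (hp : σ.jointLaw PS W ∈ stdSimplex ℝ _) (m : ℕ)
    (D₁ D₂ T₁ T₂ T : ℝ) :
    (σ.pow m).typicalProb (statePow PS m) (channelPow W m) D₁ D₂ T₁ T₂ T ≤ 1 := by
  rw [typicalProb, ← (outcomeSeqEquiv m _ _ _ _ _ _ _ _).sum_comp, ← (prod_mem_stdSimplex
    (fun _ : Fin m => hp)).2]
  refine Finset.sum_le_sum fun ω _ => ?_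
  rw [jointLaw_pow]
  split_ifs
  · exact le_rfl
  · exact Finset.prod_nonneg fun i _ => hp.1 _

/-- Asymptotic equipartition: over `m` uses, likelihood ratios and test statistics are exponential
in `m`, with exponents close to the means of their logarithms. -/
theorem exists_le_typicalProb_pow (hp : σ.jointLaw PS W ∈ stdSimplex ℝ _)
    (hpos : ∀ ω, 0 < σ.jointLaw PS W ω → 0 < σ.t₁ ω.u ω.v₂ ω.x₂ ω.s₁ ∧
      0 < σ.t₂ ω.u ω.v₁ ω.x₁ ω.s₂ ∧ 0 < σ.t ω.u ω.v₁ ω.v₂ ω.y) {ε : ℝ} (hε : 0 < ε) :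
    ∃ C, ∀ m : ℕ, 0 < m → 1 - C / m ≤
      (σ.pow m).typicalProb (statePow PS m) (channelPow W m)
        (2 ^ (m * mean (σ.jointLaw PS W) (σ.logRatio 0) + m * ε))
        (2 ^ (m * mean (σ.jointLaw PS W) (σ.logRatio 1) + m * ε))
        (2 ^ (m * mean (σ.jointLaw PS W) (σ.logRatio 2) - m * ε))
        (2 ^ (m * mean (σ.jointLaw PS W) (σ.logRatio 3) - m * ε))
        (2 ^ (m * mean (σ.jointLaw PS W) (σ.logRatio 4) - m * ε)) := by
  classical
  set p := σ.jointLaw PS W with hpdef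
  refine ⟨∑ k, variance p (σ.logRatio k) / ε ^ 2, fun m hm => ?_⟩
  rw [Finset.sum_div]
  have hdev := Finset.sum_le_sum fun k (_ : k ∈ Finset.univ) =>
    sum_prod_deviation_le hp (σ.logRatio k) hm hε
  have h1 : ∑ ω : Fin m → Outcome S₁ S₂ U V₁ V₂ X₁ X₂ Y, ∏ i, p (ω i) = 1 :=
    (prod_mem_stdSimplex fun _ => hp).2
  refine le_trans (b := ∑ ω : Fin m → Outcome S₁ S₂ U V₁ V₂ X₁ X₂ Y, ∏ i, p (ω i) -
    ∑ k, ∑ ω : Fin m → Outcome S₁ S₂ U V₁ V₂ X₁ X₂ Y, (∏ i, p (ω i)) *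
        (if m * ε ≤ |∑ i, σ.logRatio k (ω i) - m * mean p (σ.logRatio k)| then 1 else 0))
    (by rw [h1]; linarith) ?_
  rw [Finset.sum_comm, ← Finset.sum_sub_distrib, typicalProb,
    ← (outcomeSeqEquiv m _ _ _ _ _ _ _ _).sum_comp]
  refine Finset.sum_le_sum fun ω _ => ?_
  rw [jointLaw_pow, ← hpdef, ← Finset.mul_sum]
  have h0 : 0 ≤ ∏ i, p (ω i) := Finset.prod_nonneg fun i _ => hp.1 _
  have hite : ∀ k, (0 : ℝ) ≤
      if m * ε ≤ |∑ i, σ.logRatio k (ω i) - m * mean p (σ.logRatio k)| then 1 else 0 :=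
    fun k => by split_ifs <;> norm_num
  rcases h0.eq_or_lt with hz | hz
  · rw [← hz]
    simp
  by_cases hdv : ∀ k, |∑ i, σ.logRatio k (ω i) - m * mean p (σ.logRatio k)| < m * ε
  · have hpi : ∀ i, 0 < p (ω i) := by
      intro i
      refine (hp.1 _).lt_of_ne fun hi => hz.ne' ?_
      exact Finset.prod_eq_zero (Finset.mem_univ i) hi.symm
    rw [if_pos]
    · have := mul_nonneg h0 (Finset.sum_nonneg fun k (_ : k ∈ Finset.univ) => hite k)
      linarith
    · refine ⟨⟨?_, ?_⟩, ?_, ?_, ?_⟩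
      · refine (prod_lt_of_sum_logb_lt (fun i => σ.r₁_pos (hpi i)) ?_).le
        have := (abs_lt.mp (hdv 0)).2
        simp only [logRatio] at this ⊢
        simp at this
        linarith
      · refine (prod_lt_of_sum_logb_lt (fun i => σ.r₂_pos (hpi i)) ?_).le
        have := (abs_lt.mp (hdv 1)).2
        simp only [logRatio] at this ⊢
        simp at this
        linarith
      · refine lt_prod_of_lt_sum_logb (fun i => (hpos _ (hpi i)).2.1) ?_
        have := (abs_lt.mp (hdv 3)).1
        simp only [logRatio] at this ⊢
        simp at this
        linarith
      · refine lt_prod_of_lt_sum_logb (fun i => (hpos _ (hpi i)).1) ?_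
        have := (abs_lt.mp (hdv 2)).1
        simp only [logRatio] at this ⊢
        simp at this
        linarith
      · refine lt_prod_of_lt_sum_logb (fun i => (hpos _ (hpi i)).2.2) ?_
        have := (abs_lt.mp (hdv 4)).1
        simp only [logRatio] at this ⊢
        simp at this
        linarith
  · push Not at hdv
    obtain ⟨k, hk⟩ := hdv
    have h2 : (1 : ℝ) ≤ ∑ k, if m * ε ≤ |∑ i, σ.logRatio k (ω i) - m * mean p (σ.logRatio k)|
        then 1 else 0 := by
      refine le_trans (le_of_eq ?_)
        (Finset.single_le_sum (fun k _ => hite k) (Finset.mem_univ k))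
      rw [if_pos hk]
    have h3 := mul_le_mul_of_nonneg_left h2 h0
    refine le_trans (b := 0) (by linarith) ?_
    split_ifs
    exacts [h0, le_rfl]

end Scheme

end TypicalProb

/-! ### Achievable rates of a scheme -/

section Rates

theorem natCeil_bounds {x : ℝ} (hx : 1 ≤ x) :
    x ≤ ⌈x⌉₊ ∧ (⌈x⌉₊ : ℝ) ≤ 2 * x ∧ (⌈x⌉₊ : ℝ) - 1 ≤ x := by
  have := Nat.ceil_lt_add_one (zero_le_one.trans hx)
  exact ⟨Nat.le_ceil x, by linarith, by linarith⟩

/-- The messages of `B` blocks of length `m` are enough for a code of length `n`, if the rate `ρ` of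
the blocks exceeds the rate `R` of the code by enough to make up for the additional block and for
the remainder. -/
theorem ceil_le_ceil_pow {R ρ : ℝ} {B m n : ℕ} (hR : 0 ≤ R)
    (h : R = 0 ∧ ρ = 0 ∨ R + 1 ≤ B * (ρ - R)) (hm : (B + 1) * R ≤ m)
    (hn : n ≤ (B + 1) * (m + 1)) :
    ⌈(2 : ℝ) ^ ((n : ℝ) * R)⌉₊ ≤ ⌈(2 : ℝ) ^ ((m : ℝ) * ρ)⌉₊ ^ B := by
  rcases h with ⟨rfl, rfl⟩ | h
  · simp
  · rw [Nat.ceil_le, Nat.cast_pow]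
    calc (2 : ℝ) ^ ((n : ℝ) * R) ≤ 2 ^ ((m : ℝ) * ρ * B) := by
          refine Real.rpow_le_rpow_of_exponent_le (by norm_num) ?_
          have h1 : (n : ℝ) ≤ (B + 1) * (m + 1) := by exact_mod_cast hn
          have h2 := mul_le_mul_of_nonneg_right h1 hR
          have h3 := mul_le_mul_of_nonneg_left h (Nat.cast_nonneg (α := ℝ) m)
          nlinarith
      _ = (2 ^ ((m : ℝ) * ρ)) ^ B := by
          rw [Real.rpow_mul (by norm_num), Real.rpow_natCast]
      _ ≤ _ := pow_le_pow_left₀ (by positivity) (Nat.le_ceil _) B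

theorem two_rpow_div_le {a b c : ℝ} (h : a ≤ b - c) :
    (2 : ℝ) ^ a / 2 ^ b ≤ 2 ^ (-c) := by
  rw [← Real.rpow_sub (by norm_num)]
  exact Real.rpow_le_rpow_of_exponent_le (by norm_num) (by linarith)

/-- A union bound term of a cribbing encoder vanishes exponentially, and it is 0 for rate 0. -/
theorem crib_term_le {ρ I J ε : ℝ} {m : ℕ} (hρ : 0 ≤ ρ) (hI : 0 ≤ I) (hε : 0 < ε)
    (h : ρ = 0 ∨ ρ + 4 * ε ≤ J - I) :
    ((⌈(2 : ℝ) ^ ((m : ℝ) * ρ)⌉₊ : ℝ) - 1) * ⌈(2 : ℝ) ^ (m * I + 2 * (m * ε))⌉₊ /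
      2 ^ (m * J - m * ε) ≤ 2 * 2 ^ (-(m * ε)) := by
  rcases h with rfl | h
  · simp only [mul_zero, Real.rpow_zero, Nat.ceil_one, Nat.cast_one, sub_self, zero_mul, zero_div]
    positivity
  · have hm : (0 : ℝ) ≤ m := Nat.cast_nonneg m
    have h1 := natCeil_bounds (Real.one_le_rpow (x := 2) (by norm_num) (mul_nonneg hm hρ))
    have h2 := natCeil_bounds (Real.one_le_rpow (x := 2) (z := m * I + 2 * (m * ε)) (by norm_num)
      (by positivity))
    calc _ ≤ (2 : ℝ) ^ (m * ρ) * (2 * 2 ^ (m * I + 2 * (m * ε))) / 2 ^ (m * J - m * ε) := by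
          refine div_le_div_of_nonneg_right ?_ (by positivity)
          exact mul_le_mul h1.2.2 h2.2.1 (by positivity) (by positivity)
      _ = 2 * ((2 : ℝ) ^ (m * ρ + (m * I + 2 * (m * ε))) / 2 ^ (m * J - m * ε)) := by
          rw [Real.rpow_add two_pos (m * ρ)]
          ring
      _ ≤ _ := by
          refine mul_le_mul_of_nonneg_left (two_rpow_div_le ?_) (by norm_num)
          have := mul_le_mul_of_nonneg_left h hm
          linarith

theorem dec_term_le {ρ₁ ρ₂ I₁ I₂ K ε : ℝ} {m : ℕ} (hρ₁ : 0 ≤ ρ₁) (hρ₂ : 0 ≤ ρ₂) (hI₁ : 0 ≤ I₁)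
    (hI₂ : 0 ≤ I₂) (hε : 0 < ε) (h : ρ₁ + ρ₂ + 6 * ε ≤ K - I₁ - I₂) :
    (⌈(2 : ℝ) ^ ((m : ℝ) * ρ₁)⌉₊ : ℝ) * ⌈(2 : ℝ) ^ ((m : ℝ) * ρ₂)⌉₊ *
      ⌈(2 : ℝ) ^ (m * I₁ + 2 * (m * ε))⌉₊ * ⌈(2 : ℝ) ^ (m * I₂ + 2 * (m * ε))⌉₊ /
      2 ^ (m * K - m * ε) ≤ 16 * 2 ^ (-(m * ε)) := by
  have hm : (0 : ℝ) ≤ m := Nat.cast_nonneg m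
  have h1 := natCeil_bounds (Real.one_le_rpow (x := 2) (by norm_num) (mul_nonneg hm hρ₁))
  have h2 := natCeil_bounds (Real.one_le_rpow (x := 2) (by norm_num) (mul_nonneg hm hρ₂))
  have h3 := natCeil_bounds (Real.one_le_rpow (x := 2) (z := m * I₁ + 2 * (m * ε)) (by norm_num)
    (by positivity))
  have h4 := natCeil_bounds (Real.one_le_rpow (x := 2) (z := m * I₂ + 2 * (m * ε)) (by norm_num)
    (by positivity))
  calc _ ≤ (2 * (2 : ℝ) ^ (m * ρ₁)) * (2 * 2 ^ (m * ρ₂)) *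
        (2 * 2 ^ (m * I₁ + 2 * (m * ε))) * (2 * 2 ^ (m * I₂ + 2 * (m * ε))) /
          2 ^ (m * K - m * ε) := by
        refine div_le_div_of_nonneg_right ?_ (by positivity)
        exact mul_le_mul (mul_le_mul (mul_le_mul h1.2.1 h2.2.1 (by positivity) (by positivity))
          h3.2.1 (by positivity) (by positivity)) h4.2.1 (by positivity) (by positivity)
    _ = 16 * ((2 : ℝ) ^ (m * ρ₁ + m * ρ₂ + (m * I₁ + 2 * (m * ε)) + (m * I₂ + 2 * (m * ε))) /
          2 ^ (m * K - m * ε)) := by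
        rw [Real.rpow_add two_pos _ (m * I₂ + 2 * (m * ε)),
          Real.rpow_add two_pos _ (m * I₁ + 2 * (m * ε)), Real.rpow_add two_pos (m * ρ₁)]
        ring
    _ ≤ _ := by
        refine mul_le_mul_of_nonneg_left (two_rpow_div_le ?_) (by norm_num)
        have := mul_le_mul_of_nonneg_left h hm
        linarith

theorem tendsto_two_rpow_neg {ε : ℝ} (hε : 0 < ε) :
    Tendsto (fun m : ℕ => (2 : ℝ) ^ (-(m * ε))) atTop (𝓝 0) := by
  have h1 : Tendsto (fun m : ℕ => (m : ℝ) * ε) atTop atTop :=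
    tendsto_natCast_atTop_atTop.atTop_mul_const hε
  exact (tendsto_rpow_atBot_of_base_gt_one 2 (by norm_num)).comp (tendsto_neg_atTop_atBot.comp h1)

end Rates

namespace Scheme

variable {S₁ S₂ X₁ X₂ Y U V₁ V₂ : Type*} [Fintype S₁] [Fintype S₂] [Fintype X₁] [Fintype X₂]
  [Fintype Y] [Fintype U] [Fintype V₁] [Fintype V₂]

variable (σ : Scheme S₁ S₂ X₁ X₂ Y U V₁ V₂) {PS : S₁ × S₂ → ℝ} {W : X₁ → X₂ → S₁ → S₂ → Y → ℝ}

/-- Block codes for long blocks. A cribbing encoder has nothing to find if the other one has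
rate 0, so that in this case there is no condition on the individual rate. -/
theorem eventually_exists_blockCode (hPS : PS ∈ stdSimplex ℝ (S₁ × S₂))
    (hW : ∀ x₁ x₂ s₁ s₂, W x₁ x₂ s₁ s₂ ∈ stdSimplex ℝ Y)
    (hp : σ.jointLaw PS W ∈ stdSimplex ℝ _)
    (hpos : ∀ ω, 0 < σ.jointLaw PS W ω → 0 < σ.t₁ ω.u ω.v₂ ω.x₂ ω.s₁ ∧
      0 < σ.t₂ ω.u ω.v₁ ω.x₁ ω.s₂ ∧ 0 < σ.t ω.u ω.v₁ ω.v₂ ω.y)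
    (hI₁ : 0 ≤ mean (σ.jointLaw PS W) (σ.logRatio 0))
    (hI₂ : 0 ≤ mean (σ.jointLaw PS W) (σ.logRatio 1)) [Nonempty X₁] [Nonempty X₂]
    {ρ₁ ρ₂ : ℝ} (hρ₁ : 0 ≤ ρ₁) (hρ₂ : 0 ≤ ρ₂)
    (h₁ : ρ₁ = 0 ∨ ρ₁ < mean (σ.jointLaw PS W) (σ.logRatio 3) -
      mean (σ.jointLaw PS W) (σ.logRatio 0))
    (h₂ : ρ₂ = 0 ∨ ρ₂ < mean (σ.jointLaw PS W) (σ.logRatio 2) -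
      mean (σ.jointLaw PS W) (σ.logRatio 1))
    (h : ρ₁ + ρ₂ < mean (σ.jointLaw PS W) (σ.logRatio 4) -
      mean (σ.jointLaw PS W) (σ.logRatio 0) - mean (σ.jointLaw PS W) (σ.logRatio 1)) :
    ∃ δ : ℕ → ℝ, Tendsto δ atTop (𝓝 0) ∧ ∀ᶠ m : ℕ in atTop,
      ∀ π : (Fin ⌈(2 : ℝ) ^ ((m : ℝ) * ρ₁)⌉₊ × Fin ⌈(2 : ℝ) ^ ((m : ℝ) * ρ₂)⌉₊) ×
          (Fin ⌈(2 : ℝ) ^ ((m : ℝ) * ρ₁)⌉₊ × Fin ⌈(2 : ℝ) ^ ((m : ℝ) * ρ₂)⌉₊) → ℝ,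
        (∀ i, 0 ≤ π i) →
        ∃ c : BlockCode (Fin m → S₁) (Fin m → S₂) (Fin m → X₁) (Fin m → X₂) (Fin m → Y)
            (Fin ⌈(2 : ℝ) ^ ((m : ℝ) * ρ₁)⌉₊) (Fin ⌈(2 : ℝ) ^ ((m : ℝ) * ρ₂)⌉₊),
          ∑ i, π i * (1 - δ m) ≤
            ∑ i, π i * c.correctProb (statePow PS m) (channelPow W m) i.1 i.2 := by
  set I₁ := mean (σ.jointLaw PS W) (σ.logRatio 0)
  set I₂ := mean (σ.jointLaw PS W) (σ.logRatio 1)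
  set J₁ := mean (σ.jointLaw PS W) (σ.logRatio 2)
  set J₂ := mean (σ.jointLaw PS W) (σ.logRatio 3)
  set K := mean (σ.jointLaw PS W) (σ.logRatio 4)
  obtain ⟨ε, hε, hε₁, hε₂, hε₃⟩ : ∃ ε > 0, (ρ₁ = 0 ∨ ρ₁ + 4 * ε ≤ J₂ - I₁) ∧
      (ρ₂ = 0 ∨ ρ₂ + 4 * ε ≤ J₁ - I₂) ∧ ρ₁ + ρ₂ + 6 * ε ≤ K - I₁ - I₂ := by
    have hgap : ∀ {ρ b : ℝ}, (ρ = 0 ∨ ρ < b) →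
        ∃ ε > 0, ∀ ε', ε' ≤ ε → (ρ = 0 ∨ ρ + 4 * ε' ≤ b) := by
      rintro ρ b (h0 | hlt)
      · exact ⟨1, one_pos, fun _ _ => .inl h0⟩
      · exact ⟨(b - ρ) / 4, by linarith, fun ε' hε' => .inr (by linarith)⟩
    obtain ⟨ε₁, hε₁, g₁⟩ := hgap h₁
    obtain ⟨ε₂, hε₂, g₂⟩ := hgap h₂
    refine ⟨min (min ε₁ ε₂) ((K - I₁ - I₂ - (ρ₁ + ρ₂)) / 6),
      lt_min (lt_min hε₁ hε₂) (by linarith), g₁ _ ((min_le_left _ _).trans (min_le_left _ _)),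
      g₂ _ ((min_le_left _ _).trans (min_le_right _ _)), ?_⟩
    have := min_le_right (min ε₁ ε₂) ((K - I₁ - I₂ - (ρ₁ + ρ₂)) / 6)
    linarith
  obtain ⟨C, hC⟩ := σ.exists_le_typicalProb_pow hp hpos hε
  refine ⟨fun m => C / m + 22 * 2 ^ (-(m * ε)), ?_, ?_⟩
  · have := (tendsto_const_div_atTop_nhds_zero_nat C).add
      ((tendsto_two_rpow_neg hε).const_mul 22)
    simpa using this
  have hsmall : ∀ᶠ m : ℕ in atTop, 20 * (2 : ℝ) ^ (-(m * ε)) < 1 := by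
    have := (tendsto_two_rpow_neg hε).const_mul 20
    rw [mul_zero] at this
    exact this.eventually_lt_const one_pos
  filter_upwards [hsmall, eventually_gt_atTop 0] with m hm20 hm π hπ
  have hm0 : (0 : ℝ) ≤ m := Nat.cast_nonneg m
  set M₁ := ⌈(2 : ℝ) ^ ((m : ℝ) * ρ₁)⌉₊ with hM₁
  set M₂ := ⌈(2 : ℝ) ^ ((m : ℝ) * ρ₂)⌉₊ with hM₂
  -- the number of codewords per message slightly exceeds the inverse of the likelihood ratio
  set L₁ := ⌈(2 : ℝ) ^ (m * I₁ + 2 * (m * ε))⌉₊ with hL₁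
  set L₂ := ⌈(2 : ℝ) ^ (m * I₂ + 2 * (m * ε))⌉₊ with hL₂
  have : Nonempty (Fin M₁) := ⟨⟨0, Nat.ceil_pos.mpr (by positivity)⟩⟩
  have : Nonempty (Fin M₂) := ⟨⟨0, Nat.ceil_pos.mpr (by positivity)⟩⟩
  have : Nonempty (Fin L₁) := ⟨⟨0, Nat.ceil_pos.mpr (by positivity)⟩⟩
  have : Nonempty (Fin L₂) := ⟨⟨0, Nat.ceil_pos.mpr (by positivity)⟩⟩
  have hη : wrongBound M₁ M₂ L₁ L₂ (2 ^ (m * J₁ - m * ε)) (2 ^ (m * J₂ - m * ε))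
      (2 ^ (m * K - m * ε)) ≤ 20 * 2 ^ (-(m * ε)) := by
    have e1 := crib_term_le (m := m) hρ₁ hI₁ hε hε₁
    have e2 := crib_term_le (m := m) hρ₂ hI₂ hε hε₂
    have e3 := dec_term_le (m := m) hρ₁ hρ₂ hI₁ hI₂ hε hε₃
    unfold wrongBound
    linarith
  have hd : ∀ I : ℝ, (2 : ℝ) ^ (m * I + m * ε) / ⌈(2 : ℝ) ^ (m * I + 2 * (m * ε))⌉₊ ≤
      2 ^ (-(m * ε)) := fun I =>
    le_trans (div_le_div_of_nonneg_left (by positivity) (by positivity) (Nat.le_ceil _))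
      (two_rpow_div_le (by linarith))
  have hd₁ := hd I₁
  have hd₂ := hd I₂
  rw [← hL₁] at hd₁
  rw [← hL₂] at hd₂
  have hG := hC m hm
  obtain ⟨c, hc⟩ := (σ.pow m).exists_blockCode (W₁ := Fin M₁) (W₂ := Fin M₂) (J₁ := Fin L₁)
    (J₂ := Fin L₂) (PS := statePow PS m) (W := channelPow W m) (D₁ := 2 ^ (m * I₁ + m * ε))
    (D₂ := 2 ^ (m * I₂ + m * ε)) (T₁ := 2 ^ (m * J₁ - m * ε)) (T₂ := 2 ^ (m * J₂ - m * ε))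
    (T := 2 ^ (m * K - m * ε))
    (statePow_nonneg hPS m) (fun x₁ x₂ s₁ s₂ y => (channelPow_mem hW m x₁ x₂ s₁ s₂).1 y)
    (by positivity) (by positivity) (by positivity) (by positivity) (by positivity)
    (σ.typicalProb_pow_le_one hp m _ _ _ _ _)
    (by simp only [Fintype.card_fin]; exact hη.trans hm20.le) hπ
  refine ⟨c, le_trans (Finset.sum_le_sum fun i _ => mul_le_mul_of_nonneg_left ?_ (hπ i)) hc⟩
  simp only [Fintype.card_fin]
  linarith

theorem mem_achievableRates (hPS : PS ∈ stdSimplex ℝ (S₁ × S₂))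
    (hW : ∀ x₁ x₂ s₁ s₂, W x₁ x₂ s₁ s₂ ∈ stdSimplex ℝ Y)
    (hp : σ.jointLaw PS W ∈ stdSimplex ℝ _)
    (hpos : ∀ ω, 0 < σ.jointLaw PS W ω → 0 < σ.t₁ ω.u ω.v₂ ω.x₂ ω.s₁ ∧
      0 < σ.t₂ ω.u ω.v₁ ω.x₁ ω.s₂ ∧ 0 < σ.t ω.u ω.v₁ ω.v₂ ω.y)
    (hI₁ : 0 ≤ mean (σ.jointLaw PS W) (σ.logRatio 0))
    (hI₂ : 0 ≤ mean (σ.jointLaw PS W) (σ.logRatio 1))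
    {R : ℝ × ℝ} (hR₁ : 0 ≤ R.1) (hR₂ : 0 ≤ R.2)
    (h₁ : R.1 = 0 ∨ R.1 < mean (σ.jointLaw PS W) (σ.logRatio 3) -
      mean (σ.jointLaw PS W) (σ.logRatio 0))
    (h₂ : R.2 = 0 ∨ R.2 < mean (σ.jointLaw PS W) (σ.logRatio 2) -
      mean (σ.jointLaw PS W) (σ.logRatio 1))
    (h : R.1 + R.2 < mean (σ.jointLaw PS W) (σ.logRatio 4) -
      mean (σ.jointLaw PS W) (σ.logRatio 0) - mean (σ.jointLaw PS W) (σ.logRatio 1)) :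
    R ∈ achievableRates PS W := by
  classical
  obtain ⟨R₁, R₂⟩ := R
  simp only at hR₁ hR₂ h₁ h₂ h
  obtain ⟨ω₀⟩ : Nonempty (Outcome S₁ S₂ U V₁ V₂ X₁ X₂ Y) := by
    by_contra hne
    rw [not_nonempty_iff] at hne
    have := hp.2
    rw [Fintype.sum_empty] at this
    exact zero_ne_one this
  have : Nonempty S₁ := ⟨ω₀.s₁⟩
  have : Nonempty S₂ := ⟨ω₀.s₂⟩
  have : Nonempty X₁ := ⟨ω₀.x₁⟩
  have : Nonempty X₂ := ⟨ω₀.x₂⟩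
  have : Nonempty Y := ⟨ω₀.y⟩
  set I₁ := mean (σ.jointLaw PS W) (σ.logRatio 0)
  set I₂ := mean (σ.jointLaw PS W) (σ.logRatio 1)
  set J₁ := mean (σ.jointLaw PS W) (σ.logRatio 2)
  set J₂ := mean (σ.jointLaw PS W) (σ.logRatio 3)
  set K := mean (σ.jointLaw PS W) (σ.logRatio 4)
  -- rates `ρ₁`, `ρ₂` of the blocks slightly above `R₁`, `R₂`
  obtain ⟨γ, hγ, hγ₁, hγ₂, hγ₃⟩ : ∃ γ > 0, (R₁ = 0 ∨ R₁ + γ < J₂ - I₁) ∧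
      (R₂ = 0 ∨ R₂ + γ < J₁ - I₂) ∧ R₁ + R₂ + 2 * γ < K - I₁ - I₂ := by
    have hgap : ∀ {ρ b : ℝ}, (ρ = 0 ∨ ρ < b) →
        ∃ ε > 0, ∀ ε', ε' ≤ ε → (ρ = 0 ∨ ρ + ε' < b) := by
      rintro ρ b (h0 | hlt)
      · exact ⟨1, one_pos, fun _ _ => .inl h0⟩
      · exact ⟨(b - ρ) / 2, by linarith, fun ε' hε' => .inr (by linarith)⟩
    obtain ⟨ε₁, hε₁, g₁⟩ := hgap h₁
    obtain ⟨ε₂, hε₂, g₂⟩ := hgap h₂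
    refine ⟨min (min ε₁ ε₂) ((K - I₁ - I₂ - (R₁ + R₂)) / 4),
      lt_min (lt_min hε₁ hε₂) (by linarith), g₁ _ ((min_le_left _ _).trans (min_le_left _ _)),
      g₂ _ ((min_le_left _ _).trans (min_le_right _ _)), ?_⟩
    have := min_le_right (min ε₁ ε₂) ((K - I₁ - I₂ - (R₁ + R₂)) / 4)
    linarith
  have hρ : ∀ {R b : ℝ}, 0 ≤ R → (R = 0 ∨ R + γ < b) → ∃ ρ, 0 ≤ ρ ∧ ρ ≤ R + γ ∧
      (ρ = 0 ∨ ρ < b) ∧ (R = 0 ∧ ρ = 0 ∨ ρ - R = γ) := by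
    rintro R b hR (h0 | hlt)
    · exact ⟨0, le_rfl, by linarith, .inl rfl, .inl ⟨h0, rfl⟩⟩
    · exact ⟨R + γ, by linarith, le_rfl, .inr hlt, .inr (by ring)⟩
  obtain ⟨ρ₁, hρ₁, hρ₁', hb₁, hg₁⟩ := hρ hR₁ hγ₁
  obtain ⟨ρ₂, hρ₂, hρ₂', hb₂, hg₂⟩ := hρ hR₂ hγ₂
  obtain ⟨δ, hδ, hcode⟩ := σ.eventually_exists_blockCode hPS hW hp hpos hI₁ hI₂ hρ₁ hρ₂ hb₁ hb₂
    (by linarith)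
  obtain ⟨B, hB⟩ := exists_nat_ge ((R₁ + R₂ + 1) / γ)
  rw [div_le_iff₀ hγ] at hB
  have hB₁ : R₁ = 0 ∧ ρ₁ = 0 ∨ R₁ + 1 ≤ B * (ρ₁ - R₁) :=
    hg₁.imp_right fun e => by rw [e]; linarith
  have hB₂ : R₂ = 0 ∧ ρ₂ = 0 ∨ R₂ + 1 ≤ B * (ρ₂ - R₂) :=
    hg₂.imp_right fun e => by rw [e]; linarith
  have hdiv : Tendsto (fun n : ℕ => n / (B + 1)) atTop atTop :=
    Nat.tendsto_div_const_atTop (Nat.succ_ne_zero B)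
  have hlarge : ∀ᶠ m : ℕ in atTop, (B + 1) * R₁ ≤ m ∧ (B + 1) * R₂ ≤ m ∧ 0 < m :=
    (tendsto_natCast_atTop_atTop.eventually_ge_atTop _).and
      ((tendsto_natCast_atTop_atTop.eventually_ge_atTop _).and (eventually_gt_atTop 0))
  have hex : ∀ᶠ n : ℕ in atTop, ∃ c : Code S₁ S₂ X₁ X₂ Y n ⌈(2 : ℝ) ^ ((n : ℝ) * R₁)⌉₊
      ⌈(2 : ℝ) ^ ((n : ℝ) * R₂)⌉₊, c.errorProb PS W ≤ (B + 1) * δ (n / (B + 1)) := by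
    filter_upwards [hdiv.eventually (hcode.and hlarge)] with n hn
    obtain ⟨hn, hn₁, hn₂, hm⟩ := hn
    set m := n / (B + 1)
    have hnm : (B + 1) * m + n % (B + 1) = n := Nat.div_add_mod n (B + 1)
    have hle : n ≤ (B + 1) * (m + 1) := by
      have := Nat.mod_lt n (Nat.succ_pos B)
      linarith [mul_add (B + 1) m 1]
    have hN₁ := ceil_le_ceil_pow (n := n) hR₁ hB₁ hn₁ hle
    have hN₂ := ceil_le_ceil_pow (n := n) hR₂ hB₂ hn₂ hle
    have : NeZero ⌈(2 : ℝ) ^ ((n : ℝ) * R₁)⌉₊ := ⟨(Nat.ceil_pos.mpr (by positivity)).ne'⟩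
    have : NeZero ⌈(2 : ℝ) ^ ((n : ℝ) * R₂)⌉₊ := ⟨(Nat.ceil_pos.mpr (by positivity)).ne'⟩
    have : Nonempty (Fin ⌈(2 : ℝ) ^ ((m : ℝ) * ρ₁)⌉₊) := ⟨⟨0, Nat.ceil_pos.mpr (by positivity)⟩⟩
    have : Nonempty (Fin ⌈(2 : ℝ) ^ ((m : ℝ) * ρ₂)⌉₊) := ⟨⟨0, Nat.ceil_pos.mpr (by positivity)⟩⟩
    have := exists_code_errorProb_le (r := n % (B + 1)) hPS hW hm (B := B)
      (N₁ := ⌈(2 : ℝ) ^ ((n : ℝ) * R₁)⌉₊) (N₂ := ⌈(2 : ℝ) ^ ((n : ℝ) * R₂)⌉₊)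
      (by simpa only [Fintype.card_fin] using hN₁) (by simpa only [Fintype.card_fin] using hN₂) hn
    rwa [hnm] at this
  have hchoice : ∀ n : ℕ, ∃ c : Code S₁ S₂ X₁ X₂ Y n ⌈(2 : ℝ) ^ ((n : ℝ) * R₁)⌉₊
      ⌈(2 : ℝ) ^ ((n : ℝ) * R₂)⌉₊, (∃ c : Code S₁ S₂ X₁ X₂ Y n ⌈(2 : ℝ) ^ ((n : ℝ) * R₁)⌉₊
      ⌈(2 : ℝ) ^ ((n : ℝ) * R₂)⌉₊, c.errorProb PS W ≤ (B + 1) * δ (n / (B + 1))) →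
        c.errorProb PS W ≤ (B + 1) * δ (n / (B + 1)) := by
    intro n
    by_cases hc : ∃ c : Code S₁ S₂ X₁ X₂ Y n ⌈(2 : ℝ) ^ ((n : ℝ) * R₁)⌉₊
      ⌈(2 : ℝ) ^ ((n : ℝ) * R₂)⌉₊, c.errorProb PS W ≤ (B + 1) * δ (n / (B + 1))
    · exact ⟨hc.choose, fun _ => hc.choose_spec⟩
    · exact ⟨⟨fun _ _ _ _ => ω₀.x₁, fun _ _ _ _ => ω₀.x₂,
        fun _ => (⟨0, Nat.ceil_pos.mpr (by positivity)⟩, ⟨0, Nat.ceil_pos.mpr (by positivity)⟩)⟩,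
        fun h => absurd h hc⟩
  choose c hc using hchoice
  refine ⟨hR₁, hR₂, c, ?_⟩
  refine tendsto_of_tendsto_of_tendsto_of_le_of_le' tendsto_const_nhds
    (h := fun n => (B + 1) * δ (n / (B + 1))) ?_ ?_ (hex.mono fun n hn => hc n hn)
  · have := (hδ.comp hdiv).const_mul ((B : ℝ) + 1)
    simpa using this
  · refine Eventually.of_forall fun n => ?_
    unfold Code.errorProb
    refine mul_nonneg (by positivity) (Finset.sum_nonneg fun w₁ _ => Finset.sum_nonneg fun w₂ _ =>
      Finset.sum_nonneg fun s₁ _ => Finset.sum_nonneg fun s₂ _ => Finset.sum_nonneg fun y _ => ?_)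
    split_ifs
    · exact mul_nonneg (Finset.prod_nonneg fun i _ => hPS.1 _)
        (Finset.prod_nonneg fun i _ => (hW _ _ _ _).1 _)
    · exact le_rfl

end Scheme

/-! ### Laws of random variables -/

section Law

variable {Ω α β γ : Type*} [Fintype Ω]

theorem law_nonneg {p : Ω → ℝ} (hp : ∀ ω, 0 ≤ p ω) (A : Ω → α) (a : α) : 0 ≤ law p A a :=
  Finset.sum_nonneg fun ω _ => by split_ifs; exacts [hp ω, le_rfl]

theorem law_pos {p : Ω → ℝ} (hp : ∀ ω, 0 ≤ p ω) (A : Ω → α) {ω : Ω} (hω : 0 < p ω) :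
    0 < law p A (A ω) := by
  classical
  refine hω.trans_le (le_trans (le_of_eq ?_) (Finset.single_le_sum (fun ω' _ => ?_)
    (Finset.mem_univ ω)))
  · rw [if_pos rfl]
  · split_ifs
    exacts [hp ω', le_rfl]

/-- The law of a random variable, after renaming its values. -/
theorem law_comp_injective {p : Ω → ℝ} {e : α → β} (he : Function.Injective e) (A : Ω → α) (a : α) :
    law p (fun ω => e (A ω)) (e a) = law p A a := by
  unfold law
  refine Finset.sum_congr rfl fun ω _ => ?_
  by_cases h : A ω = a
  · rw [if_pos h, if_pos (congrArg e h)]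
  · rw [if_neg h, if_neg fun h' => h (he h')]

theorem sum_law_mul [Fintype α] (p : Ω → ℝ) (A : Ω → α) (f : α → ℝ) :
    ∑ a, law p A a * f a = ∑ ω, p ω * f (A ω) := by
  classical
  simp only [law, Finset.sum_mul]
  rw [Finset.sum_comm]
  refine Finset.sum_congr rfl fun ω _ => ?_
  rw [Finset.sum_eq_single (A ω)]
  · rw [if_pos rfl]
  · intro a _ ha
    rw [if_neg ha.symm, zero_mul]
  · simp

/-- The law of a component of a random variable is a marginal. -/
theorem sum_law_eq [Fintype α] (p : Ω → ℝ) (A : Ω → α) (B : Ω → β) (g : α → γ → β)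
    {C : Ω → γ} (hg : ∀ ω a c, B ω = g a c ↔ A ω = a ∧ C ω = c) (c : γ) :
    ∑ a, law p B (g a c) = law p C c := by
  classical
  simp only [law, hg]
  rw [Finset.sum_comm]
  refine Finset.sum_congr rfl fun ω _ => ?_
  rw [Finset.sum_eq_single (A ω)]
  · simp
  · intro a _ ha
    rw [if_neg fun h => ha h.1.symm]
  · simp

theorem mutualInfo_eq_sum [Fintype α] [Fintype β] (p : Ω → ℝ) (A : Ω → α) (B : Ω → β) :
    mutualInfo p A B = ∑ ω, p ω * Real.logb 2 (law p (fun ω => (A ω, B ω)) (A ω, B ω) /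
      (law p A (A ω) * law p B (B ω))) := by
  have := sum_law_mul p (fun ω => (A ω, B ω)) (fun ab =>
    Real.logb 2 (law p (fun ω => (A ω, B ω)) ab / (law p A ab.1 * law p B ab.2)))
  rw [Fintype.sum_prod_type] at this
  exact this

theorem condMutualInfo_eq_sum [Fintype α] [Fintype β] [Fintype γ] (p : Ω → ℝ) (A : Ω → α)
    (B : Ω → β) (C : Ω → γ) :
    condMutualInfo p A B C = ∑ ω, p ω * Real.logb 2
      (law p (fun ω => (A ω, B ω, C ω)) (A ω, B ω, C ω) * law p C (C ω) /
        (law p (fun ω => (A ω, C ω)) (A ω, C ω) * law p (fun ω => (B ω, C ω)) (B ω, C ω))) := by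
  have := sum_law_mul p (fun ω => (A ω, B ω, C ω)) (fun abc =>
    Real.logb 2 (law p (fun ω => (A ω, B ω, C ω)) abc * law p C abc.2.2 /
      (law p (fun ω => (A ω, C ω)) (abc.1, abc.2.2) *
        law p (fun ω => (B ω, C ω)) (abc.2.1, abc.2.2))))
  simp only [Fintype.sum_prod_type] at this
  exact this

end Law

/-! ### The factors of a joint law -/

section TestChannel

variable {S₁ S₂ U V₁ V₂ X₁ X₂ Y : Type*} [Fintype S₁] [Fintype S₂] [Fintype U] [Fintype V₁]
  [Fintype V₂] [Fintype X₁] [Fintype X₂] [Fintype Y]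

/-- A test channel: the factors of a joint law in `jointLaws`. -/
structure TestChannel (S₁ S₂ U V₁ V₂ X₁ X₂ Y : Type*) [Fintype S₁] [Fintype S₂] [Fintype U]
    [Fintype V₁] [Fintype V₂] [Fintype X₁] [Fintype X₂] [Fintype Y] where
  PS : S₁ × S₂ → ℝ
  PU : U → ℝ
  Q₁ : U → S₁ → X₁ × V₁ → ℝ
  Q₂ : U → S₂ → X₂ × V₂ → ℝ
  W : X₁ → X₂ → S₁ → S₂ → Y → ℝ
  PS_mem : PS ∈ stdSimplex ℝ (S₁ × S₂)
  PU_mem : PU ∈ stdSimplex ℝ U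
  Q₁_mem : ∀ u s₁, Q₁ u s₁ ∈ stdSimplex ℝ (X₁ × V₁)
  Q₂_mem : ∀ u s₂, Q₂ u s₂ ∈ stdSimplex ℝ (X₂ × V₂)
  W_mem : ∀ x₁ x₂ s₁ s₂, W x₁ x₂ s₁ s₂ ∈ stdSimplex ℝ Y

namespace TestChannel

variable (τ : TestChannel S₁ S₂ U V₁ V₂ X₁ X₂ Y)

/-- The joint law of all variables. -/
def joint (ω : Outcome S₁ S₂ U V₁ V₂ X₁ X₂ Y) : ℝ :=
  τ.PS (ω.s₁, ω.s₂) * τ.PU ω.u * τ.Q₁ ω.u ω.s₁ (ω.x₁, ω.v₁) *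
      τ.Q₂ ω.u ω.s₂ (ω.x₂, ω.v₂) * τ.W ω.x₁ ω.x₂ ω.s₁ ω.s₂ ω.y

/-- The conditional law `P(v₁ | u, s₁)`. -/
def A₁ (u : U) (s : S₁) (v : V₁) : ℝ := ∑ x, τ.Q₁ u s (x, v)

/-- The conditional law `P(v₂ | u, s₂)`. -/
def A₂ (u : U) (s : S₂) (v : V₂) : ℝ := ∑ x, τ.Q₂ u s (x, v)

/-- The conditional law `P(v₁ | u)`. -/
def q₁ (u : U) (v : V₁) : ℝ := ∑ s : S₁ × S₂, τ.PS s * τ.A₁ u s.1 v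

/-- The conditional law `P(v₂ | u)`. -/
def q₂ (u : U) (v : V₂) : ℝ := ∑ s : S₁ × S₂, τ.PS s * τ.A₂ u s.2 v

theorem A₁_mem (u : U) (s : S₁) : τ.A₁ u s ∈ stdSimplex ℝ V₁ :=
  ⟨fun _ => Finset.sum_nonneg fun _ _ => (τ.Q₁_mem u s).1 _, by
    rw [← (τ.Q₁_mem u s).2, Fintype.sum_prod_type, Finset.sum_comm]; rfl⟩

theorem A₂_mem (u : U) (s : S₂) : τ.A₂ u s ∈ stdSimplex ℝ V₂ :=
  ⟨fun _ => Finset.sum_nonneg fun _ _ => (τ.Q₂_mem u s).1 _, by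
    rw [← (τ.Q₂_mem u s).2, Fintype.sum_prod_type, Finset.sum_comm]; rfl⟩

theorem q₁_mem (u : U) : τ.q₁ u ∈ stdSimplex ℝ V₁ := by
  refine ⟨fun v => Finset.sum_nonneg fun s _ => mul_nonneg (τ.PS_mem.1 s) ((τ.A₁_mem u s.1).1 v), ?_⟩
  simp only [q₁]
  rw [Finset.sum_comm]
  simp only [← Finset.mul_sum, (τ.A₁_mem u _).2, mul_one, τ.PS_mem.2]

theorem q₂_mem (u : U) : τ.q₂ u ∈ stdSimplex ℝ V₂ := by
  refine ⟨fun v => Finset.sum_nonneg fun s _ => mul_nonneg (τ.PS_mem.1 s) ((τ.A₂_mem u s.2).1 v), ?_⟩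
  simp only [q₂]
  rw [Finset.sum_comm]
  simp only [← Finset.mul_sum, (τ.A₂_mem u _).2, mul_one, τ.PS_mem.2]

theorem Q₁_le_A₁ (u : U) (s : S₁) (x : X₁) (v : V₁) : τ.Q₁ u s (x, v) ≤ τ.A₁ u s v :=
  Finset.single_le_sum (f := fun x => τ.Q₁ u s (x, v)) (fun _ _ => (τ.Q₁_mem u s).1 _)
    (Finset.mem_univ x)

theorem Q₂_le_A₂ (u : U) (s : S₂) (x : X₂) (v : V₂) : τ.Q₂ u s (x, v) ≤ τ.A₂ u s v :=
  Finset.single_le_sum (f := fun x => τ.Q₂ u s (x, v)) (fun _ _ => (τ.Q₂_mem u s).1 _)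
    (Finset.mem_univ x)

theorem PS_mul_A₁_le_q₁ (u : U) (s : S₁ × S₂) (v : V₁) : τ.PS s * τ.A₁ u s.1 v ≤ τ.q₁ u v :=
  Finset.single_le_sum (f := fun s : S₁ × S₂ => τ.PS s * τ.A₁ u s.1 v)
    (fun s _ => mul_nonneg (τ.PS_mem.1 s) ((τ.A₁_mem u s.1).1 v)) (Finset.mem_univ s)

theorem PS_mul_A₂_le_q₂ (u : U) (s : S₁ × S₂) (v : V₂) : τ.PS s * τ.A₂ u s.2 v ≤ τ.q₂ u v :=
  Finset.single_le_sum (f := fun s : S₁ × S₂ => τ.PS s * τ.A₂ u s.2 v)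
    (fun s _ => mul_nonneg (τ.PS_mem.1 s) ((τ.A₂_mem u s.2).1 v)) (Finset.mem_univ s)

theorem joint_nonneg (ω : Outcome S₁ S₂ U V₁ V₂ X₁ X₂ Y) : 0 ≤ τ.joint ω :=
  mul_nonneg (mul_nonneg (mul_nonneg (mul_nonneg (τ.PS_mem.1 _) (τ.PU_mem.1 _))
    ((τ.Q₁_mem _ _).1 _)) ((τ.Q₂_mem _ _).1 _)) ((τ.W_mem _ _ _ _).1 _)

/-- The joint law of states and auxiliary variables. -/
theorem sum_joint_mul (f : S₁ × S₂ × U × V₁ × V₂ → ℝ) :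
    ∑ ω, τ.joint ω * f (ω.s₁, ω.s₂, ω.u, ω.v₁, ω.v₂) =
      ∑ s₁, ∑ s₂, ∑ u, ∑ v₁, ∑ v₂,
        τ.PS (s₁, s₂) * τ.PU u * τ.A₁ u s₁ v₁ * τ.A₂ u s₂ v₂ * f (s₁, s₂, u, v₁, v₂) := by
  simp only [Fintype.sum_prod_type]
  refine Finset.sum_congr rfl fun s₁ _ => Finset.sum_congr rfl fun s₂ _ =>
    Finset.sum_congr rfl fun u _ => Finset.sum_congr rfl fun v₁ _ =>
    Finset.sum_congr rfl fun v₂ _ => ?_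
  have hy : ∀ x₁ x₂, ∑ y, τ.joint (s₁, s₂, u, v₁, v₂, x₁, x₂, y) * f (s₁, s₂, u, v₁, v₂) =
      τ.PS (s₁, s₂) * τ.PU u * τ.Q₁ u s₁ (x₁, v₁) * τ.Q₂ u s₂ (x₂, v₂) *
        f (s₁, s₂, u, v₁, v₂) := by
    intro x₁ x₂
    rw [← Finset.sum_mul]
    change (∑ y, τ.PS (s₁, s₂) * τ.PU u * τ.Q₁ u s₁ (x₁, v₁) * τ.Q₂ u s₂ (x₂, v₂) *
      τ.W x₁ x₂ s₁ s₂ y) * _ = _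
    rw [← Finset.mul_sum, (τ.W_mem _ _ _ _).2, mul_one]
  simp only [hy, A₁, A₂]
  simp only [← Finset.sum_mul, ← Finset.mul_sum]

theorem joint_mem : τ.joint ∈ stdSimplex ℝ (Outcome S₁ S₂ U V₁ V₂ X₁ X₂ Y) := by
  refine ⟨τ.joint_nonneg, ?_⟩
  have := τ.sum_joint_mul fun _ => 1
  simp only [mul_one] at this
  rw [this]
  simp only [← Finset.mul_sum, (τ.A₁_mem _ _).2, (τ.A₂_mem _ _).2, mul_one, τ.PU_mem.2]
  rw [← Fintype.sum_prod_type (f := τ.PS), τ.PS_mem.2]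

theorem law_v₁_s₁ (v : V₁) (s₁ : S₁) (u : U) (s₂ : S₂) :
    law τ.joint (fun ω => (ω.v₁, ω.s₁, (ω.u, ω.s₂))) (v, s₁, (u, s₂)) =
      τ.PS (s₁, s₂) * τ.PU u * τ.A₁ u s₁ v := by
  classical
  have := τ.sum_joint_mul fun z => if z.2.2.2.1 = v ∧ z.1 = s₁ ∧ z.2.2.1 = u ∧ z.2.1 = s₂
    then 1 else 0
  simp only [law, Prod.mk.injEq]
  simp only [mul_ite, mul_one, mul_zero] at this
  rw [this]
  simp [ite_and, ← Finset.mul_sum, (τ.A₂_mem _ _).2]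

theorem law_v₂_s₂ (v : V₂) (s₂ : S₂) (u : U) (s₁ : S₁) :
    law τ.joint (fun ω => (ω.v₂, ω.s₂, (ω.u, ω.s₁))) (v, s₂, (u, s₁)) =
      τ.PS (s₁, s₂) * τ.PU u * τ.A₂ u s₂ v := by
  classical
  have := τ.sum_joint_mul fun z => if z.2.2.2.2 = v ∧ z.2.1 = s₂ ∧ z.2.2.1 = u ∧ z.1 = s₁
    then 1 else 0
  simp only [law, Prod.mk.injEq]
  simp only [mul_ite, mul_one, mul_zero] at this
  rw [this]
  simp [ite_and, ← Finset.mul_sum, ← Finset.sum_mul, (τ.A₁_mem _ _).2]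

theorem law_s₁ (s₁ : S₁) (u : U) (s₂ : S₂) :
    law τ.joint (fun ω => (ω.s₁, (ω.u, ω.s₂))) (s₁, (u, s₂)) = τ.PS (s₁, s₂) * τ.PU u := by
  classical
  have := τ.sum_joint_mul fun z => if z.1 = s₁ ∧ z.2.2.1 = u ∧ z.2.1 = s₂ then 1 else 0
  simp only [law, Prod.mk.injEq]
  simp only [mul_ite, mul_one, mul_zero] at this
  rw [this]
  simp [ite_and, ← Finset.mul_sum, (τ.A₁_mem _ _).2, (τ.A₂_mem _ _).2]

theorem law_s₂ (s₂ : S₂) (u : U) (s₁ : S₁) :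
    law τ.joint (fun ω => (ω.s₂, (ω.u, ω.s₁))) (s₂, (u, s₁)) = τ.PS (s₁, s₂) * τ.PU u := by
  classical
  have := τ.sum_joint_mul fun z => if z.2.1 = s₂ ∧ z.2.2.1 = u ∧ z.1 = s₁ then 1 else 0
  simp only [law, Prod.mk.injEq]
  simp only [mul_ite, mul_one, mul_zero] at this
  rw [this]
  simp [ite_and, ← Finset.mul_sum, (τ.A₁_mem _ _).2, (τ.A₂_mem _ _).2]

theorem law_v_s (v₁ : V₁) (v₂ : V₂) (s₁ : S₁) (s₂ : S₂) (u : U) :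
    law τ.joint (fun ω => ((ω.v₁, ω.v₂), (ω.s₁, ω.s₂), ω.u)) ((v₁, v₂), (s₁, s₂), u) =
      τ.PS (s₁, s₂) * τ.PU u * τ.A₁ u s₁ v₁ * τ.A₂ u s₂ v₂ := by
  classical
  have := τ.sum_joint_mul fun z => if (z.2.2.2.1 = v₁ ∧ z.2.2.2.2 = v₂) ∧
    (z.1 = s₁ ∧ z.2.1 = s₂) ∧ z.2.2.1 = u then 1 else 0
  simp only [law, Prod.mk.injEq]
  simp only [mul_ite, mul_one, mul_zero] at this
  rw [this]
  simp [ite_and]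

theorem law_s (s₁ : S₁) (s₂ : S₂) (u : U) :
    law τ.joint (fun ω => ((ω.s₁, ω.s₂), ω.u)) ((s₁, s₂), u) = τ.PS (s₁, s₂) * τ.PU u := by
  classical
  have := τ.sum_joint_mul fun z => if (z.1 = s₁ ∧ z.2.1 = s₂) ∧ z.2.2.1 = u then 1 else 0
  simp only [law, Prod.mk.injEq]
  simp only [mul_ite, mul_one, mul_zero] at this
  rw [this]
  simp [ite_and, ← Finset.mul_sum, (τ.A₁_mem _ _).2, (τ.A₂_mem _ _).2]

theorem law_u (u : U) : law τ.joint (fun ω => ω.u) u = τ.PU u := by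
  classical
  have := τ.sum_joint_mul fun z => if z.2.2.1 = u then 1 else 0
  simp only [law]
  simp only [mul_ite, mul_one, mul_zero] at this
  rw [this]
  simp only [Finset.sum_ite_irrel, Finset.sum_const_zero]
  simp only [← Finset.mul_sum, (τ.A₁_mem _ _).2, (τ.A₂_mem _ _).2, mul_one, Finset.sum_ite_eq',
    Finset.mem_univ, if_true, ← Finset.sum_mul]
  rw [← Fintype.sum_prod_type (f := τ.PS), τ.PS_mem.2, one_mul]

end TestChannel

end TestChannel

/-! ### The scheme of a joint law -/

/-- A likelihood ratio whose reciprocal has mean at most one has nonnegative mean logarithm. -/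
theorem mean_logb_nonneg {Ω : Type*} [Fintype Ω] {p f : Ω → ℝ} (hp : p ∈ stdSimplex ℝ Ω)
    (hf : ∀ ω, 0 < p ω → 0 < f ω) (h : ∑ ω, p ω * (f ω)⁻¹ ≤ 1) :
    0 ≤ mean p (fun ω => Real.logb 2 (f ω)) := by
  have h2 : 0 < Real.log 2 := Real.log_pos one_lt_two
  have key : ∑ ω, p ω * Real.log (f ω) = Real.log 2 * mean p (fun ω => Real.logb 2 (f ω)) := by
    rw [mean, Finset.mul_sum]
    refine Finset.sum_congr rfl fun ω _ => ?_
    rw [Real.logb]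
    field_simp
  have hle : ∑ ω, (p ω - p ω * (f ω)⁻¹) ≤ ∑ ω, p ω * Real.log (f ω) := by
    refine Finset.sum_le_sum fun ω _ => ?_
    rcases (hp.1 ω).eq_or_lt with h0 | h0
    · simp [← h0]
    · have := Real.one_sub_inv_le_log_of_pos (hf ω h0)
      nlinarith
  rw [Finset.sum_sub_distrib, hp.2, key] at hle
  exact nonneg_of_mul_nonneg_right (by linarith) h2

theorem mul_div_self_le (a : ℝ) {b : ℝ} (hb : 0 ≤ b) : a * (b / a) ≤ b := by
  by_cases h : a = 0
  · rwa [h, zero_mul]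
  · rw [mul_div_cancel₀ b h]

theorem mul_div_mul_le (a : ℝ) {b c : ℝ} (hb : 0 ≤ b) (hc : 0 ≤ c) : a * (b / (a * c)) ≤ b / c := by
  rw [mul_comm a c, ← div_div]
  exact mul_div_self_le a (div_nonneg hb hc)

namespace TestChannel

variable {S₁ S₂ U V₁ V₂ X₁ X₂ Y : Type*} [Fintype S₁] [Fintype S₂] [Fintype U] [Fintype V₁]
  [Fintype V₂] [Fintype X₁] [Fintype X₂] [Fintype Y]

variable (τ : TestChannel S₁ S₂ U V₁ V₂ X₁ X₂ Y)

/-- The scheme of a test channel: codewords are drawn from `P(v₁ | u)` and `P(v₂ | u)`, an encoder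
compares them by the likelihood ratios `P(v₁ | u, s₁) / P(v₁ | u)`, and the tests are the
likelihood ratios of the true joint law against independently drawn codewords. -/
noncomputable def toScheme : Scheme S₁ S₂ X₁ X₂ Y U V₁ V₂ where
  PU := τ.PU
  q₁ := τ.q₁
  q₂ := τ.q₂
  r₁ u s v := τ.A₁ u s v / τ.q₁ u v
  r₂ u s v := τ.A₂ u s v / τ.q₂ u v
  k₁ u s v x := τ.Q₁ u s (x, v) / τ.A₁ u s v
  k₂ u s v x := τ.Q₂ u s (x, v) / τ.A₂ u s v
  t₁ u v x s := law τ.joint (fun ω => (ω.x₂, ω.v₂, (ω.u, ω.s₁))) (x, v, (u, s)) /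
    (τ.q₂ u v * law τ.joint (fun ω => (ω.x₂, (ω.u, ω.s₁))) (x, (u, s)))
  t₂ u v x s := law τ.joint (fun ω => (ω.x₁, ω.v₁, (ω.u, ω.s₂))) (x, v, (u, s)) /
    (τ.q₁ u v * law τ.joint (fun ω => (ω.x₁, (ω.u, ω.s₂))) (x, (u, s)))
  t u v₁ v₂ y := law τ.joint (fun ω => (ω.y, (ω.v₁, ω.v₂, ω.u))) (y, (v₁, v₂, u)) /
    (τ.PU u * τ.q₁ u v₁ * τ.q₂ u v₂ * law τ.joint (fun ω => ω.y) y)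
  PU_mem := τ.PU_mem
  q₁_mem := τ.q₁_mem
  q₂_mem := τ.q₂_mem
  r₁_nonneg u s v := div_nonneg ((τ.A₁_mem u s).1 v) ((τ.q₁_mem u).1 v)
  r₂_nonneg u s v := div_nonneg ((τ.A₂_mem u s).1 v) ((τ.q₂_mem u).1 v)
  k₁_nonneg u s v x := div_nonneg ((τ.Q₁_mem u s).1 _) ((τ.A₁_mem u s).1 v)
  k₂_nonneg u s v x := div_nonneg ((τ.Q₂_mem u s).1 _) ((τ.A₂_mem u s).1 v)
  t₁_nonneg u v x s := div_nonneg (law_nonneg τ.joint_nonneg _ _)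
    (mul_nonneg ((τ.q₂_mem u).1 v) (law_nonneg τ.joint_nonneg _ _))
  t₂_nonneg u v x s := div_nonneg (law_nonneg τ.joint_nonneg _ _)
    (mul_nonneg ((τ.q₁_mem u).1 v) (law_nonneg τ.joint_nonneg _ _))
  t_nonneg u v₁ v₂ y := div_nonneg (law_nonneg τ.joint_nonneg _ _)
    (mul_nonneg (mul_nonneg (mul_nonneg (τ.PU_mem.1 u) ((τ.q₁_mem u).1 v₁)) ((τ.q₂_mem u).1 v₂))
      (law_nonneg τ.joint_nonneg _ _))
  sum_r₁_le u s := by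
    rw [← (τ.A₁_mem u s).2]
    exact Finset.sum_le_sum fun v _ => mul_div_self_le _ ((τ.A₁_mem u s).1 v)
  sum_r₂_le u s := by
    rw [← (τ.A₂_mem u s).2]
    exact Finset.sum_le_sum fun v _ => mul_div_self_le _ ((τ.A₂_mem u s).1 v)
  sum_k₁_le u s v := by
    rw [← Finset.sum_div]
    exact div_self_le_one _
  sum_k₂_le u s v := by
    rw [← Finset.sum_div]
    exact div_self_le_one _
  sum_t₁_le u x s := by
    refine (Finset.sum_le_sum fun v _ => mul_div_mul_le _
      (law_nonneg τ.joint_nonneg _ _) (law_nonneg τ.joint_nonneg _ _)).trans ?_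
    rw [← Finset.sum_div, sum_law_eq τ.joint (fun ω => ω.v₂)
      (fun ω => (ω.x₂, ω.v₂, (ω.u, ω.s₁))) (fun v (c : X₂ × U × S₁) => (c.1, v, c.2))
      (C := fun ω => (ω.x₂, (ω.u, ω.s₁)))
      (fun ω v c => by simp only [Prod.ext_iff]; tauto) (x, (u, s))]
    exact div_self_le_one _
  sum_t₂_le u x s := by
    refine (Finset.sum_le_sum fun v _ => mul_div_mul_le _
      (law_nonneg τ.joint_nonneg _ _) (law_nonneg τ.joint_nonneg _ _)).trans ?_
    rw [← Finset.sum_div, sum_law_eq τ.joint (fun ω => ω.v₁)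
      (fun ω => (ω.x₁, ω.v₁, (ω.u, ω.s₂))) (fun v (c : X₁ × U × S₂) => (c.1, v, c.2))
      (C := fun ω => (ω.x₁, (ω.u, ω.s₂)))
      (fun ω v c => by simp only [Prod.ext_iff]; tauto) (x, (u, s))]
    exact div_self_le_one _
  sum_t_le y := by
    refine (Finset.sum_le_sum fun u _ => Finset.sum_le_sum fun v₁ _ => Finset.sum_le_sum fun v₂ _ =>
      mul_div_mul_le _ (law_nonneg τ.joint_nonneg _ _)
        (law_nonneg τ.joint_nonneg _ _)).trans ?_
    simp only [← Finset.sum_div]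
    have := sum_law_eq τ.joint (fun ω => (ω.u, ω.v₁, ω.v₂))
      (fun ω => (ω.y, (ω.v₁, ω.v₂, ω.u))) (fun z y => (y, z.2.1, z.2.2, z.1))
      (C := fun ω => ω.y) (fun ω v c => by simp only [Prod.ext_iff]; tauto) y
    simp only [Fintype.sum_prod_type] at this
    rw [this]
    exact div_self_le_one _

/-- Off the support of the auxiliary laws both sides vanish. -/
theorem jointLaw_toScheme (ω : Outcome S₁ S₂ U V₁ V₂ X₁ X₂ Y) :
    τ.toScheme.jointLaw τ.PS τ.W ω = τ.joint ω := by
  change τ.PS (ω.s₁, ω.s₂) * τ.PU ω.u *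
    (τ.q₁ ω.u ω.v₁ * (τ.A₁ ω.u ω.s₁ ω.v₁ / τ.q₁ ω.u ω.v₁) *
      (τ.Q₁ ω.u ω.s₁ (ω.x₁, ω.v₁) / τ.A₁ ω.u ω.s₁ ω.v₁)) *
    (τ.q₂ ω.u ω.v₂ * (τ.A₂ ω.u ω.s₂ ω.v₂ / τ.q₂ ω.u ω.v₂) *
      (τ.Q₂ ω.u ω.s₂ (ω.x₂, ω.v₂) / τ.A₂ ω.u ω.s₂ ω.v₂)) * τ.W ω.x₁ ω.x₂ ω.s₁ ω.s₂ ω.y =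
    τ.PS (ω.s₁, ω.s₂) * τ.PU ω.u * τ.Q₁ ω.u ω.s₁ (ω.x₁, ω.v₁) *
      τ.Q₂ ω.u ω.s₂ (ω.x₂, ω.v₂) * τ.W ω.x₁ ω.x₂ ω.s₁ ω.s₂ ω.y
  rcases (τ.PS_mem.1 (ω.s₁, ω.s₂)).eq_or_lt with hs | hs
  · rw [← hs]
    ring
  have h₁ : τ.q₁ ω.u ω.v₁ * (τ.A₁ ω.u ω.s₁ ω.v₁ / τ.q₁ ω.u ω.v₁) *
      (τ.Q₁ ω.u ω.s₁ (ω.x₁, ω.v₁) / τ.A₁ ω.u ω.s₁ ω.v₁) = τ.Q₁ ω.u ω.s₁ (ω.x₁, ω.v₁) := by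
    rcases ((τ.A₁_mem ω.u ω.s₁).1 ω.v₁).eq_or_lt with h | h
    · have := τ.Q₁_le_A₁ ω.u ω.s₁ ω.x₁ ω.v₁
      rw [← h] at this
      rw [← h, le_antisymm this ((τ.Q₁_mem ω.u ω.s₁).1 _)]
      simp
    · have := (mul_pos hs h).trans_le (τ.PS_mul_A₁_le_q₁ ω.u (ω.s₁, ω.s₂) ω.v₁)
      field_simp
  have h₂ : τ.q₂ ω.u ω.v₂ * (τ.A₂ ω.u ω.s₂ ω.v₂ / τ.q₂ ω.u ω.v₂) *
      (τ.Q₂ ω.u ω.s₂ (ω.x₂, ω.v₂) / τ.A₂ ω.u ω.s₂ ω.v₂) = τ.Q₂ ω.u ω.s₂ (ω.x₂, ω.v₂) := by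
    rcases ((τ.A₂_mem ω.u ω.s₂).1 ω.v₂).eq_or_lt with h | h
    · have := τ.Q₂_le_A₂ ω.u ω.s₂ ω.x₂ ω.v₂
      rw [← h] at this
      rw [← h, le_antisymm this ((τ.Q₂_mem ω.u ω.s₂).1 _)]
      simp
    · have := (mul_pos hs h).trans_le (τ.PS_mul_A₂_le_q₂ ω.u (ω.s₁, ω.s₂) ω.v₂)
      field_simp
  rw [h₁, h₂]

/-- Every factor of the joint law is positive on its support. -/
theorem factors_pos {ω : Outcome S₁ S₂ U V₁ V₂ X₁ X₂ Y} (hω : 0 < τ.joint ω) :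
    0 < τ.PS (ω.s₁, ω.s₂) ∧ 0 < τ.PU ω.u ∧ 0 < τ.A₁ ω.u ω.s₁ ω.v₁ ∧ 0 < τ.A₂ ω.u ω.s₂ ω.v₂ ∧
      0 < τ.q₁ ω.u ω.v₁ ∧ 0 < τ.q₂ ω.u ω.v₂ := by
  have hs : 0 < τ.PS (ω.s₁, ω.s₂) := (τ.PS_mem.1 _).lt_of_ne fun h => hω.ne' (by
    rw [joint, ← h]; ring)
  have hu : 0 < τ.PU ω.u := (τ.PU_mem.1 _).lt_of_ne fun h => hω.ne' (by rw [joint, ← h]; ring)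
  have h1 : 0 < τ.Q₁ ω.u ω.s₁ (ω.x₁, ω.v₁) := ((τ.Q₁_mem _ _).1 _).lt_of_ne fun h => hω.ne' (by
    rw [joint, ← h]; ring)
  have h2 : 0 < τ.Q₂ ω.u ω.s₂ (ω.x₂, ω.v₂) := ((τ.Q₂_mem _ _).1 _).lt_of_ne fun h => hω.ne' (by
    rw [joint, ← h]; ring)
  have hA₁ := h1.trans_le (τ.Q₁_le_A₁ _ _ _ _)
  have hA₂ := h2.trans_le (τ.Q₂_le_A₂ _ _ _ _)
  exact ⟨hs, hu, hA₁, hA₂, (mul_pos hs hA₁).trans_le (τ.PS_mul_A₁_le_q₁ _ (ω.s₁, ω.s₂) _),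
    (mul_pos hs hA₂).trans_le (τ.PS_mul_A₂_le_q₂ _ (ω.s₁, ω.s₂) _)⟩

theorem t₁_pos {ω : Outcome S₁ S₂ U V₁ V₂ X₁ X₂ Y} (hω : 0 < τ.joint ω) :
    0 < τ.toScheme.t₁ ω.u ω.v₂ ω.x₂ ω.s₁ :=
  div_pos (law_pos τ.joint_nonneg (fun ω => (ω.x₂, ω.v₂, (ω.u, ω.s₁))) hω)
    (mul_pos (τ.factors_pos hω).2.2.2.2.2
      (law_pos τ.joint_nonneg (fun ω => (ω.x₂, (ω.u, ω.s₁))) hω))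

theorem t₂_pos {ω : Outcome S₁ S₂ U V₁ V₂ X₁ X₂ Y} (hω : 0 < τ.joint ω) :
    0 < τ.toScheme.t₂ ω.u ω.v₁ ω.x₁ ω.s₂ :=
  div_pos (law_pos τ.joint_nonneg (fun ω => (ω.x₁, ω.v₁, (ω.u, ω.s₂))) hω)
    (mul_pos (τ.factors_pos hω).2.2.2.2.1
      (law_pos τ.joint_nonneg (fun ω => (ω.x₁, (ω.u, ω.s₂))) hω))

theorem t_pos {ω : Outcome S₁ S₂ U V₁ V₂ X₁ X₂ Y} (hω : 0 < τ.joint ω) :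
    0 < τ.toScheme.t ω.u ω.v₁ ω.v₂ ω.y := by
  obtain ⟨-, hu, -, -, h₁, h₂⟩ := τ.factors_pos hω
  exact div_pos (law_pos τ.joint_nonneg (fun ω => (ω.y, (ω.v₁, ω.v₂, ω.u))) hω)
    (mul_pos (mul_pos (mul_pos hu h₁) h₂) (law_pos τ.joint_nonneg (fun ω => ω.y) hω))

theorem r₁_pos {ω : Outcome S₁ S₂ U V₁ V₂ X₁ X₂ Y} (hω : 0 < τ.joint ω) :
    0 < τ.toScheme.r₁ ω.u ω.s₁ ω.v₁ :=
  div_pos (τ.factors_pos hω).2.2.1 (τ.factors_pos hω).2.2.2.2.1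

theorem r₂_pos {ω : Outcome S₁ S₂ U V₁ V₂ X₁ X₂ Y} (hω : 0 < τ.joint ω) :
    0 < τ.toScheme.r₂ ω.u ω.s₂ ω.v₂ :=
  div_pos (τ.factors_pos hω).2.2.2.1 (τ.factors_pos hω).2.2.2.2.2

theorem mean_logRatio_zero_nonneg : 0 ≤ mean τ.joint (τ.toScheme.logRatio 0) := by
  refine mean_logb_nonneg τ.joint_mem (fun ω hω => τ.r₁_pos hω) ?_
  have := τ.sum_joint_mul fun z => (τ.A₁ z.2.2.1 z.1 z.2.2.2.1 / τ.q₁ z.2.2.1 z.2.2.2.1)⁻¹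
  refine this.trans_le ?_
  calc _ ≤ ∑ s₁, ∑ s₂, ∑ u, ∑ v₁, ∑ v₂,
        τ.PS (s₁, s₂) * τ.PU u * τ.q₁ u v₁ * τ.A₂ u s₂ v₂ := by
        refine Finset.sum_le_sum fun s₁ _ => Finset.sum_le_sum fun s₂ _ =>
          Finset.sum_le_sum fun u _ => Finset.sum_le_sum fun v₁ _ =>
          Finset.sum_le_sum fun v₂ _ => ?_
        simp only [inv_div]
        rw [mul_right_comm _ (τ.A₂ u s₂ v₂), mul_assoc _ (τ.A₁ u s₁ v₁)]
        exact mul_le_mul_of_nonneg_right (mul_le_mul_of_nonneg_left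
          (mul_div_self_le _ ((τ.q₁_mem u).1 v₁))
          (mul_nonneg (τ.PS_mem.1 _) (τ.PU_mem.1 u))) ((τ.A₂_mem u s₂).1 v₂)
    _ = 1 := by
        simp only [← Finset.mul_sum, (τ.A₂_mem _ _).2, (τ.q₁_mem _).2, mul_one, τ.PU_mem.2]
        rw [← Fintype.sum_prod_type (f := τ.PS), τ.PS_mem.2]

theorem mean_logRatio_one_nonneg : 0 ≤ mean τ.joint (τ.toScheme.logRatio 1) := by
  refine mean_logb_nonneg τ.joint_mem (fun ω hω => τ.r₂_pos hω) ?_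
  have := τ.sum_joint_mul fun z => (τ.A₂ z.2.2.1 z.2.1 z.2.2.2.2 / τ.q₂ z.2.2.1 z.2.2.2.2)⁻¹
  refine this.trans_le ?_
  calc _ ≤ ∑ s₁, ∑ s₂, ∑ u, ∑ v₁, ∑ v₂,
        τ.PS (s₁, s₂) * τ.PU u * τ.A₁ u s₁ v₁ * τ.q₂ u v₂ := by
        refine Finset.sum_le_sum fun s₁ _ => Finset.sum_le_sum fun s₂ _ =>
          Finset.sum_le_sum fun u _ => Finset.sum_le_sum fun v₁ _ =>
          Finset.sum_le_sum fun v₂ _ => ?_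
        simp only [inv_div]
        rw [mul_assoc _ (τ.A₂ u s₂ v₂)]
        exact mul_le_mul_of_nonneg_left (mul_div_self_le _ ((τ.q₂_mem u).1 v₂))
          (mul_nonneg (mul_nonneg (τ.PS_mem.1 _) (τ.PU_mem.1 u)) ((τ.A₁_mem u s₁).1 v₁))
    _ = 1 := by
        simp only [← Finset.mul_sum, (τ.A₁_mem _ _).2, (τ.q₂_mem _).2, mul_one, τ.PU_mem.2]
        rw [← Fintype.sum_prod_type (f := τ.PS), τ.PS_mem.2]

theorem bound₁_joint : bound₁ τ.joint =
    mean τ.joint (τ.toScheme.logRatio 3) - mean τ.joint (τ.toScheme.logRatio 0) := by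
  rw [bound₁, condMutualInfo_eq_sum, condMutualInfo_eq_sum, mean, mean, ← Finset.sum_sub_distrib,
    ← Finset.sum_sub_distrib]
  refine Finset.sum_congr rfl fun ω _ => ?_
  rcases (τ.joint_nonneg ω).eq_or_lt with h0 | h0
  · rw [← h0]
    ring
  obtain ⟨hs, hu, hA, -, hq, -⟩ := τ.factors_pos h0
  rw [τ.law_v₁_s₁, τ.law_s₁]
  change _ = τ.joint ω * Real.logb 2 (law τ.joint (fun ω => (ω.x₁, ω.v₁, (ω.u, ω.s₂)))
      (ω.x₁, ω.v₁, (ω.u, ω.s₂)) / (τ.q₁ ω.u ω.v₁ *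
        law τ.joint (fun ω => (ω.x₁, (ω.u, ω.s₂))) (ω.x₁, (ω.u, ω.s₂)))) -
    τ.joint ω * Real.logb 2 (τ.A₁ ω.u ω.s₁ ω.v₁ / τ.q₁ ω.u ω.v₁)
  have h1 := law_pos τ.joint_nonneg (fun ω => (ω.x₁, ω.v₁, (ω.u, ω.s₂))) h0
  have h2 := law_pos τ.joint_nonneg (fun ω => (ω.x₁, (ω.u, ω.s₂))) h0
  have h3 := law_pos τ.joint_nonneg (fun ω => (ω.v₁, (ω.u, ω.s₂))) h0
  have h4 := law_pos τ.joint_nonneg (fun ω => (ω.u, ω.s₂)) h0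
  rw [← mul_sub, ← mul_sub, ← Real.logb_div (by positivity) (by positivity),
    ← Real.logb_div (by positivity) (by positivity)]
  congr 2
  field_simp

theorem bound₂_joint : bound₂ τ.joint =
    mean τ.joint (τ.toScheme.logRatio 2) - mean τ.joint (τ.toScheme.logRatio 1) := by
  rw [bound₂, condMutualInfo_eq_sum, condMutualInfo_eq_sum, mean, mean, ← Finset.sum_sub_distrib,
    ← Finset.sum_sub_distrib]
  refine Finset.sum_congr rfl fun ω _ => ?_
  rcases (τ.joint_nonneg ω).eq_or_lt with h0 | h0
  · rw [← h0]
    ring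
  obtain ⟨hs, hu, -, hA, -, hq⟩ := τ.factors_pos h0
  rw [τ.law_v₂_s₂, τ.law_s₂]
  change _ = τ.joint ω * Real.logb 2 (law τ.joint (fun ω => (ω.x₂, ω.v₂, (ω.u, ω.s₁)))
      (ω.x₂, ω.v₂, (ω.u, ω.s₁)) / (τ.q₂ ω.u ω.v₂ *
        law τ.joint (fun ω => (ω.x₂, (ω.u, ω.s₁))) (ω.x₂, (ω.u, ω.s₁)))) -
    τ.joint ω * Real.logb 2 (τ.A₂ ω.u ω.s₂ ω.v₂ / τ.q₂ ω.u ω.v₂)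
  have h1 := law_pos τ.joint_nonneg (fun ω => (ω.x₂, ω.v₂, (ω.u, ω.s₁))) h0
  have h2 := law_pos τ.joint_nonneg (fun ω => (ω.x₂, (ω.u, ω.s₁))) h0
  have h3 := law_pos τ.joint_nonneg (fun ω => (ω.v₂, (ω.u, ω.s₁))) h0
  have h4 := law_pos τ.joint_nonneg (fun ω => (ω.u, ω.s₁)) h0
  rw [← mul_sub, ← mul_sub, ← Real.logb_div (by positivity) (by positivity),
    ← Real.logb_div (by positivity) (by positivity)]
  congr 2
  field_simp

theorem boundSum_joint : boundSum τ.joint =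
    mean τ.joint (τ.toScheme.logRatio 4) - mean τ.joint (τ.toScheme.logRatio 0) -
      mean τ.joint (τ.toScheme.logRatio 1) := by
  rw [boundSum, mutualInfo_eq_sum, condMutualInfo_eq_sum, mean, mean, mean,
    ← Finset.sum_sub_distrib, ← Finset.sum_sub_distrib, ← Finset.sum_sub_distrib]
  refine Finset.sum_congr rfl fun ω _ => ?_
  rcases (τ.joint_nonneg ω).eq_or_lt with h0 | h0
  · rw [← h0]
    ring
  obtain ⟨hs, hu, hA₁, hA₂, hq₁, hq₂⟩ := τ.factors_pos h0
  have hassoc : law τ.joint (fun ω => ((ω.v₁, ω.v₂), ω.u)) ((ω.v₁, ω.v₂), ω.u) =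
      law τ.joint (fun ω => (ω.v₁, ω.v₂, ω.u)) (ω.v₁, ω.v₂, ω.u) :=
    (law_comp_injective (Equiv.prodAssoc V₁ V₂ U).injective
      (fun ω : Outcome S₁ S₂ U V₁ V₂ X₁ X₂ Y => ((ω.v₁, ω.v₂), ω.u)) ((ω.v₁, ω.v₂), ω.u)).symm
  rw [τ.law_v_s, τ.law_s, τ.law_u, hassoc]
  change _ = τ.joint ω * Real.logb 2 (law τ.joint (fun ω => (ω.y, (ω.v₁, ω.v₂, ω.u)))
      (ω.y, (ω.v₁, ω.v₂, ω.u)) / (τ.PU ω.u * τ.q₁ ω.u ω.v₁ * τ.q₂ ω.u ω.v₂ *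
        law τ.joint (fun ω => ω.y) ω.y)) -
    τ.joint ω * Real.logb 2 (τ.A₁ ω.u ω.s₁ ω.v₁ / τ.q₁ ω.u ω.v₁) -
    τ.joint ω * Real.logb 2 (τ.A₂ ω.u ω.s₂ ω.v₂ / τ.q₂ ω.u ω.v₂)
  have h1 := law_pos τ.joint_nonneg (fun ω => (ω.y, (ω.v₁, ω.v₂, ω.u))) h0
  have h2 := law_pos τ.joint_nonneg (fun ω => ω.y) h0
  have h3 := law_pos τ.joint_nonneg (fun ω => (ω.v₁, ω.v₂, ω.u)) h0
  rw [← mul_sub, ← mul_sub, ← mul_sub, ← Real.logb_div (by positivity) (by positivity),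
    ← Real.logb_div (by positivity) (by positivity),
    ← Real.logb_div (by positivity) (by positivity)]
  congr 2
  field_simp

/-- A rate of an encoder that is zero need not be strictly below its bound: there is then only one
message, which the other encoder knows already. -/
theorem mem_achievableRates {R : ℝ × ℝ} (hR₁ : 0 ≤ R.1) (hR₂ : 0 ≤ R.2)
    (h₁ : R.1 = 0 ∨ R.1 < bound₁ τ.joint) (h₂ : R.2 = 0 ∨ R.2 < bound₂ τ.joint)
    (h : R.1 + R.2 < boundSum τ.joint) : R ∈ achievableRates τ.PS τ.W := by
  have hj : τ.toScheme.jointLaw τ.PS τ.W = τ.joint := funext τ.jointLaw_toScheme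
  rw [τ.bound₁_joint, ← hj] at h₁
  rw [τ.bound₂_joint, ← hj] at h₂
  rw [τ.boundSum_joint, ← hj] at h
  refine τ.toScheme.mem_achievableRates τ.PS_mem τ.W_mem (hj ▸ τ.joint_mem) ?_ ?_ ?_ hR₁ hR₂ h₁ h₂ h
  · rw [hj]
    exact fun ω hω => ⟨τ.t₁_pos hω, τ.t₂_pos hω, τ.t_pos hω⟩
  · rw [hj]
    exact τ.mean_logRatio_zero_nonneg
  · rw [hj]
    exact τ.mean_logRatio_one_nonneg

end TestChannel

/-! ### The rate region -/

section

variable {S₁ S₂ X₁ X₂ Y : Type*} [Fintype S₁] [Fintype S₂] [Fintype Y] {PS : S₁ × S₂ → ℝ}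
  {W : X₁ → X₂ → S₁ → S₂ → Y → ℝ}

/-- Codes with a single message pair make no error. -/
theorem zero_mem_achievableRates (x₁ : X₁) (x₂ : X₂) : (0, 0) ∈ achievableRates PS W := by
  have h1 : ∀ n : ℕ, ⌈(2 : ℝ) ^ ((n : ℝ) * (0 : ℝ))⌉₊ = 1 := by simp
  refine ⟨le_rfl, le_rfl, fun n => ⟨fun _ _ _ _ => x₁, fun _ _ _ _ => x₂,
    fun _ => (⟨0, Nat.ceil_pos.mpr (by positivity)⟩, ⟨0, Nat.ceil_pos.mpr (by positivity)⟩)⟩, ?_⟩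
  refine tendsto_const_nhds.congr fun n => ?_
  have : Subsingleton (Fin ⌈(2 : ℝ) ^ ((n : ℝ) * (0 : ℝ))⌉₊) := by
    rw [h1]
    infer_instance
  unfold Code.errorProb
  rw [Finset.sum_eq_zero, mul_zero]
  refine fun w₁ _ => Finset.sum_eq_zero fun w₂ _ => Finset.sum_eq_zero fun s₁ _ =>
    Finset.sum_eq_zero fun s₂ _ => Finset.sum_eq_zero fun y _ => ?_
  rw [if_neg]
  exact not_not.mpr (Subsingleton.elim (α := Fin _ × Fin _) _ _)

end

section Region

variable {S₁ S₂ U V₁ V₂ X₁ X₂ Y : Type*} [Fintype S₁] [Fintype S₂] [Fintype U] [Fintype V₁]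
  [Fintype V₂] [Fintype X₁] [Fintype X₂] [Fintype Y] {PS : S₁ × S₂ → ℝ}
  {W : X₁ → X₂ → S₁ → S₂ → Y → ℝ}

theorem mem_achievableRates_of_lt (hPS : PS ∈ stdSimplex ℝ (S₁ × S₂))
    (hW : ∀ x₁ x₂ s₁ s₂, W x₁ x₂ s₁ s₂ ∈ stdSimplex ℝ Y)
    {p : Outcome S₁ S₂ U V₁ V₂ X₁ X₂ Y → ℝ} (hp : p ∈ jointLaws PS W) {R : ℝ × ℝ}
    (hR₁ : 0 ≤ R.1) (hR₂ : 0 ≤ R.2) (h₁ : R.1 = 0 ∨ R.1 < bound₁ p)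
    (h₂ : R.2 = 0 ∨ R.2 < bound₂ p) (h : R.1 + R.2 < boundSum p) : R ∈ achievableRates PS W := by
  obtain ⟨PU, Q₁, Q₂, hPU, hQ₁, hQ₂, hp⟩ := hp
  let τ : TestChannel S₁ S₂ U V₁ V₂ X₁ X₂ Y := ⟨PS, PU, Q₁, Q₂, W, hPS, hPU, hQ₁, hQ₂, hW⟩
  have hpτ : p = τ.joint := funext hp
  rw [hpτ] at h₁ h₂ h
  exact τ.mem_achievableRates hR₁ hR₂ h₁ h₂ h

/-- A pair that is not zero is the limit of the pairs `(1 - δ) R`, which satisfy the bounds with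
slack in every coordinate where `R` is not zero. -/
theorem mem_capacityRegion_of_le (hPS : PS ∈ stdSimplex ℝ (S₁ × S₂))
    (hW : ∀ x₁ x₂ s₁ s₂, W x₁ x₂ s₁ s₂ ∈ stdSimplex ℝ Y)
    {p : Outcome S₁ S₂ U V₁ V₂ X₁ X₂ Y → ℝ} (hp : p ∈ jointLaws PS W) {R : ℝ × ℝ}
    (hR₁ : 0 ≤ R.1) (hR₂ : 0 ≤ R.2) (h₁ : R.1 ≤ bound₁ p) (h₂ : R.2 ≤ bound₂ p)
    (h : R.1 + R.2 ≤ boundSum p) : R ∈ capacityRegion PS W := by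
  rcases (add_nonneg hR₁ hR₂).eq_or_lt with h0 | h0
  · have hR : R = (0, 0) := Prod.ext (by linarith) (by linarith)
    obtain ⟨PU, Q₁, Q₂, hPU, hQ₁, hQ₂, -⟩ := hp
    let τ : TestChannel S₁ S₂ U V₁ V₂ X₁ X₂ Y := ⟨PS, PU, Q₁, Q₂, W, hPS, hPU, hQ₁, hQ₂, hW⟩
    obtain ⟨ω, -⟩ := Finset.exists_ne_zero_of_sum_ne_zero
      (τ.joint_mem.2.trans_ne one_ne_zero)
    rw [hR]
    exact subset_closure (zero_mem_achievableRates ω.x₁ ω.x₂)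
  · have hmul : ∀ {r δ : ℝ}, 0 < r → 0 < δ → (1 - δ) * r < r := fun hr hδ => by
      nlinarith [mul_pos hδ hr]
    have hlim : Tendsto (fun δ : ℝ => ((1 - δ) * R.1, (1 - δ) * R.2)) (𝓝[>] 0) (𝓝 R) := by
      have hc : Continuous fun δ : ℝ => ((1 - δ) * R.1, (1 - δ) * R.2) := by fun_prop
      have := hc.tendsto 0
      simp only [sub_zero, one_mul] at this
      exact this.mono_left nhdsWithin_le_nhds
    refine mem_closure_of_tendsto hlim ?_
    filter_upwards [Ioo_mem_nhdsGT one_pos] with δ hδ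
    have h1 : 0 ≤ 1 - δ := sub_nonneg.mpr hδ.2.le
    refine mem_achievableRates_of_lt hPS hW hp (mul_nonneg h1 hR₁) (mul_nonneg h1 hR₂) ?_ ?_ ?_
    · rcases hR₁.eq_or_lt with hr | hr
      · exact Or.inl (by simp [← hr])
      · exact Or.inr ((hmul hr hδ.1).trans_le h₁)
    · rcases hR₂.eq_or_lt with hr | hr
      · exact Or.inl (by simp [← hr])
      · exact Or.inr ((hmul hr hδ.1).trans_le h₂)
    · have := hmul h0 hδ.1
      linarith

end Region

end CribMAC

open CribMAC
theorem theorem1 {S₁ S₂ X₁ X₂ Y : Type*}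
    [Fintype S₁] [Fintype S₂] [Fintype X₁] [Fintype X₂] [Fintype Y]
    (PS : S₁ × S₂ → ℝ) (hPS : PS ∈ stdSimplex ℝ (S₁ × S₂))
    (W : X₁ → X₂ → S₁ → S₂ → Y → ℝ) (hW : ∀ x₁ x₂ s₁ s₂, W x₁ x₂ s₁ s₂ ∈ stdSimplex ℝ Y) :
    rateRegion PS W ⊆ capacityRegion PS W ∧ strictRateRegion PS W ⊆ achievableRates PS W := by
  constructor
  · rintro R ⟨U, V₁, V₂, _, _, _, p, hp, hR₁, hR₂, h₁, h₂, h⟩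
    exact mem_capacityRegion_of_le hPS hW hp hR₁ hR₂ h₁ h₂ h
  · rintro R ⟨U, V₁, V₂, _, _, _, p, hp, hR₁, hR₂, h₁, h₂, h⟩
    exact mem_achievableRates_of_lt hPS hW hp hR₁ hR₂ (Or.inr h₁) (Or.inr h₂) h
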